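/- **Theorem.** The search problem Banach is CLS-complete, and each of its instances has a solution. The notions are as follows. *Arithmetic circuits.* An arithmetic circuit with $n$ inputs and $m$ outputs is a finite directed acyclic graph whose in-degree-$0$ nodes are the $n$ inputs and gates that output a rational constant, and whose other nodes are binary gates from $\{+,-,*,\max,\min,>\}$, where $>(a,b)=1$ if $a>b$ and $0$ otherwise; $m$ nodes are designated as outputs. It computes a function $\mathbb R^n\to\mathbb R^m$. Circuits are coded by bit strings in the usual way, rational constants being written in binary. *Search problems.* In a search problem $P$ every instance $I$ is coded (injectively) by a bit string, and the solutions of $I$ form a set $P(I)\subseteq\mathbb R^{\dim I}$. A polynomial-time reduction from $P$ to $Q$ consists of two maps that are computable in polynomial time by Turing machines: a map $\varphi$ from the instances of $P$ to the instances of $Q$, and a map that sends every instance $I$ of $P$ to an arithmetic circuit $\psi_I$ such that $\psi_I(s)\in P(I)$ for every $s\in Q(\varphi(I))$. *ContinuousLocalOpt and CLS.* An instance of ContinuousLocalOpt consists of functions $f:[0,1]^3\to[0,1]^3$ and $p:[0,1]^3\to[0,1]$, represented by arithmetic circuits, and rational numbers $\varepsilon,\lambda>0$. A solution consists of points $x,x'\in[0,1]^3$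 satisfying at least one of 1. $p(f(x))\ge p(x)-\varepsilon$ (here $x'$ is irrelevant); 2. $|f(x)-f(x')|_1>\lambda|x-x'|_1$; 3. $|p(x)-p(x')|>\lambda|x-x'|_1$. CLS is the class of the search problems that have a polynomial-time reduction to ContinuousLocalOpt. A search problem is CLS-complete if it belongs to CLS and every problem in CLS has a polynomial-time reduction to it. *Banach.* An instance of Banach consists of functions $f:[0,1]^3\to[0,1]^3$ and $d:[0,1]^3\times[0,1]^3\to\mathbb R$, represented by arithmetic circuits, and rational numbers $\varepsilon,\lambda>0$ and $0<c<1$; it is not promised that $d$ is a metric. A solution consists of points $x_1,x_2,y_1,y_2\in[0,1]^3$ satisfying at least one of the following (points that are not mentioned are irrelevant): 1. $d(x_1,f(x_1))\le\varepsilon$; 2. $d(f(x_1),f(x_2))>c\cdot d(x_1,x_2)$; 3. $|f(x_1)-f(x_2)|_1>\lambda|x_1-x_2|_1$; 4. $x_1\ne x_2$, $y_1\ne y_2$ and $|d(x_1,x_2)-d(y_1,y_2)|>\lambda\left(|x_1-y_1|_1+|x_2-y_2|_1\right)$; 5. $x=x_1$, $y=x_2$, $z=y_1$ violate a metric axiom: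 $d(x,y)<0$, or exactly one of $d(x,y)=0$ and $x=y$ holds, or $d(x,y)\ne d(y,x)$, or $d(x,y)>d(x,z)+d(z,y)$. -/

import Mathlib

namespace BanachCLS

/-! ### Arithmetic circuits -/

/-- A non-input gate of an arithmetic circuit. The arguments are the numbers of earlier wires;
`const q` outputs the rational constant `q`, and `gt i j` outputs `1` if (wire `i`) > (wire `j`)
and `0` otherwise. -/
inductive Gate where
  | const (q : ℚ)
  | add (i j : ℕ)
  | sub (i j : ℕ)
  | mul (i j : ℕ)
  | max (i j : ℕ)
  | min (i j : ℕ)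
  | gt (i j : ℕ)

/-- The value of a gate, given the values of all earlier wires. -/
noncomputable def Gate.eval (w : ℕ → ℝ) : Gate → ℝ
  | .const q => (q : ℝ)
  | .add i j => w i + w j
  | .sub i j => w i - w j
  | .mul i j => w i * w j
  | .max i j => Max.max (w i) (w j)
  | .min i j => Min.min (w i) (w j)
  | .gt i j => if w i > w j then 1 else 0

/-- All the wires that the gate reads have a number smaller than `k`. -/
def Gate.RefsLT (k : ℕ) : Gate → Prop
  | .const _ => True
  | .add i j => i < k ∧ j < k
  | .sub i j => i < k ∧ j < k
  | .mul i j => i < k ∧ j < k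
  | .max i j => i < k ∧ j < k
  | .min i j => i < k ∧ j < k
  | .gt i j => i < k ∧ j < k

/-- A list of gates is topologically sorted when `k` wires precede it. -/
def GatesWF : ℕ → List Gate → Prop
  | _, [] => True
  | k, g :: gs => g.RefsLT k ∧ GatesWF (k + 1) gs

/-- Evaluate a list of gates in order, each one appending its value to the list of wire values. -/
noncomputable def runGates : List Gate → List ℝ → List ℝ
  | [], v => v
  | g :: gs, v => runGates gs (v ++ [g.eval (fun i => v.getD i 0)])

/-- An arithmetic circuit with `n` inputs and `m` outputs: a directed acyclic graph, listed in
topological order. The wires `0, …, n - 1` are the inputs, wire `n + k` is the output of the `k`-th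
gate, and `outputs` says which wires are the outputs of the circuit. -/
structure ArithCircuit (n m : ℕ) where
  gates : List Gate
  outputs : Fin m → ℕ
  gates_wf : GatesWF n gates
  outputs_lt : ∀ j, outputs j < n + gates.length

/-- The function `ℝⁿ → ℝᵐ` computed by a circuit. -/
noncomputable def ArithCircuit.eval {n m : ℕ} (C : ArithCircuit n m) (x : Fin n → ℝ) :
    Fin m → ℝ :=
  fun j => (runGates C.gates (List.ofFn x)).getD (C.outputs j) 0

/-! ### Encodings by bit strings -/

/-- Self-delimiting code of a bit string. -/
def encBits (l : List Bool) : List Bool := l.flatMap (fun b => [true, b]) ++ [false]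

/-- Code of a wire number. Wire numbers are bounded by the number of wires of the circuit, so
writing them in unary makes the length of the code of a circuit at most quadratic in its size. -/
def encWire (n : ℕ) : List Bool := List.replicate n true ++ [false]

/-- Code of a rational number: sign, and numerator and denominator (in lowest terms) in binary. -/
def encRat (q : ℚ) : List Bool :=
  decide (q.num < 0) :: (encBits q.num.natAbs.bits ++ encBits q.den.bits)

/-- Code of a gate. -/
def encGate : Gate → List Bool
  | .const q => [false, false, false] ++ encRat q
  | .add i j => [false, false, true] ++ (encWire i ++ encWire j)
  | .sub i j => [false, true, false] ++ (encWire i ++ encWire j)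
  | .mul i j => [false, true, true] ++ (encWire i ++ encWire j)
  | .max i j => [true, false, false] ++ (encWire i ++ encWire j)
  | .min i j => [true, false, true] ++ (encWire i ++ encWire j)
  | .gt i j => [true, true, false] ++ (encWire i ++ encWire j)

/-- Code of a list, from a code of its members. -/
def encList {α : Type} (e : α → List Bool) (l : List α) : List Bool :=
  l.flatMap (fun a => true :: e a) ++ [false]

/-- Code of a circuit. -/
def ArithCircuit.encode {n m : ℕ} (C : ArithCircuit n m) : List Bool :=
  encList encGate C.gates ++ encList encWire (List.ofFn C.outputs)

/-- `e` is injective and no code word is a proper prefix of another one. -/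
def PrefixCode {α : Type} (e : α → List Bool) : Prop :=
  ∀ a b s t, e a ++ s = e b ++ t → a = b ∧ s = t

theorem prefixCode_encList {α : Type} {e : α → List Bool} (he : PrefixCode e) :
    PrefixCode (encList e) := by
  intro a
  induction a with
  | nil => intro b s t h; cases b <;> simp_all [encList]
  | cons x xs ih =>
    intro b s t h
    cases b with
    | nil => simp [encList] at h
    | cons y ys =>
      simp only [encList, List.flatMap_cons, List.cons_append, List.append_assoc,
        List.cons.injEq, true_and] at h
      obtain ⟨rfl, h2⟩ := he _ _ _ _ h
      obtain ⟨rfl, h3⟩ := ih ys s t (by simpa [encList] using h2)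
      exact ⟨rfl, h3⟩

theorem prefixCode_encBits : PrefixCode encBits := by
  have h : PrefixCode (fun b : Bool => [b]) := by
    intro a b s t h
    simpa using h
  intro a b s t hab
  exact prefixCode_encList h a b s t hab

theorem prefixCode_encWire : PrefixCode encWire := by
  intro a
  induction a with
  | zero => intro b s t h; cases b <;> simp_all [encWire, List.replicate_succ]
  | succ a ih =>
    intro b s t h
    cases b with
    | zero => simp [encWire, List.replicate_succ] at h
    | succ b =>
      obtain ⟨rfl, h3⟩ := ih b s t (by simpa [encWire, List.replicate_succ] using h)
      exact ⟨rfl, h3⟩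

theorem bits_injective : Function.Injective Nat.bits := by
  intro a b h
  have := congrArg (fun l => Nat.ofDigits 2 (l.map (fun b => cond b 1 0))) h
  simpa only [← Nat.digits_two_eq_bits, Nat.ofDigits_digits] using this

theorem prefixCode_encRat : PrefixCode encRat := by
  intro a b s t h
  simp only [encRat, List.cons_append, List.append_assoc, List.cons.injEq] at h
  obtain ⟨h0, h⟩ := h
  obtain ⟨h1, h⟩ := prefixCode_encBits _ _ _ _ h
  obtain ⟨h2, h⟩ := prefixCode_encBits _ _ _ _ h
  have h1 := bits_injective h1
  have h2 := bits_injective h2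
  have h0 : (a.num < 0) ↔ (b.num < 0) := by simpa using h0
  exact ⟨Rat.ext (by omega) h2, h⟩

theorem prefixCode_encGate : PrefixCode encGate := by
  intro a b s t h
  cases a <;> cases b <;> simp only [encGate, List.cons_append, List.nil_append,
    List.append_assoc, List.cons.injEq, true_and, false_and, and_false,
    Bool.false_eq_true, Bool.true_eq_false] at h
  case const.const =>
    obtain ⟨rfl, h2⟩ := prefixCode_encRat _ _ _ _ h
    exact ⟨rfl, h2⟩
  all_goals
    obtain ⟨rfl, h2⟩ := prefixCode_encWire _ _ _ _ h
    obtain ⟨rfl, h3⟩ := prefixCode_encWire _ _ _ _ h2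
    exact ⟨rfl, h3⟩

theorem prefixCode_encode {n m : ℕ} : PrefixCode (ArithCircuit.encode (n := n) (m := m)) := by
  rintro ⟨g, o, hg, ho⟩ ⟨g', o', hg', ho'⟩ s t h
  simp only [ArithCircuit.encode, List.append_assoc] at h
  obtain ⟨rfl, h2⟩ := prefixCode_encList prefixCode_encGate _ _ _ _ h
  obtain ⟨h1, h3⟩ := prefixCode_encList prefixCode_encWire _ _ _ _ h2
  obtain rfl := List.ofFn_injective h1
  exact ⟨rfl, h3⟩

/-! ### Search problems and reductions -/

/-- A search problem: the instances are coded by bit strings, and a solution of an instance `I` is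
a vector of `dim I` real numbers. -/
structure SearchProblem where
  Inst : Type
  encode : Inst → List Bool
  encode_injective : Function.Injective encode
  dim : Inst → ℕ
  IsSolution : (I : Inst) → (Fin (dim I) → ℝ) → Prop

/-- Every instance has a solution. -/
def SearchProblem.Total (P : SearchProblem) : Prop :=
  ∀ I : P.Inst, ∃ s : Fin (P.dim I) → ℝ, P.IsSolution I s

/-- Polynomial-time reducibility of the search problem `P` to the search problem `Q`: one
polynomial-time Turing machine turns an instance `I` of `P` into an instance `φ I` of `Q`, and
another one turns `I` into an arithmetic circuit `ψ I` (hence of polynomial size) that maps every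
solution of `φ I` to a solution of `I`. -/
def Reducible (P Q : SearchProblem) : Prop :=
  ∃ (φ : P.Inst → Q.Inst) (ψ : (I : P.Inst) → ArithCircuit (Q.dim (φ I)) (P.dim I)),
    Nonempty (Turing.TM2ComputableInPolyTime P.encode Q.encode φ) ∧
    Nonempty (Turing.TM2ComputableInPolyTime P.encode id (fun I => (ψ I).encode)) ∧
    ∀ (I : P.Inst) (s : Fin (Q.dim (φ I)) → ℝ),
      Q.IsSolution (φ I) s → P.IsSolution I ((ψ I).eval s)

/-! ### The problem ContinuousLocalOpt and the class CLS -/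

/-- The cube `[0,1]³`. -/
def cube : Set (Fin 3 → ℝ) := {x | ∀ i, x i ∈ Set.Icc (0 : ℝ) 1}

/-- The `ℓ₁` distance of two points of `ℝ³`. -/
noncomputable def dist1 (x y : Fin 3 → ℝ) : ℝ := ∑ i, |x i - y i|

/-- The `j`-th point of a list of `k` points of `ℝ³`, given as one vector of `k * 3` numbers. -/
def point {k : ℕ} (s : Fin (k * 3) → ℝ) (j : Fin k) : Fin 3 → ℝ :=
  fun i => s (finProdFinEquiv (j, i))

/-- Instances of ContinuousLocalOpt: circuits for functions `f : [0,1]³ → [0,1]³` and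
`p : [0,1]³ → [0,1]`, and rational numbers `ε, lam > 0`. -/
structure CLOInstance where
  f : ArithCircuit 3 3
  p : ArithCircuit 3 1
  ε : ℚ
  lam : ℚ
  f_mapsTo : ∀ x ∈ cube, f.eval x ∈ cube
  p_mem : ∀ x ∈ cube, p.eval x 0 ∈ Set.Icc (0 : ℝ) 1
  ε_pos : 0 < ε
  lam_pos : 0 < lam

def CLOInstance.encode (I : CLOInstance) : List Bool :=
  I.f.encode ++ (I.p.encode ++ (encRat I.ε ++ encRat I.lam))

theorem CLOInstance.encode_injective : Function.Injective CLOInstance.encode := by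
  rintro ⟨f, p, e, l, _, _, _, _⟩ ⟨f', p', e', l', _, _, _, _⟩ h
  simp only [CLOInstance.encode] at h
  obtain ⟨rfl, h2⟩ := prefixCode_encode _ _ _ _ h
  obtain ⟨rfl, h3⟩ := prefixCode_encode _ _ _ _ h2
  obtain ⟨rfl, h4⟩ := prefixCode_encRat _ _ _ _ h3
  obtain ⟨rfl, -⟩ := prefixCode_encRat l l' [] [] (by simpa using h4)
  rfl

/-- The pair `(x, x')` solves the instance: `x` is an approximate local optimum, or the pair
violates the Lipschitz continuity of `f`, or that of `p`. -/
def CLOInstance.Solves (I : CLOInstance) (x x' : Fin 3 → ℝ) : Prop :=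
  I.p.eval (I.f.eval x) 0 ≥ I.p.eval x 0 - I.ε ∨
  dist1 (I.f.eval x) (I.f.eval x') > I.lam * dist1 x x' ∨
  |I.p.eval x 0 - I.p.eval x' 0| > I.lam * dist1 x x'

/-- The search problem ContinuousLocalOpt. A solution consists of two points of the cube (the
second one is arbitrary if the first one is an approximate local optimum). -/
def ContinuousLocalOpt : SearchProblem where
  Inst := CLOInstance
  encode := CLOInstance.encode
  encode_injective := CLOInstance.encode_injective
  dim _ := 2 * 3
  IsSolution I s := (∀ j, point s j ∈ cube) ∧ I.Solves (point s 0) (point s 1)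

/-- The class CLS. -/
def CLS : Set SearchProblem := {P | Reducible P ContinuousLocalOpt}

/-- `P` is CLS-complete. -/
def CLSComplete (P : SearchProblem) : Prop :=
  P ∈ CLS ∧ ∀ Q ∈ CLS, Reducible Q P

/-! ### The problem Banach -/

/-- Instances of Banach: circuits for functions `f : [0,1]³ → [0,1]³` and
`d : [0,1]³ × [0,1]³ → ℝ`, and rational numbers `ε, lam > 0` and `0 < c < 1`. -/
structure BanachInstance where
  f : ArithCircuit 3 3
  d : ArithCircuit (3 + 3) 1
  ε : ℚ
  lam : ℚ
  c : ℚ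
  f_mapsTo : ∀ x ∈ cube, f.eval x ∈ cube
  ε_pos : 0 < ε
  lam_pos : 0 < lam
  c_pos : 0 < c
  c_lt_one : c < 1

def BanachInstance.encode (I : BanachInstance) : List Bool :=
  I.f.encode ++ (I.d.encode ++ (encRat I.ε ++ (encRat I.lam ++ encRat I.c)))

theorem BanachInstance.encode_injective : Function.Injective BanachInstance.encode := by
  rintro ⟨f, p, e, l, c, _, _, _, _, _⟩ ⟨f', p', e', l', c', _, _, _, _, _⟩ h
  simp only [BanachInstance.encode] at h
  obtain ⟨rfl, h2⟩ := prefixCode_encode _ _ _ _ h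
  obtain ⟨rfl, h3⟩ := prefixCode_encode _ _ _ _ h2
  obtain ⟨rfl, h4⟩ := prefixCode_encRat _ _ _ _ h3
  obtain ⟨rfl, h5⟩ := prefixCode_encRat _ _ _ _ h4
  obtain ⟨rfl, -⟩ := prefixCode_encRat c c' [] [] (by simpa using h5)
  rfl

/-- The function `d : [0,1]³ × [0,1]³ → ℝ` given by the circuit. -/
noncomputable def BanachInstance.dd (I : BanachInstance) (x y : Fin 3 → ℝ) : ℝ :=
  I.d.eval (Fin.append x y) 0

/-- The points `x, y, z` violate one of the axioms of a metric: non-negativity,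
`d x y = 0 ↔ x = y`, symmetry, or the triangle inequality. -/
def BanachInstance.MetricViolation (I : BanachInstance) (x y z : Fin 3 → ℝ) : Prop :=
  I.dd x y < 0 ∨
  ¬ (I.dd x y = 0 ↔ x = y) ∨
  I.dd x y ≠ I.dd y x ∨
  I.dd x y > I.dd x z + I.dd z y

/-- The points `x₁, x₂, y₁, y₂` solve the instance: `x₁` is an approximate fixed point, or `x₁, x₂`
violate the contraction of `f`, or `x₁, x₂` violate the Lipschitz continuity of `f`, or the four
points violate the Lipschitz continuity of `d`, or `x₁, x₂, y₁` violate an axiom of a metric. -/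
def BanachInstance.Solves (I : BanachInstance) (x₁ x₂ y₁ y₂ : Fin 3 → ℝ) : Prop :=
  I.dd x₁ (I.f.eval x₁) ≤ I.ε ∨
  I.dd (I.f.eval x₁) (I.f.eval x₂) > I.c * I.dd x₁ x₂ ∨
  dist1 (I.f.eval x₁) (I.f.eval x₂) > I.lam * dist1 x₁ x₂ ∨
  (x₁ ≠ x₂ ∧ y₁ ≠ y₂ ∧
    |I.dd x₁ x₂ - I.dd y₁ y₂| > I.lam * (dist1 x₁ y₁ + dist1 x₂ y₂)) ∨
  I.MetricViolation x₁ x₂ y₁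

/-- The search problem Banach. A solution consists of four points of the cube (those that the
alternative in question does not mention are arbitrary). -/
def Banach : SearchProblem where
  Inst := BanachInstance
  encode := BanachInstance.encode
  encode_injective := BanachInstance.encode_injective
  dim _ := 4 * 3
  IsSolution I s :=
    (∀ j, point s j ∈ cube) ∧ I.Solves (point s 0) (point s 1) (point s 2) (point s 3)

end BanachCLS

open Turing

namespace BanachCLS

/-! ### Structured programs over bit stacks -/

/-! Totality is Picard iteration. Along the orbit of the origin under `f`, if no contraction is
violated then `d(xₙ, xₙ₊₁) ≤ cⁿ d(x₀, x₁)`, which drops below `ε`. The metric axioms play no role.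

Membership in CLS uses the distance `d(x, f x)` as potential. Since `d` is not promised to be
bounded, its value at a fixed pair of points is subtracted; the Lipschitz clause confines the
difference to an interval of known length, and scaling by `2 ^ (-K)`, shifting and clamping give
values in `[0,1]`. If the potential drops by at most `4 ^ (-K)` from `x` to `f x`, then `d` drops by
at most `2 ^ (-K) ≤ (1 - c) ε`, and this is incompatible with contraction unless `d(x, f x) ≤ ε`. A
Lipschitz violation of the potential comes from one of `f` or `d`, or from a degenerate point. This
is `BanachInstance.exists_solves`.

For hardness, the distance of different points is `1 + max (p x) (p y)`. This is a metric whatever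
`p : cube → [0,1]` is, because it takes values in `{0} ∪ [1,2]`. If `p` drops by more than `ε` at
both points, distances shrink by more than `ε`, hence by a factor below `1 - δ` as soon as `2 δ ≤
ε`; so a contraction violation exposes an approximate local optimum. The metric jumps at the
diagonal, which is harmless because the Lipschitz clause for `d` only concerns pairs of different
points. This is `CLOInstance.exists_solves`.

Both arguments only say that one of finitely many candidates is a solution. Circuits can compare
numbers exactly, so every solution condition has a circuit with value `0` or `1` (`Ind`), and a
circuit can select the first good candidate (`vals_pick`).

The remaining work is to realize the reductions by Turing machines. Structured programs over bit
stacks are compiled to machines (`computable_of_runs`), with other machines as callable subroutines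
(`Runs.call`). The circuits needed are values of fixed expressions over the circuits of the
instance; `compile` turns an expression into gates, `sound_compile` shows that they compute the
right value, and `emits_compile` that a program writes their code in polynomial time. The exponent
`K` is the length of the code of the instance, so powers of two are written by repeating fixed bits
and no arithmetic on numerals is needed. A machine cannot write more than its running time allows
(`exists_length_stk_le`), which keeps intermediate stacks polynomial in size. -/

/-- Programs that operate on finitely many stacks of bits, indexed by `R`. The command `call i r`
runs the `i`-th machine of a given family on the reversal of stack `r`. -/
inductive Prog (R ι : Type) where
  | skip
  | push (r : R) (b : Bool)
  | seq (p q : Prog R ι)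
  | case (r : R) (p q : Prog R ι)
  | loopT (r : R) (p : Prog R ι)
  | loopS (r : R) (p q : Prog R ι)
  | call (i : ι) (r : R)

section Compile

variable {R ι : Type} [DecidableEq R] [DecidableEq ι]
  (M : ι → TM2ComputableAux Bool Bool)

/-- Stack alphabets of the compiled machine. -/
@[reducible] def Alph (R : Type) {ι : Type} (M : ι → TM2ComputableAux Bool Bool) :
    R ⊕ (Σ i, (M i).tm.K) → Type
  | .inl _ => Bool
  | .inr x => (M x.1).tm.Γ x.2

/-- Control states of the compiled machine. -/
abbrev Ctl {ι : Type} (M : ι → TM2ComputableAux Bool Bool) : Type :=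
  Option Bool × (∀ i, (M i).tm.σ)

/-- Labels of a compiled program. -/
def Lab : Prog R ι → Type
  | .skip => Unit
  | .push _ _ => Unit
  | .seq p q => Lab p ⊕ Lab q
  | .case _ p q => Option (Lab p ⊕ Lab q)
  | .loopT _ p => Option (Lab p)
  | .loopS _ p q => Option (Lab p ⊕ Lab q)
  | .call i _ => Bool ⊕ (M i).tm.Λ

/-- There are finitely many labels. -/
@[reducible] def Lab.fintype : (p : Prog R ι) → Fintype (Lab M p)
  | .skip => inferInstanceAs (Fintype Unit)
  | .push _ _ => inferInstanceAs (Fintype Unit)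
  | .seq p q => @instFintypeSum _ _ (Lab.fintype p) (Lab.fintype q)
  | .case _ p q => @instFintypeOption _ (@instFintypeSum _ _ (Lab.fintype p) (Lab.fintype q))
  | .loopT _ p => @instFintypeOption _ (Lab.fintype p)
  | .loopS _ p q => @instFintypeOption _ (@instFintypeSum _ _ (Lab.fintype p) (Lab.fintype q))
  | .call i _ => @instFintypeSum _ _ inferInstance (M i).tm.ΛFin

/-- The label at which a compiled program starts. -/
def entry : (p : Prog R ι) → Lab M p
  | .skip => ()
  | .push _ _ => ()
  | .seq p _ => Sum.inl (entry p)
  | .case _ _ _ => none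
  | .loopT _ _ => none
  | .loopS _ _ _ => none
  | .call _ _ => Sum.inl false

variable {M} {Λ : Type}

/-- Embedding of the statements of the `i`-th machine. -/
def embStmt (i : ι) (emb : (M i).tm.Λ → Λ) (ex : Λ) :
    TM2.Stmt (M i).tm.Γ (M i).tm.Λ (M i).tm.σ → TM2.Stmt (Alph R M) Λ (Ctl M)
  | .push k f q => .push (Sum.inr ⟨i, k⟩) (fun s => f (s.2 i)) (embStmt i emb ex q)
  | .peek k f q =>
    .peek (Sum.inr ⟨i, k⟩) (fun s o => (s.1, Function.update s.2 i (f (s.2 i) o)))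
      (embStmt i emb ex q)
  | .pop k f q =>
    .pop (Sum.inr ⟨i, k⟩) (fun s o => (s.1, Function.update s.2 i (f (s.2 i) o)))
      (embStmt i emb ex q)
  | .load f q => .load (fun s => (s.1, Function.update s.2 i (f (s.2 i)))) (embStmt i emb ex q)
  | .branch f q q' => .branch (fun s => f (s.2 i)) (embStmt i emb ex q) (embStmt i emb ex q')
  | .goto l => .goto fun s => emb (l (s.2 i))
  | .halt => .goto fun _ => ex

/-- Pop a bit of stack `r` and continue at a label that depends on it. -/
def popGoto (r : R) (a b c : Λ) : TM2.Stmt (Alph R M) Λ (Ctl M) :=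
  .pop (Sum.inl r) (fun s o => (o, s.2))
    -- The popped bit is erased from the control state before the jump, so every label is reached
    -- with `none` there, as `cfg` requires.
    (.branch (fun s => s.1 == some true) (.load (fun s => (none, s.2)) (.goto fun _ => a))
      (.branch (fun s => s.1 == some false) (.load (fun s => (none, s.2)) (.goto fun _ => b))
        (.goto fun _ => c)))

variable (M)

/-- The code of a program, when its labels are embedded by `emb` and `ex` is the label at which
the computation continues afterwards. -/
def code : (p : Prog R ι) → (Lab M p → Λ) → Λ → Lab M p → TM2.Stmt (Alph R M) Λ (Ctl M)
  | .skip, _, ex, _ => .goto fun _ => ex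
  | .push r b, _, ex, _ => .push (Sum.inl r) (fun _ => b) (.goto fun _ => ex)
  | .seq p q, emb, _, .inl l =>
    code p (fun x => emb (.inl x)) (emb (.inr (entry M q))) l
  | .seq _ q, emb, ex, .inr l => code q (fun x => emb (.inr x)) ex l
  -- The third target of `popGoto` serves the empty stack: `case` treats it like the bit `false`,
  -- `loopT` stops on it as on `false`, and only `loopS` distinguishes all three situations.
  | .case r p q, emb, _, none =>
    popGoto r (emb (some (.inl (entry M p)))) (emb (some (.inr (entry M q))))
      (emb (some (.inr (entry M q))))
  | .case _ p _, emb, ex, some (.inl l) => code p (fun x => emb (some (.inl x))) ex l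
  | .case _ _ q, emb, ex, some (.inr l) => code q (fun x => emb (some (.inr x))) ex l
  | .loopT r p, emb, ex, none => popGoto r (emb (some (entry M p))) ex ex
  | .loopT _ p, emb, _, some l => code p (fun x => emb (some x)) (emb none) l
  | .loopS r p q, emb, ex, none =>
    popGoto r (emb (some (.inl (entry M p)))) (emb (some (.inr (entry M q)))) ex
  | .loopS _ p _, emb, _, some (.inl l) => code p (fun x => emb (some (.inl x))) (emb none) l
  | .loopS _ _ q, emb, _, some (.inr l) => code q (fun x => emb (some (.inr x))) (emb none) l
  -- Label `inl false` feeds `r` to the machine bit by bit, which reverses it, and label `inl true`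
  -- moves the output back in the same way; so argument and result are both stored reversed in `r`.
  | .call i r, emb, _, .inl false =>
    .pop (Sum.inl r) (fun s o => (o, s.2))
      (.branch (fun s => s.1.isSome)
        (.push (Sum.inr ⟨i, (M i).tm.k₀⟩) (fun s => (M i).inputAlphabet.symm (s.1.getD false))
          (.load (fun s => (none, s.2)) (.goto fun _ => emb (.inl false))))
        (.goto fun _ => emb (.inr (M i).tm.main)))
  | .call i r, emb, ex, .inl true =>
    .pop (Sum.inr ⟨i, (M i).tm.k₁⟩) (fun s o => (o.map (M i).outputAlphabet, s.2))
      (.branch (fun s => s.1.isSome)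
        (.push (Sum.inl r) (fun s => s.1.getD false)
          (.load (fun s => (none, s.2)) (.goto fun _ => emb (.inl true))))
        (.goto fun _ => ex))
  | .call i _, emb, _, .inr l =>
    embStmt i (fun x => emb (.inr x)) (emb (.inl true)) ((M i).tm.m l)

/-- `f` leads from `c` to `c'` in at most `T` steps. -/
def StepsLE {C : Type} (f : C → Option C) (T : ℕ) (c c' : C) : Prop :=
  ∃ t ≤ T, (flip bind f)^[t] (some c) = some c'

theorem StepsLE.single {C : Type} {f : C → Option C} {c c' : C} (h : f c = some c') :
    StepsLE f 1 c c' :=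
  ⟨1, le_rfl, by simpa [flip] using h⟩

theorem StepsLE.trans {C : Type} {f : C → Option C} {T U : ℕ} {a b c : C}
    (h : StepsLE f T a b) (h' : StepsLE f U b c) : StepsLE f (T + U) a c := by
  obtain ⟨t, ht, e⟩ := h
  obtain ⟨u, hu, e'⟩ := h'
  exact ⟨u + t, by omega, by rw [Function.iterate_add_apply, e, e']⟩

theorem StepsLE.mono {C : Type} {f : C → Option C} {T U : ℕ} {a b : C}
    (h : StepsLE f T a b) (hTU : T ≤ U) : StepsLE f U a b := by
  obtain ⟨t, ht, e⟩ := h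
  exact ⟨t, ht.trans hTU, e⟩

/-- The stacks of the compiled machine, assembled from the bit stacks and the stacks of the
embedded machines. -/
def stkOf (S : R → List Bool) (W : ∀ i, ∀ k, List ((M i).tm.Γ k)) :
    ∀ x : R ⊕ (Σ i, (M i).tm.K), List (Alph R M x)
  | .inl r => S r
  | .inr x => W x.1 x.2

theorem update_stkOf_inl (S : R → List Bool) (W) (r : R) (l : List Bool) :
    Function.update (stkOf M S W) (Sum.inl r) l = stkOf M (Function.update S r l) W := by
  funext x
  rcases x with x | x
  · by_cases h : x = r
    · subst h; simp [stkOf]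
    · rw [Function.update_of_ne (by simpa using h)]
      simp [stkOf, h]
  · rw [Function.update_of_ne (by simp)]
    rfl

theorem update_stkOf_inr (S : R → List Bool) (W) (i : ι) (k : (M i).tm.K)
    (l : List ((M i).tm.Γ k)) :
    Function.update (stkOf M S W) (Sum.inr ⟨i, k⟩) l =
      stkOf M S (Function.update W i (Function.update (W i) k l)) := by
  funext x
  rcases x with x | ⟨j, k'⟩
  · rw [Function.update_of_ne (by simp)]
    rfl
  · by_cases h : j = i
    · subst h
      by_cases h' : k' = k
      · subst h'; simp [stkOf]
      · rw [Function.update_of_ne (by simpa using h')]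
        simp [stkOf, h']
    · rw [Function.update_of_ne (by simp [h])]
      simp [stkOf, h]

/-- The initial control states of the embedded machines. -/
def idleCtl : ∀ i, (M i).tm.σ := fun i => (M i).tm.initialState

/-- The empty stacks of the embedded machines. -/
def idleStk : ∀ i, ∀ k, List ((M i).tm.Γ k) := fun _ _ => []

/-- The configuration at label `l` with bit stacks `S`, all embedded machines being idle. -/
def cfg (l : Λ) (S : R → List Bool) : TM2.Cfg (Alph R M) Λ (Ctl M) :=
  ⟨some l, (none, idleCtl M), stkOf M S (idleStk M)⟩

/-- Any machine that contains the code of `p` gets from the entry of `p`, with bit stacks `S`, to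
the exit of `p`, with bit stacks `S'`, in at most `T` steps. -/
def Runs (p : Prog R ι) (S : R → List Bool) (T : ℕ) (S' : R → List Bool) : Prop :=
  -- The surrounding machine and the embedding of labels are arbitrary, so a fact about a subprogram
  -- applies wherever the subprogram occurs.
  ∀ (Λ : Type) (m : Λ → TM2.Stmt (Alph R M) Λ (Ctl M)) (emb : Lab M p → Λ) (ex : Λ),
    (∀ l, m (emb l) = code M p emb ex l) →
      StepsLE (TM2.step m) T (cfg M (emb (entry M p)) S) (cfg M ex S')

variable {M} {S S' S'' : R → List Bool} {T T' U : ℕ} {p q : Prog R ι} {r : R}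

theorem Runs.mono (h : Runs M p S T S') (hT : T ≤ U) : Runs M p S U S' :=
  fun Λ m emb ex hm => (h Λ m emb ex hm).mono hT

theorem Runs.congr (h : Runs M p S T S') (hT : T ≤ U) (hS : S' = S'') : Runs M p S U S'' :=
  hS ▸ h.mono hT

theorem step_cfg {m : Λ → TM2.Stmt (Alph R M) Λ (Ctl M)} {l : Λ} {s : TM2.Stmt (Alph R M) Λ (Ctl M)}
    (h : m l = s) : TM2.step m (cfg M l S) =
      some (TM2.stepAux s (none, idleCtl M) (stkOf M S (idleStk M))) := by
  subst h; rfl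

theorem Runs.skip : Runs M .skip S 1 S := by
  intro Λ m emb ex hm
  apply StepsLE.single
  exact step_cfg (hm (entry M .skip))

theorem Runs.push (b : Bool) : Runs M (.push r b) S 1 (Function.update S r (b :: S r)) := by
  intro Λ m emb ex hm
  apply StepsLE.single
  refine (step_cfg (hm (entry M (.push r b)))).trans ?_
  simp [cfg, code, update_stkOf_inl, stkOf]

theorem Runs.seq (h : Runs M p S T S') (h' : Runs M q S' U S'') :
    Runs M (.seq p q) S (T + U) S'' := by
  intro Λ m emb ex hm
  exact (h Λ m (fun x => emb (.inl x)) (emb (.inr (entry M q))) fun l => hm (.inl l)).trans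
    (h' Λ m (fun x => emb (.inr x)) ex fun l => hm (.inr l))

theorem stepAux_popGoto_cons (a b c : Λ) {x : Bool} {l : List Bool} (h : S r = x :: l) :
    TM2.stepAux (popGoto r a b c) (none, idleCtl M) (stkOf M S (idleStk M)) =
      cfg M (cond x a b) (Function.update S r l) := by
  cases x <;> simp [popGoto, cfg, update_stkOf_inl, stkOf, h]

theorem stepAux_popGoto_nil (a b c : Λ) (h : S r = []) :
    TM2.stepAux (popGoto r a b c) (none, idleCtl M) (stkOf M S (idleStk M)) = cfg M c S := by
  have : Function.update S r [] = S := by rw [← h, Function.update_eq_self]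
  simp [popGoto, cfg, update_stkOf_inl, stkOf, h, this]

theorem Runs.case_true {l : List Bool} (hS : S r = true :: l)
    (h : Runs M p (Function.update S r l) T S') : Runs M (.case r p q) S (1 + T) S' := by
  intro Λ m emb ex hm
  refine StepsLE.trans (StepsLE.single ?_) 
    (h Λ m (fun x => emb (some (.inl x))) ex fun l => hm (some (.inl l)))
  exact (step_cfg (hm none)).trans (congrArg some (stepAux_popGoto_cons _ _ _ hS))

theorem Runs.case_false {l : List Bool} (hS : S r = false :: l)
    (h : Runs M q (Function.update S r l) T S') : Runs M (.case r p q) S (1 + T) S' := by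
  intro Λ m emb ex hm
  refine StepsLE.trans (StepsLE.single ?_) 
    (h Λ m (fun x => emb (some (.inr x))) ex fun l => hm (some (.inr l)))
  exact (step_cfg (hm none)).trans (congrArg some (stepAux_popGoto_cons _ _ _ hS))

theorem Runs.loopT_false {l : List Bool} (hS : S r = false :: l) :
    Runs M (.loopT r p) S 1 (Function.update S r l) := by
  intro Λ m emb ex hm
  refine StepsLE.single ?_
  exact (step_cfg (hm none)).trans (congrArg some (stepAux_popGoto_cons _ _ _ hS))

theorem Runs.loopT_true {l : List Bool} (hS : S r = true :: l)
    (h : Runs M p (Function.update S r l) T S') (h' : Runs M (.loopT r p) S' U S'') :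
    Runs M (.loopT r p) S (1 + T + U) S'' := by
  intro Λ m emb ex hm
  refine (StepsLE.trans (StepsLE.single ?_) 
    (h Λ m (fun x => emb (some x)) (emb none) fun l => hm (some l))).trans
    (h' Λ m emb ex hm)
  exact (step_cfg (hm none)).trans (congrArg some (stepAux_popGoto_cons _ _ _ hS))

theorem Runs.loopS_nil (hS : S r = []) : Runs M (.loopS r p q) S 1 S := by
  intro Λ m emb ex hm
  refine StepsLE.single ?_
  exact (step_cfg (hm none)).trans (congrArg some (stepAux_popGoto_nil _ _ _ hS))

theorem Runs.loopS_cons {b : Bool} {l : List Bool} (hS : S r = b :: l)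
    (h : Runs M (cond b p q) (Function.update S r l) T S')
    (h' : Runs M (.loopS r p q) S' U S'') :
    Runs M (.loopS r p q) S (1 + T + U) S'' := by
  intro Λ m emb ex hm
  cases b
  · refine (StepsLE.trans (StepsLE.single ?_)
      (h Λ m (fun x => emb (some (.inr x))) (emb none) fun l => hm (some (.inr l)))).trans
      (h' Λ m emb ex hm)
    exact (step_cfg (hm none)).trans (congrArg some (stepAux_popGoto_cons _ _ _ hS))
  · refine (StepsLE.trans (StepsLE.single ?_)
      (h Λ m (fun x => emb (some (.inl x))) (emb none) fun l => hm (some (.inl l)))).trans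
      (h' Λ m emb ex hm)
    exact (step_cfg (hm none)).trans (congrArg some (stepAux_popGoto_cons _ _ _ hS))

/-- The configuration of the compiled machine that corresponds to a configuration of the `i`-th
machine. -/
def embCfg (i : ι) (emb : (M i).tm.Λ → Λ) (ex : Λ) (S : R → List Bool)
    (c : TM2.Cfg (M i).tm.Γ (M i).tm.Λ (M i).tm.σ) : TM2.Cfg (Alph R M) Λ (Ctl M) :=
  ⟨some (c.l.elim ex emb), (none, Function.update (idleCtl M) i c.var),
    stkOf M S (Function.update (idleStk M) i c.stk)⟩

/-- Embedded commands touch only component `i` of the control state and the stacks of machine `i`,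
and `halt` becomes a jump to the exit label. -/
theorem stepAux_embStmt (i : ι) (emb : (M i).tm.Λ → Λ) (ex : Λ) (S : R → List Bool)
    (s : TM2.Stmt (M i).tm.Γ (M i).tm.Λ (M i).tm.σ) (v : (M i).tm.σ)
    (stk : ∀ k, List ((M i).tm.Γ k)) :
    TM2.stepAux (embStmt i emb ex s) (none, Function.update (idleCtl M) i v)
      (stkOf M S (Function.update (idleStk M) i stk)) =
    embCfg i emb ex S (TM2.stepAux s v stk) := by
  induction s generalizing v stk with
  | push k f q ih =>
    simp only [embStmt, TM2.stepAux, update_stkOf_inr, stkOf, Function.update_self,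
      Function.update_idem, ← ih]
  | peek k f q ih =>
    simp only [embStmt, TM2.stepAux, stkOf, Function.update_self,
      Function.update_idem, ← ih]
  | pop k f q ih =>
    simp only [embStmt, TM2.stepAux, update_stkOf_inr, stkOf, Function.update_self,
      Function.update_idem, ← ih]
  | load f q ih =>
    simp only [embStmt, TM2.stepAux, Function.update_self, Function.update_idem, ← ih]
  | branch f q q' ih ih' =>
    simp only [embStmt, TM2.stepAux, Function.update_self]
    cases f v <;> simp only [cond, ih, ih']
  | goto l => simp [embStmt, TM2.stepAux, embCfg]
  | halt => simp [embStmt, TM2.stepAux, embCfg]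

/-- The simulation is step for step, so the number of steps is preserved. A halted configuration has
no successor, hence it cannot occur before the end of a run that ends in a configuration. -/
theorem iterate_embCfg (i : ι) (emb : (M i).tm.Λ → Λ) (ex : Λ) (S : R → List Bool)
    (m : Λ → TM2.Stmt (Alph R M) Λ (Ctl M)) (hm : ∀ l, m (emb l) = embStmt i emb ex ((M i).tm.m l))
    (t : ℕ) (c c' : TM2.Cfg (M i).tm.Γ (M i).tm.Λ (M i).tm.σ)
    (h : (flip bind (TM2.step (M i).tm.m))^[t] (some c) = some c') :
    (flip bind (TM2.step m))^[t] (some (embCfg i emb ex S c)) = some (embCfg i emb ex S c') := by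
  induction t generalizing c with
  | zero => simp only [Function.iterate_zero, id, Option.some.injEq] at h ⊢; rw [h]
  | succ t ih =>
    rw [Function.iterate_succ_apply] at h ⊢
    have hnone : ∀ t, (flip bind (TM2.step (M i).tm.m))^[t] none = none := by
      intro t
      induction t with
      | zero => rfl
      | succ t ih => rw [Function.iterate_succ_apply]; simpa [flip] using ih
    obtain ⟨_ | l, v, stk⟩ := c
    · rw [show flip bind (TM2.step (M i).tm.m) (some ⟨none, v, stk⟩) = none from rfl, hnone] at h
      exact absurd h (by simp)
    · simp only [flip, Option.bind_eq_bind, Option.bind_some, TM2.step] at h ⊢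
      rw [← ih _ h]
      simp only [embCfg, Option.elim, hm]
      rw [stepAux_embStmt]
      rfl

theorem initList_stk (tm : FinTM2) (s : List (tm.Γ tm.k₀)) :
    (initList tm s).stk = Function.update (fun _ => []) tm.k₀ s := by
  funext k
  by_cases h : k = tm.k₀
  · subst h; simp [initList]
  · simp [initList, h]

theorem haltList_stk (tm : FinTM2) (s : List (tm.Γ tm.k₁)) :
    (haltList tm s).stk = Function.update (fun _ => []) tm.k₁ s := by
  funext k
  by_cases h : k = tm.k₁
  · subst h; simp [haltList]
  · simp [haltList, h]

/-- Three phases: load the input, simulate, unload the output. A machine halts in its initial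
control state with all stacks but the output stack empty (`haltList`), so after unloading it is idle
again and ready for another call. -/
theorem Runs.call (i : ι) (r : R) (l l' : List Bool) (t : ℕ)
    (h : Nonempty (TM2OutputsInTime (M i).tm (l.map (M i).inputAlphabet.symm)
      (some (l'.map (M i).outputAlphabet.symm)) t)) (S : R → List Bool)
    (hS : S r = l.reverse) :
    Runs M (.call i r) S (l.length + 1 + t + (l'.length + 1))
      (Function.update S r l'.reverse) := by
  intro Λ m (emb : Bool ⊕ (M i).tm.Λ → Λ) ex hm
  have hm0 : m (emb (.inl false)) = code M (.call i r) emb ex (.inl false) := hm _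
  have hm1 : m (emb (.inl true)) = code M (.call i r) emb ex (.inl true) := hm _
  have hm2 : ∀ l, m (emb (.inr l)) =
    embStmt i (fun x => emb (.inr x)) (emb (.inl true)) ((M i).tm.m l) := fun l => hm (.inr l)
  simp only [code] at hm0 hm1
  -- Here `w` is the part of the input that has already been loaded.
  have hin : ∀ (l : List Bool) (w : List Bool) (S : R → List Bool), S r = l →
      StepsLE (TM2.step m) (l.length + 1)
        ⟨some (emb (.inl false)), (none, idleCtl M),
          stkOf M S (Function.update (idleStk M) i (Function.update (fun _ => []) (M i).tm.k₀
            (w.map (M i).inputAlphabet.symm)))⟩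
        ⟨some (emb (.inr (M i).tm.main)), (none, idleCtl M),
          stkOf M (Function.update S r []) (Function.update (idleStk M) i
            (Function.update (fun _ => []) (M i).tm.k₀
              ((l.reverse ++ w).map (M i).inputAlphabet.symm)))⟩ := by
    intro l
    induction l with
    | nil =>
      intro w S hS
      refine StepsLE.single ?_
      simp [TM2.step, hm0, update_stkOf_inl, stkOf, hS]
    | cons b l ih =>
      intro w S hS
      have := ih (b :: w) (Function.update S r l) (by simp)
      rw [Function.update_idem] at this
      rw [show (b :: l).reverse ++ w = l.reverse ++ b :: w by simp]
      refine StepsLE.mono (StepsLE.trans (StepsLE.single ?_) this) (by simp; omega)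
      simp [TM2.step, hm0, update_stkOf_inl, update_stkOf_inr, stkOf, hS]
  have hout : ∀ (l : List Bool) (S : R → List Bool),
      StepsLE (TM2.step m) (l.length + 1)
        ⟨some (emb (.inl true)), (none, idleCtl M),
          stkOf M S (Function.update (idleStk M) i (Function.update (fun _ => []) (M i).tm.k₁
            (l.map (M i).outputAlphabet.symm)))⟩
        (cfg M ex (Function.update S r (l.reverse ++ S r))) := by
    intro l
    induction l with
    | nil =>
      intro S
      refine StepsLE.single ?_
      have : Function.update (idleStk M) i (fun _ => []) = idleStk M := by
        conv_rhs => rw [← Function.update_eq_self i (idleStk M)]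
        rfl
      have hk : Function.update (idleStk M i) (M i).tm.k₁ [] = idleStk M i :=
        Function.update_eq_self (M i).tm.k₁ (idleStk M i)
      have hi : idleStk M i (M i).tm.k₁ = [] := rfl
      simp [TM2.step, hm1, update_stkOf_inr, stkOf, cfg, this, hk, hi]
    | cons b l ih =>
      intro S
      have := ih (Function.update S r (b :: S r))
      rw [Function.update_idem] at this
      rw [show (b :: l).reverse ++ S r = l.reverse ++ b :: S r by simp]
      rw [Function.update_self] at this
      refine StepsLE.mono (StepsLE.trans (StepsLE.single ?_) this) (by simp; omega)
      simp [TM2.step, hm1, update_stkOf_inl, update_stkOf_inr, stkOf]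
  obtain ⟨⟨⟨t', e⟩, ht'⟩⟩ := h
  have hidle : Function.update (idleCtl M) i (M i).tm.initialState = idleCtl M :=
    Function.update_eq_self i (idleCtl M)
  have hrun : StepsLE (TM2.step m) t
        ⟨some (emb (.inr (M i).tm.main)), (none, idleCtl M),
          stkOf M (Function.update S r []) (Function.update (idleStk M) i
            (Function.update (fun _ => []) (M i).tm.k₀ (l.map (M i).inputAlphabet.symm)))⟩
        ⟨some (emb (.inl true)), (none, idleCtl M),
          stkOf M (Function.update S r []) (Function.update (idleStk M) i
            (Function.update (fun _ => []) (M i).tm.k₁ (l'.map (M i).outputAlphabet.symm)))⟩ := by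
    refine ⟨t', ht', ?_⟩
    have := iterate_embCfg i (fun x => emb (.inr x)) (emb (.inl true)) (Function.update S r []) m
      hm2 t' _ _ e
    simp only [embCfg, initList_stk, haltList_stk] at this
    simp only [initList, haltList, Option.elim, hidle] at this
    exact this
  have h1 := hin l.reverse [] S hS
  have h3 := hout l' (Function.update S r [])
  simp only [List.reverse_reverse, List.append_nil, List.map_nil, List.length_reverse,
    Function.update_self, Function.update_idem] at h1 h3
  refine StepsLE.trans (StepsLE.trans ?_ hrun) h3
  have hst : Function.update (idleStk M) i
      (Function.update (fun _ => []) (M i).tm.k₀ []) = idleStk M := by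
    conv_rhs => rw [← Function.update_eq_self i (idleStk M)]
    congr 1
    exact Function.update_eq_self (M i).tm.k₀ (fun _ => [])
  rw [hst] at h1
  exact h1

/-- The machine compiled from a program. -/
noncomputable def machine [Fintype R] [Fintype ι] (M : ι → TM2ComputableAux Bool Bool)
    (p : Prog R ι) (rin rout : R) : FinTM2 :=
  haveI := Lab.fintype M p
  haveI : ∀ i, Fintype (M i).tm.K := fun i => (M i).tm.kFin
  haveI : ∀ i, Fintype (M i).tm.σ := fun i => (M i).tm.σFin
  { K := R ⊕ (Σ i, (M i).tm.K)
    k₀ := Sum.inl rin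
    k₁ := Sum.inl rout
    Γ := Alph R M
    Λ := Option (Lab M p)
    main := some (entry M p)
    σ := Ctl M
    initialState := (none, idleCtl M)
    Γk₀Fin := inferInstanceAs (Fintype Bool)
    m := fun l => l.elim .halt (code M p some none) }

/-- The exit label of the whole program is `none`, whose statement is `halt`; this last step is the
`+ 1` in the time bound. All stacks other than `rout` have to end empty, because this is the shape
required of a halted configuration. -/
theorem computable_of_runs [Fintype R] [Fintype ι] {α β : Type} {ea : α → List Bool}
    {eb : β → List Bool} {f : α → β} (M : ι → TM2ComputableAux Bool Bool)
    (p : Prog R ι) (rin rout : R) (T : Polynomial ℕ)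
    (h : ∀ a, Runs M p (Function.update (fun _ => []) rin (ea a)) (T.eval (ea a).length)
      (Function.update (fun _ => []) rout (eb (f a)))) :
    Nonempty (TM2ComputableInPolyTime ea eb f) := by
  refine ⟨{ tm := machine M p rin rout, inputAlphabet := Equiv.refl Bool,
            outputAlphabet := Equiv.refl Bool, time := T + 1, outputsFun := fun a => ?_ }⟩
  have h1 := h a (Option (Lab M p)) (machine M p rin rout).m some none (fun l => rfl)
  have h2 : StepsLE (machine M p rin rout).step 1
      (cfg M none (Function.update (fun _ => []) rout (eb (f a))))
      (haltList (machine M p rin rout) (eb (f a))) := by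
    apply StepsLE.single
    change some (TM2.Cfg.mk _ _ _) = _
    congr 1
    refine (TM2.Cfg.mk.injEq ..).mpr ⟨rfl, rfl, ?_⟩
    refine Eq.trans ?_ (haltList_stk (machine M p rin rout) (eb (f a))).symm
    refine (update_stkOf_inl M (fun _ => []) (idleStk M) rout _).symm.trans ?_
    have : stkOf M (fun _ : R => []) (idleStk M) = fun _ => [] := by
      funext x
      rcases x with x | x <;> rfl
    rw [this]
    rfl
  have h3 := h1.trans h2
  have h0 : cfg M (some (entry M p)) (Function.update (fun _ => []) rin (ea a)) =
      initList (machine M p rin rout) (ea a) := by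
    refine (TM2.Cfg.mk.injEq ..).mpr ⟨rfl, rfl, ?_⟩
    refine Eq.trans ?_ (initList_stk (machine M p rin rout) (ea a)).symm
    refine (update_stkOf_inl M (fun _ => []) (idleStk M) rin _).symm.trans ?_
    have : stkOf M (fun _ : R => []) (idleStk M) = fun _ => [] := by
      funext x
      rcases x with x | x <;> rfl
    rw [this]
    rfl
  rw [h0] at h3
  refine Classical.choice ?_
  obtain ⟨t, ht, e⟩ := h3
  refine ⟨⟨⟨t, ?_⟩, by simpa using ht⟩⟩
  have hid : ∀ l : List Bool, List.map (Equiv.refl Bool).invFun l = l := fun l => List.map_id l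
  have e' := e
  rw [← hid (ea a), ← hid (eb (f a))] at e'
  exact e'

end Compile

/-! ### Polynomial bounds -/

/-- `f` is bounded by a polynomial in the size `ℓ`. -/
def PolyBdd {α : Type} (ℓ f : α → ℕ) : Prop := ∃ T : Polynomial ℕ, ∀ a, f a ≤ T.eval (ℓ a)

section PolyBdd

variable {α : Type} {ℓ f g : α → ℕ}

theorem PolyBdd.self : PolyBdd ℓ ℓ := ⟨Polynomial.X, fun a => by simp⟩

theorem PolyBdd.const (c : ℕ) : PolyBdd ℓ (fun _ => c) := ⟨Polynomial.C c, fun a => by simp⟩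

theorem PolyBdd.add (hf : PolyBdd ℓ f) (hg : PolyBdd ℓ g) : PolyBdd ℓ (fun a => f a + g a) := by
  obtain ⟨T, hT⟩ := hf
  obtain ⟨U, hU⟩ := hg
  exact ⟨T + U, fun a => by simpa using add_le_add (hT a) (hU a)⟩

theorem PolyBdd.mul (hf : PolyBdd ℓ f) (hg : PolyBdd ℓ g) : PolyBdd ℓ (fun a => f a * g a) := by
  obtain ⟨T, hT⟩ := hf
  obtain ⟨U, hU⟩ := hg
  exact ⟨T * U, fun a => by simpa using Nat.mul_le_mul (hT a) (hU a)⟩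

theorem PolyBdd.mono (hg : PolyBdd ℓ g) (h : ∀ a, f a ≤ g a) : PolyBdd ℓ f := by
  obtain ⟨U, hU⟩ := hg
  exact ⟨U, fun a => (h a).trans (hU a)⟩

/-- Polynomials with natural coefficients are monotone, so a bound may be substituted for the
argument. -/
theorem PolyBdd.eval (T : Polynomial ℕ) (hf : PolyBdd ℓ f) : PolyBdd ℓ (fun a => T.eval (f a)) := by
  obtain ⟨U, hU⟩ := hf
  refine ⟨T.comp U, fun a => ?_⟩
  rw [Polynomial.eval_comp]
  have hm : Monotone fun x => T.eval x := by
    intro x y hxy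
    simp only [Polynomial.eval_eq_sum, Polynomial.sum]
    gcongr
  exact hm (hU a)

end PolyBdd

/-! ### Stacks grow at most linearly in the running time -/

section OutputLength

/-- The number of push commands in a statement. -/
def pushes {K : Type} {Γ : K → Type} {Λ σ : Type} : TM2.Stmt Γ Λ σ → ℕ
  | .push _ _ q => pushes q + 1
  | .peek _ _ q => pushes q
  | .pop _ _ q => pushes q
  | .load _ q => pushes q
  | .branch _ q q' => pushes q + pushes q'
  | .goto _ => 0
  | .halt => 0

theorem length_stepAux {K : Type} [DecidableEq K] {Γ : K → Type} {Λ σ : Type}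
    (s : TM2.Stmt Γ Λ σ) (v : σ) (S : ∀ k, List (Γ k)) (k : K) :
    ((TM2.stepAux s v S).stk k).length ≤ (S k).length + pushes s := by
  induction s generalizing v S with
  | push k' f q ih =>
    simp only [TM2.stepAux, pushes]
    refine (ih _ _).trans ?_
    by_cases h : k = k'
    · subst h; simp; omega
    · simp [h]
  | peek k' f q ih => exact ih _ _
  | pop k' f q ih =>
    simp only [TM2.stepAux, pushes]
    refine (ih _ _).trans ?_
    by_cases h : k = k'
    · subst h; simp
    · simp [h]
  | load f q ih => exact ih _ _
  | branch f q q' ih ih' =>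
    simp only [TM2.stepAux, pushes]
    have h1 := ih v S
    have h2 := ih' v S
    cases f v <;> simp only [cond] <;> omega
  | goto l => simp [TM2.stepAux]
  | halt => simp [TM2.stepAux]

/-- The stacks of a machine grow at most linearly in the running time. -/
theorem exists_length_stk_le {K : Type} [DecidableEq K] {Γ : K → Type} {Λ σ : Type} [Fintype Λ]
    (m : Λ → TM2.Stmt Γ Λ σ) : ∃ b : ℕ, ∀ (n : ℕ) (c c' : TM2.Cfg Γ Λ σ),
      (flip bind (TM2.step m))^[n] (some c) = some c' →
      ∀ k, (c'.stk k).length ≤ (c.stk k).length + b * n := by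
  -- One step executes one statement; the sum over the finitely many labels bounds the number of
  -- symbols pushed by any of them.
  refine ⟨∑ x : Λ, pushes (m x), fun n => ?_⟩
  induction n with
  | zero =>
    intro c c' h k
    simp only [Function.iterate_zero, id, Option.some.injEq] at h
    simp [h]
  | succ n ih =>
    intro c c' h k
    rw [Function.iterate_succ_apply'] at h
    obtain ⟨c1, h1, h2⟩ : ∃ c1, (flip bind (TM2.step m))^[n] (some c) = some c1 ∧
        TM2.step m c1 = some c' := by
      cases hc : (flip bind (TM2.step m))^[n] (some c) with
      | none => rw [hc] at h; cases (h : none = some c')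
      | some c1 => rw [hc] at h; exact ⟨c1, rfl, h⟩
    have h3 := ih c c1 h1 k
    obtain ⟨_ | x, v, S⟩ := c1
    · cases h2
    · have h2' : TM2.stepAux (m x) v S = c' := Option.some.inj h2
      have h4 := length_stepAux (m x) v S k
      rw [h2'] at h4
      have h5 : pushes (m x) ≤ ∑ x : Λ, pushes (m x) :=
        Finset.single_le_sum (f := fun x => pushes (m x)) (fun _ _ => Nat.zero_le _)
          (Finset.mem_univ x)
      simp only at h3
      rw [Nat.mul_succ]
      omega

/-- The output of a machine grows at most linearly in the running time. -/
theorem exists_length_output_le (tm : FinTM2) : ∃ c : ℕ, ∀ l l' t,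
    Nonempty (TM2OutputsInTime tm l (some l') t) → l'.length ≤ l.length + c * t := by
  have := tm.ΛFin
  obtain ⟨c, key⟩ := exists_length_stk_le tm.m
  refine ⟨c, fun l l' t ⟨⟨⟨t', e⟩, ht⟩⟩ => ?_⟩
  have h := key t' _ _ e tm.k₁
  rw [haltList_stk, initList_stk] at h
  simp only [Function.update_self] at h
  have h1 : (Function.update (fun _ => []) tm.k₀ l tm.k₁).length ≤ l.length := by
    by_cases hk : tm.k₁ = tm.k₀
    · have : ∀ k, k = tm.k₀ → (Function.update (fun _ => []) tm.k₀ l k).length ≤ l.length := by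
        rintro k rfl; simp
      exact this _ hk
    · rw [Function.update_of_ne hk]; simp
  have h2 : c * t' ≤ c * t := Nat.mul_le_mul_left _ ht
  omega

/-- The bit stacks grow at most linearly in the running time. -/
theorem exists_length_runs_le {R ι : Type} [DecidableEq R] [DecidableEq ι]
    (M : ι → TM2ComputableAux Bool Bool) (p : Prog R ι) : ∃ c : ℕ, ∀ S T S',
    Runs M p S T S' → ∀ r, (S' r).length ≤ (S r).length + c * T := by
  have := Lab.fintype M p
  obtain ⟨c, key⟩ := exists_length_stk_le
    (fun l : Option (Lab M p) => l.elim .halt (code M p some none))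
  refine ⟨c, fun S T S' h r => ?_⟩
  obtain ⟨t, ht, e⟩ := h _ (fun l : Option (Lab M p) => l.elim .halt (code M p some none)) some none
    fun l => rfl
  have h1 : (S' r).length ≤ (S r).length + c * t := key t _ _ e (.inl r)
  have h2 : c * t ≤ c * T := Nat.mul_le_mul_left _ ht
  omega

/-- Writing takes time, so the output is longer than the input by at most a multiple of the running
time. This keeps everything that happens after a subroutine call polynomial in the original size. -/
theorem polyBdd_length_of_computable {α β : Type} {ea : α → List Bool} {eb : β → List Bool}
    {f : α → β} (h : TM2ComputableInPolyTime ea eb f) :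
    PolyBdd (fun a => (ea a).length) (fun a => (eb (f a)).length) := by
  obtain ⟨c, hc⟩ := exists_length_output_le h.tm
  refine PolyBdd.mono (PolyBdd.add PolyBdd.self
    ((PolyBdd.const c).mul (PolyBdd.eval h.time PolyBdd.self))) fun a => ?_
  simpa using hc _ _ _ ⟨h.outputsFun a⟩

end OutputLength

/-! ### Families of runs in polynomial time -/

section PolyRuns

variable {R ι : Type} [DecidableEq R] [DecidableEq ι] {M : ι → TM2ComputableAux Bool Bool}
  {α : Type} {ℓ : α → ℕ} {p q : Prog R ι} {S S' S'' : α → R → List Bool}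

/-- The program `p` leads from `S a` to `S' a` in time polynomial in `ℓ a`. -/
def PolyRuns (M : ι → TM2ComputableAux Bool Bool) (ℓ : α → ℕ) (p : Prog R ι)
    (S S' : α → R → List Bool) : Prop :=
  ∃ T : α → ℕ, PolyBdd ℓ T ∧ ∀ a, Runs M p (S a) (T a) (S' a)

theorem PolyRuns.seq (h : PolyRuns M ℓ p S S') (h' : PolyRuns M ℓ q S' S'') :
    PolyRuns M ℓ (.seq p q) S S'' := by
  obtain ⟨T, hT, h⟩ := h
  obtain ⟨U, hU, h'⟩ := h'
  exact ⟨_, hT.add hU, fun a => (h a).seq (h' a)⟩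

theorem PolyRuns.congr (h : PolyRuns M ℓ p S S') (hS : ∀ a, S' a = S'' a) :
    PolyRuns M ℓ p S S'' := by
  rwa [← funext hS]

/-- All stacks have polynomial size. -/
def Small (ℓ : α → ℕ) (S : α → R → List Bool) : Prop := ∀ r, PolyBdd ℓ fun a => (S a r).length

/-- The running time already limits the growth of the stacks, so intermediate sizes need not be
tracked by hand. -/
theorem PolyRuns.small (h : PolyRuns M ℓ p S S') (hS : Small ℓ S) : Small ℓ S' := by
  obtain ⟨T, hT, h⟩ := h
  obtain ⟨c, hc⟩ := exists_length_runs_le M p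
  exact fun r => ((hS r).add ((PolyBdd.const c).mul hT)).mono fun a => hc _ _ _ (h a) r

theorem PolyRuns.call {β : Type} {ea : α → List Bool} {eb : β → List Bool} {f : α → β}
    (h : TM2ComputableInPolyTime ea eb f) {i : ι} (hi : M i = h.toTM2ComputableAux) (r : R)
    (hS : ∀ a, S a r = (ea a).reverse) (hℓ : PolyBdd ℓ (fun a => (ea a).length)) :
    PolyRuns M ℓ (.call i r) S (fun a => Function.update (S a) r (eb (f a)).reverse) := by
  obtain ⟨T, hT⟩ := polyBdd_length_of_computable h
  refine ⟨_, ((hℓ.add (PolyBdd.const 1)).add (hℓ.eval h.time)).add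
    (((hℓ.eval T).mono hT).add (PolyBdd.const 1)), fun a => ?_⟩
  refine Runs.call i r _ _ _ ?_ (S a) (hS a)
  rw [hi]
  exact ⟨h.outputsFun a⟩

theorem computable_of_polyRuns [Fintype R] [Fintype ι] {β : Type} {ea : α → List Bool}
    {eb : β → List Bool} {f : α → β} (rin rout : R)
    (h : PolyRuns M (fun a => (ea a).length) p (fun a => Function.update (fun _ => []) rin (ea a))
      (fun a => Function.update (fun _ => []) rout (eb (f a)))) :
    Nonempty (TM2ComputableInPolyTime ea eb f) := by
  obtain ⟨U, ⟨T, hT⟩, h⟩ := h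
  exact computable_of_runs M p rin rout T fun a => (h a).mono (hT a)

end PolyRuns

/-! ### Routines -/

section Routines

variable {R ι : Type} [DecidableEq R] [DecidableEq ι] {M : ι → TM2ComputableAux Bool Bool}

/-- Move the bits of `src` to `d`, reversing their order. -/
def moveBits (src d : R) : Prog R ι := .loopS src (.push d true) (.push d false)

theorem runs_moveBits {src d : R} (hd : d ≠ src) (S : R → List Bool) :
    Runs M (moveBits src d) S (2 * (S src).length + 1)
      (Function.update (Function.update S src []) d ((S src).reverse ++ S d)) := by
  generalize h : S src = l
  induction l generalizing S with
  | nil =>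
    refine (Runs.loopS_nil h).congr (by simp) ?_
    funext x
    simp only [Function.update_apply]
    split_ifs <;> simp_all
  | cons b l ih =>
    have h1 : Runs M (cond b (.push d true) (.push d false)) (Function.update S src l) 1
        (Function.update (Function.update S src l) d (b :: S d)) := by
      cases b
      all_goals
        refine (Runs.push _).congr le_rfl ?_
        rw [Function.update_of_ne hd]
    refine (Runs.loopS_cons h h1 (ih _ ?_)).congr (by simp; omega) ?_
    · simp [hd.symm]
    · funext x
      simp only [Function.update_apply]
      split_ifs <;> simp_all

/-- Move the bits of `src` to both `d` and `e`, reversing their order. -/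
def moveBits₂ (src d e : R) : Prog R ι :=
  .loopS src (.seq (.push d true) (.push e true)) (.seq (.push d false) (.push e false))

theorem runs_moveBits₂ {src d e : R} (hd : d ≠ src) (he : e ≠ src) (hde : d ≠ e)
    (S : R → List Bool) :
    Runs M (moveBits₂ src d e) S (3 * (S src).length + 1)
      (Function.update (Function.update (Function.update S src []) d ((S src).reverse ++ S d)) e
        ((S src).reverse ++ S e)) := by
  generalize h : S src = l
  induction l generalizing S with
  | nil =>
    refine (Runs.loopS_nil h).congr (by simp) ?_
    funext x
    simp only [Function.update_apply]
    split_ifs <;> simp_all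
  | cons b l ih =>
    have h1 : Runs M (cond b (.seq (.push d true) (.push e true))
        (.seq (.push d false) (.push e false))) (Function.update S src l) 2
        (Function.update (Function.update (Function.update S src l) d (b :: S d)) e
          (b :: S e)) := by
      cases b
      all_goals
        refine ((Runs.push _).seq (Runs.push _)).congr le_rfl ?_
        rw [Function.update_of_ne hd, Function.update_of_ne hde.symm, Function.update_of_ne he]
    refine (Runs.loopS_cons h h1 (ih _ ?_)).congr (by simp; omega) ?_
    · simp [hd.symm, he.symm]
    · funext x
      simp only [Function.update_apply]
      split_ifs <;> simp_all

/-- Append the bits of `src` to `d` in reversed order, without changing `src`; the stack `t` is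
used in between. -/
def appendTo (t src d : R) : Prog R ι := .seq (moveBits₂ src d t) (moveBits t src)

theorem runs_appendTo {t src d : R} (hd : d ≠ src) (ht : t ≠ src) (hdt : d ≠ t)
    (S : R → List Bool) (hS : S t = []) :
    Runs M (appendTo t src d) S (5 * (S src).length + 2)
      (Function.update S d ((S src).reverse ++ S d)) := by
  refine ((runs_moveBits₂ hd ht hdt S).seq (runs_moveBits ht.symm _)).congr ?_ ?_
  · simp [hS]; omega
  · funext x
    simp only [Function.update_apply]
    split_ifs <;> simp_all

/-- Empty the stack `r`. -/
def clear (r : R) : Prog R ι := .loopS r .skip .skip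

theorem runs_clear {r : R} (S : R → List Bool) :
    Runs M (clear r) S (2 * (S r).length + 1) (Function.update S r []) := by
  generalize h : S r = l
  induction l generalizing S with
  | nil =>
    refine (Runs.loopS_nil h).congr (by simp) ?_
    funext x
    simp only [Function.update_apply]
    split_ifs <;> simp_all
  | cons b l ih =>
    have h1 : Runs M (cond b .skip .skip) (Function.update S r l) 1 (Function.update S r l) := by
      cases b <;> exact Runs.skip
    refine (Runs.loopS_cons h h1 (ih _ ?_)).congr (by simp; omega) ?_ <;> simp

/-- Push the bits of a fixed list, the last one first. -/
def pushAll (r : R) : List Bool → Prog R ι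
  | [] => .skip
  | b :: l => .seq (pushAll r l) (.push r b)

theorem runs_pushAll {r : R} (l : List Bool) (S : R → List Bool) :
    Runs M (pushAll r l) S (l.length + 1) (Function.update S r (l ++ S r)) := by
  induction l with
  | nil => simpa [pushAll] using Runs.skip.mono le_rfl
  | cons b l ih =>
    refine (ih.seq (Runs.push b)).congr (by simp) ?_
    simp

end Routines

/-! ### Scanning codes of circuits -/

/-- The stacks used by the programs below. `G k`, `O k` hold the gates and the outputs of circuits,
`Q k` hold rational numbers. -/
inductive Reg where
  | inp | inp2 | res | out | pos | wires | base | tmp | bak | size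
  | G (k : Fin 3) | O (k : Fin 3) | Q (k : Fin 6)
  deriving DecidableEq, Fintype

/-- The stacks that the scanning programs can read. -/
def IsSrc (r : Reg) : Prop :=
  r ≠ .out ∧ r ≠ .pos ∧ r ≠ .base ∧ r ≠ .tmp ∧ r ≠ .bak

/-- The effect of scanning the code `x` from `src`: it is moved to `bak`, the bits `y` are written
to `out`, and `pos` increases by `n`. -/
def scanned (S : Reg → List Bool) (src : Reg) (rest x y : List Bool) (n : ℕ) : Reg → List Bool :=
  Function.update (Function.update (Function.update (Function.update S src rest)
    .bak (x.reverse ++ S .bak)) .out (y.reverse ++ S .out)) .pos (List.replicate n true ++ S .pos)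

section Scans

variable {ι : Type} [DecidableEq ι] (M : ι → TM2ComputableAux Bool Bool)

/-- The program `p` scans the code `x` from `src` and writes `y`, increasing `pos` by `n`, when
`base` holds the number `b` in unary. -/
def Scans (b : ℕ) (src : Reg) (p : Prog Reg ι) (x y : List Bool) (n T : ℕ) : Prop :=
  ∀ (S : Reg → List Bool) (rest : List Bool), S .base = List.replicate b true → S .tmp = [] →
    S src = x ++ rest → Runs M p S T (scanned S src rest x y n)

variable {M} {b : ℕ} {src : Reg} (hsrc : IsSrc src) {p q : Prog Reg ι}
  {x x' y y' : List Bool} {n n' T T' U : ℕ}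

theorem Scans.mono (h : Scans M b src p x y n T) (hT : T ≤ U) : Scans M b src p x y n U :=
  fun S rest h1 h2 h3 => (h S rest h1 h2 h3).mono hT

theorem Scans.congr (h : Scans M b src p x y n T) (hx : x = x') (hy : y = y') (hn : n = n')
    (hT : T ≤ U) : Scans M b src p x' y' n' U := by
  subst hx hy hn; exact h.mono hT

include hsrc in
theorem Scans.seq (h : Scans M b src p x y n T) (h' : Scans M b src q x' y' n' T') :
    Scans M b src (.seq p q) (x ++ x') (y ++ y') (n + n') (T + T') := by
  obtain ⟨s1, s2, s3, s4, s5⟩ := hsrc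
  intro S rest h1 h2 h3
  have h3' : S src = x ++ (x' ++ rest) := by rw [h3, List.append_assoc]
  refine ((h S _ h1 h2 h3').seq (h' _ rest ?_ ?_ ?_)).congr le_rfl ?_
  · simp [scanned, h1, s3.symm]
  · simp [scanned, h2, s4.symm]
  · simp [scanned, s1, s2, s5]
  · funext r
    simp only [scanned, Function.update_apply]
    split_ifs <;> simp_all
    rw [Nat.add_comm, List.replicate_add, List.append_assoc]

include hsrc in
theorem Scans.emit (c : Bool) : Scans M b src (.push .out c) [] [c] 0 1 := by
  obtain ⟨s1, s2, s3, s4, s5⟩ := hsrc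
  intro S rest h1 h2 h3
  refine (Runs.push c).congr le_rfl ?_
  funext r
  simp only [scanned, Function.update_apply]
  split_ifs <;> simp_all

include hsrc in
theorem Scans.bump : Scans M b src (.push .pos true) [] [] 1 1 := by
  obtain ⟨s1, s2, s3, s4, s5⟩ := hsrc
  intro S rest h1 h2 h3
  refine (Runs.push true).congr le_rfl ?_
  funext r
  simp only [scanned, Function.update_apply]
  split_ifs <;> simp_all

include hsrc in
theorem Scans.appendBase :
    Scans M b src (appendTo .tmp .base .out) [] (List.replicate b true) 0 (5 * b + 2) := by
  obtain ⟨s1, s2, s3, s4, s5⟩ := hsrc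
  intro S rest h1 h2 h3
  refine (runs_appendTo (by simp) (by simp) (by simp) S h2).congr (by simp [h1]) ?_
  funext r
  simp only [scanned, Function.update_apply]
  split_ifs <;> simp_all

/-- Read a bit and continue accordingly. -/
def scanCase (src : Reg) (p q : Prog Reg ι) : Prog Reg ι :=
  .case src (.seq (.push .bak true) p) (.seq (.push .bak false) q)

include hsrc in
theorem Scans.push_bak {c : Bool} (h : Scans M b src p x y n T) {S : Reg → List Bool}
    {rest : List Bool} (h1 : S .base = List.replicate b true) (h2 : S .tmp = []) :
    Runs M (.seq (.push .bak c) p) (Function.update S src (x ++ rest)) (T + 1)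
      (scanned S src rest (c :: x) y n) := by
  obtain ⟨s1, s2, s3, s4, s5⟩ := hsrc
  refine ((Runs.push c).seq (h _ rest ?_ ?_ ?_)).congr (by omega) ?_
  · simp [h1, s3.symm]
  · simp [h2, s4.symm]
  · simp [s5]
  · funext r
    simp only [scanned, Function.update_apply]
    split_ifs <;> simp_all

include hsrc in
theorem Scans.case_true (h : Scans M b src p x y n T) :
    Scans M b src (scanCase src p q) (true :: x) y n (T + 2) :=
  fun S rest h1 h2 h3 => (Runs.case_true h3 (h.push_bak hsrc h1 h2)).mono (by omega)

include hsrc in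
theorem Scans.case_false (h : Scans M b src q x y n T) :
    Scans M b src (scanCase src p q) (false :: x) y n (T + 2) :=
  fun S rest h1 h2 h3 => (Runs.case_false h3 (h.push_bak hsrc h1 h2)).mono (by omega)

/-- Scan the members of a list. -/
def scanLoop (src : Reg) (p : Prog Reg ι) : Prog Reg ι :=
  .seq (.loopT src (.seq (.push .bak true) p)) (.push .bak false)

-- The marker bits and the terminator of `encList` are consumed but not written; the body writes its
-- own markers. So the outputs of several loops can be joined into one list.
include hsrc in
theorem Scans.loop {β : Type} (e e' : β → List Bool) (n T : β → ℕ) (l : List β)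
    (h : ∀ a ∈ l, Scans M b src p (e a) (e' a) (n a) (T a)) :
    Scans M b src (scanLoop src p) (encList e l) (l.flatMap e') (l.map n).sum
      ((l.map fun a => T a + 2).sum + 2) := by
  have key : ∀ l : List β, (∀ a ∈ l, Scans M b src p (e a) (e' a) (n a) (T a)) →
      ∀ (S : Reg → List Bool) (rest : List Bool), S .base = List.replicate b true → S .tmp = [] →
      S src = encList e l ++ rest →
      Runs M (.loopT src (.seq (.push .bak true) p)) S ((l.map fun a => T a + 2).sum + 1)
        (scanned S src rest (l.flatMap fun a => true :: e a) (l.flatMap e') (l.map n).sum) := by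
    intro l
    induction l with
    | nil =>
      intro _ S rest h1 h2 h3
      refine (Runs.loopT_false (by simpa [encList] using h3)).congr (by simp) ?_
      obtain ⟨s1, s2, s3, s4, s5⟩ := hsrc
      funext r
      simp only [scanned, Function.update_apply]
      split_ifs <;> simp_all
    | cons a l ih =>
      intro hl S rest h1 h2 h3
      have h3' : S src = true :: (e a ++ (encList e l ++ rest)) := by simp [h3, encList]
      refine (Runs.loopT_true h3' ((hl a (by simp)).push_bak hsrc h1 h2)
        (ih (fun a ha => hl a (by simp [ha])) _ rest ?_ ?_ ?_)).congr ?_ ?_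
      all_goals obtain ⟨s1, s2, s3, s4, s5⟩ := hsrc
      · simp [scanned, h1, s3.symm]
      · simp [scanned, h2, s4.symm]
      · simp [scanned, s1, s2, s5]
      · simp; omega
      · funext r
        simp only [scanned, Function.update_apply]
        split_ifs <;> simp_all
        rw [Nat.add_comm (n a), List.replicate_add, List.append_assoc]
  intro S rest h1 h2 h3
  refine ((key l h S rest h1 h2 h3).seq (Runs.push false)).congr le_rfl ?_
  obtain ⟨s1, s2, s3, s4, s5⟩ := hsrc
  funext r
  simp only [scanned, encList, Function.update_apply]
  split_ifs <;> simp_all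

/-- Copy one bit. -/
def scanBit (src : Reg) : Prog Reg ι := scanCase src (.push .out true) (.push .out false)

include hsrc in
theorem scans_bit (c : Bool) : Scans M b src (scanBit src) [c] [c] 0 3 := by
  cases c
  · exact (Scans.emit hsrc false).case_false hsrc
  · exact (Scans.emit hsrc true).case_true hsrc

/-- Copy a code of a bit string. -/
def scanBits (src : Reg) : Prog Reg ι :=
  .seq (scanLoop src (.seq (.push .out true) (scanBit src))) (.push .out false)

include hsrc in
theorem scans_bits (l : List Bool) :
    Scans M b src (scanBits src) (encBits l) (encBits l) 0 (6 * l.length + 3) := by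
  refine ((Scans.loop hsrc (fun c => [c]) (fun c => [true, c]) (fun _ => 0) (fun _ => 4) l
    fun c _ => (((Scans.emit hsrc true).seq hsrc (scans_bit hsrc c)).congr (by simp) (by simp)
      (by simp) (by simp))).seq hsrc (Scans.emit hsrc false)).congr ?_ ?_ ?_ ?_
  · simp [encList, encBits]
  · simp [encBits]
  · simp
  · simp; omega

/-- Copy a code of a rational number. -/
def scanRat (src : Reg) : Prog Reg ι :=
  .seq (scanBit src) (.seq (scanBits src) (scanBits src))

theorem length_encBits (l : List Bool) : (encBits l).length = 2 * l.length + 1 := by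
  simp [encBits, List.length_flatMap, Nat.mul_comm]

include hsrc in
theorem scans_rat (r : ℚ) :
    Scans M b src (scanRat src) (encRat r) (encRat r) 0 (9 * (encRat r).length) := by
  refine ((scans_bit hsrc (decide (r.num < 0))).seq hsrc ((scans_bits hsrc
    r.num.natAbs.bits).seq hsrc (scans_bits hsrc r.den.bits))).congr ?_ ?_ ?_ ?_
  · rfl
  · rfl
  · rfl
  · simp only [encRat, List.length_cons, List.length_append, length_encBits]
    omega

/-- Copy a wire number, increasing it by the number in `base`. -/
def scanWire (src : Reg) : Prog Reg ι :=
  .seq (appendTo .tmp .base .out) (.seq (scanLoop src (.push .out true)) (.push .out false))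

/-- A unary number is a list of empty codes, which lets `scanLoop` read it. -/
theorem encWire_eq (w : ℕ) : encWire w = encList (fun _ => []) (List.replicate w ()) := by
  induction w with
  | zero => rfl
  | succ w ih => simpa [encWire, encList, List.replicate_succ] using ih

theorem length_encWire (w : ℕ) : (encWire w).length = w + 1 := by simp [encWire]

-- Unary addition is concatenation: the ones of `base` are written first, then those of `w`.
include hsrc in
theorem scans_wire (w : ℕ) :
    Scans M b src (scanWire src) (encWire w) (encWire (b + w)) 0
      (5 * (b + 1) * (encWire w).length) := by
  refine ((Scans.appendBase hsrc).seq hsrc ((Scans.loop hsrc (fun _ => []) (fun _ => [true])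
    (fun _ => 0) (fun _ => 1) (List.replicate w ()) fun _ _ => Scans.emit hsrc true).seq hsrc
    (Scans.emit hsrc false))).congr ?_ ?_ ?_ ?_
  · simp [encWire_eq]
  · simp only [encWire, List.flatMap_replicate]
    rw [List.replicate_add, List.append_assoc]
    simp
  · simp
  · simp only [List.map_replicate, List.sum_replicate, length_encWire, smul_eq_mul]
    nlinarith

/-- The result of increasing the wire numbers of a gate. -/
def Gate.shift (b : ℕ) : Gate → Gate
  | .const q => .const q
  | .add i j => .add (b + i) (b + j)
  | .sub i j => .sub (b + i) (b + j)
  | .mul i j => .mul (b + i) (b + j)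
  | .max i j => .max (b + i) (b + j)
  | .min i j => .min (b + i) (b + j)
  | .gt i j => .gt (b + i) (b + j)

/-- Copy the two wire numbers of a gate. -/
def scanWires₂ (src : Reg) : Prog Reg ι := .seq (scanWire src) (scanWire src)

/-- Copy a gate, increasing the wire numbers by the number in `base`. -/
def scanGate (src : Reg) : Prog Reg ι :=
  scanCase src
    (.seq (.push .out true) (.seq (scanBit src) (.seq (scanBit src) (scanWires₂ src))))
    (.seq (.push .out false)
      (scanCase src (.seq (.push .out true) (.seq (scanBit src) (scanWires₂ src)))
        (.seq (.push .out false)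
          (scanCase src (.seq (.push .out true) (scanWires₂ src))
            (.seq (.push .out false) (scanRat src))))))

include hsrc in
theorem scans_wires₂ (i j : ℕ) :
    Scans M b src (scanWires₂ src) (encWire i ++ encWire j)
      (encWire (b + i) ++ encWire (b + j)) 0
      (5 * (b + 1) * ((encWire i).length + (encWire j).length)) :=
  ((scans_wire hsrc i).seq hsrc (scans_wire hsrc j)).congr rfl rfl rfl (by rw [← mul_add])

-- The program is the decision tree of the three-bit tags. Tags starting with `true`, tags starting
-- with `false, true`, and the tag `false, false, true` lead to two wire numbers (`hA`, `hB`, `hC`);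
-- the one remaining leaf is a rational constant.
include hsrc in
theorem scans_gate (g : Gate) :
    Scans M b src (scanGate src) (encGate g) (encGate (g.shift b)) 0
      (9 * (b + 1) * (encGate g).length) := by
  have hT : ∀ i j, 9 + 5 * (b + 1) * ((encWire i).length + (encWire j).length) ≤
      9 * (b + 1) * ((encWire i).length + (encWire j).length + 1 + 1 + 1) := by
    intro i j; nlinarith
  have hA : ∀ (c d : Bool) (i j : ℕ), Scans M b src (scanGate src)
      ([true, c, d] ++ (encWire i ++ encWire j))
      ([true, c, d] ++ (encWire (b + i) ++ encWire (b + j))) 0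
      (9 + 5 * (b + 1) * ((encWire i).length + (encWire j).length)) := fun c d i j =>
    (((Scans.emit hsrc true).seq hsrc ((scans_bit hsrc c).seq hsrc ((scans_bit hsrc d).seq hsrc
      (scans_wires₂ hsrc i j)))).case_true hsrc).congr (by simp) (by simp) rfl (by omega)
  have hB : ∀ (d : Bool) (i j : ℕ), Scans M b src (scanGate src)
      ([false, true, d] ++ (encWire i ++ encWire j))
      ([false, true, d] ++ (encWire (b + i) ++ encWire (b + j))) 0
      (9 + 5 * (b + 1) * ((encWire i).length + (encWire j).length)) := fun d i j =>
    (((Scans.emit hsrc false).seq hsrc (((Scans.emit hsrc true).seq hsrc ((scans_bit hsrc d).seq hsrc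
      (scans_wires₂ hsrc i j))).case_true hsrc)).case_false hsrc).congr (by simp) (by simp) rfl
      (by omega)
  have hC : ∀ (i j : ℕ), Scans M b src (scanGate src)
      ([false, false, true] ++ (encWire i ++ encWire j))
      ([false, false, true] ++ (encWire (b + i) ++ encWire (b + j))) 0
      (9 + 5 * (b + 1) * ((encWire i).length + (encWire j).length)) := fun i j =>
    (((Scans.emit hsrc false).seq hsrc (((Scans.emit hsrc false).seq hsrc
      (((Scans.emit hsrc true).seq hsrc
      (scans_wires₂ hsrc i j)).case_true hsrc)).case_false hsrc)).case_false hsrc).congr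
      (by simp) (by simp) rfl (by omega)
  cases g with
  | const r =>
    refine (((Scans.emit hsrc false).seq hsrc (((Scans.emit hsrc false).seq hsrc
      (((Scans.emit hsrc false).seq hsrc
      (scans_rat hsrc r)).case_false hsrc)).case_false hsrc)).case_false hsrc).congr
      (by simp [encGate]) (by simp [encGate, Gate.shift]) rfl ?_
    simp only [encGate, List.length_append, List.length_cons, List.length_nil]
    nlinarith
  | add i j => exact (hC i j).mono (by simpa [encGate] using hT i j)
  | sub i j => exact (hB _ i j).mono (by simpa [encGate] using hT i j)
  | mul i j => exact (hB _ i j).mono (by simpa [encGate] using hT i j)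
  | max i j => exact (hA _ _ i j).mono (by simpa [encGate] using hT i j)
  | min i j => exact (hA _ _ i j).mono (by simpa [encGate] using hT i j)
  | gt i j => exact (hA _ _ i j).mono (by simpa [encGate] using hT i j)

/-- Code of a list of gates that is part of a longer list. -/
def gatesCode (l : List Gate) : List Bool := l.flatMap fun g => true :: encGate g

/-- Copy a list of gates, increasing the wire numbers by the number in `base`. -/
def scanGates (src : Reg) : Prog Reg ι :=
  scanLoop src (.seq (.push .out true) (.seq (scanGate src) (.push .pos true)))

theorem length_encList {β : Type} (e : β → List Bool) (l : List β) :
    (encList e l).length = (l.map fun a => (e a).length + 1).sum + 1 := by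
  simp [encList, List.length_flatMap]

-- No terminator is written, so further gates may follow in the same list. Counting the gates in
-- `pos` keeps the number of the next free wire up to date.
include hsrc in
theorem scans_gates (l : List Gate) :
    Scans M b src (scanGates src) (encList encGate l) (gatesCode (l.map (Gate.shift b))) l.length
      (9 * (b + 1) * (encList encGate l).length) := by
  refine (Scans.loop hsrc encGate (fun g => true :: encGate (g.shift b)) (fun _ => 1)
    (fun g => 9 * (b + 1) * (encGate g).length + 2) l fun g _ => (((Scans.emit hsrc true).seq hsrc
      ((scans_gate hsrc g).seq hsrc (Scans.bump hsrc))).congr (by simp) (by simp) (by simp)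
        (by omega))).congr rfl ?_ ?_ ?_
  · simp [gatesCode, List.flatMap_map]
  · simp
  · rw [length_encList, mul_add (9 * (b + 1)), ← List.sum_map_mul_left]
    refine add_le_add (List.sum_le_sum fun g _ => ?_) ?_ <;> nlinarith

/-- Copy a list of wires, increasing the wire numbers by the number in `base`. -/
def scanOutputs (src : Reg) : Prog Reg ι :=
  .seq (scanLoop src (.seq (.push .out true) (scanWire src))) (.push .out false)

include hsrc in
theorem scans_outputs (l : List ℕ) :
    Scans M b src (scanOutputs src) (encList encWire l) (encList encWire (l.map (b + ·))) 0
      (9 * (b + 1) * (encList encWire l).length) := by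
  refine ((Scans.loop hsrc encWire (fun w => true :: encWire (b + w)) (fun _ => 0)
    (fun w => 5 * (b + 1) * (encWire w).length + 1) l fun g _ => (((Scans.emit hsrc true).seq hsrc
      (scans_wire hsrc g)).congr (by simp) (by simp) (by simp)
        (by omega))).seq hsrc (Scans.emit hsrc false)).congr (by simp) ?_ ?_ ?_
  · simp [encList, List.flatMap_map]
  · simp
  · rw [length_encList, mul_add (9 * (b + 1)), ← List.sum_map_mul_left, add_assoc]
    refine add_le_add (List.sum_le_sum fun g _ => ?_) ?_ <;> nlinarith

end Scans

/-! ### Expressions over circuits -/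

/-- The binary operations of arithmetic circuits. -/
inductive Op where
  | add | sub | mul | max | min | gt

/-- The gate for an operation. -/
def Op.gate : Op → ℕ → ℕ → Gate
  | .add => .add
  | .sub => .sub
  | .mul => .mul
  | .max => .max
  | .min => .min
  | .gt => .gt

/-- The function of an operation. -/
noncomputable def Op.eval : Op → ℝ → ℝ → ℝ
  | .add, x, y => x + y
  | .sub, x, y => x - y
  | .mul, x, y => x * y
  | .max, x, y => Max.max x y
  | .min, x, y => Min.min x y
  | .gt, x, y => if x > y then 1 else 0

/-- The code of an operation. -/
def Op.bits : Op → List Bool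
  | .add => [false, false, true]
  | .sub => [false, true, false]
  | .mul => [false, true, true]
  | .max => [true, false, false]
  | .min => [true, false, true]
  | .gt => [true, true, false]

theorem encGate_gate (o : Op) (i j : ℕ) :
    encGate (o.gate i j) = o.bits ++ (encWire i ++ encWire j) := by
  cases o <;> rfl

theorem eval_gate (o : Op) (i j : ℕ) (w : ℕ → ℝ) : (o.gate i j).eval w = o.eval (w i) (w j) := by
  cases o <;> rfl

theorem refsLT_gate (o : Op) (i j k : ℕ) (hi : i < k) (hj : j < k) : (o.gate i j).RefsLT k := by
  cases o <;> exact ⟨hi, hj⟩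

/-- Circuits and constants to which expressions refer. -/
structure Ctx where
  gates : Fin 3 → List Gate
  outs : Fin 3 → List ℕ
  q : Fin 6 → ℚ

/-- Expressions: inputs, constants, operations, and outputs of circuits. -/
inductive Expr where
  | inp (i : ℕ)
  | const (k : Fin 6)
  | op (o : Op) (a b : Expr)
  | call (k : Fin 3) (j n : ℕ) (args : Fin n → Expr)

/-- Compile several expressions, the last one first. -/
def compileAll : List (ℕ → List Gate × ℕ) → ℕ → List Gate × List ℕ
  | [], _ => ([], [])
  | c :: cs, p =>
    ((compileAll cs p).1 ++ (c (p + (compileAll cs p).1.length)).1,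
      (c (p + (compileAll cs p).1.length)).2 :: (compileAll cs p).2)

/-- Gates for the arguments of a circuit, for copying them, and for the circuit itself. -/
def compileCall (gs : List Gate) (cs : List (ℕ → List Gate × ℕ)) (p : ℕ) : List Gate :=
  -- The copies occupy consecutive wires, directly followed by the gates of the circuit. With
  -- respect to the first copy, the layout is that of the circuit itself, so one uniform shift
  -- relocates references to inputs and to gates alike.
  (compileAll cs p).1 ++ ((compileAll cs p).2.map (fun w => Gate.max w w) ++
    gs.map (Gate.shift (p + (compileAll cs p).1.length)))

/-- Gates that compute an expression, and the wire that carries its value, when `p` wires precede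
them. -/
def compile (C : Ctx) : Expr → ℕ → List Gate × ℕ
  | .inp i, _ => ([], i)
  | .const k, p => ([.const (C.q k)], p)
  -- The second operand is compiled first: the emitting program keeps pending wires on a stack, and
  -- then finds the wire of `a` on top.
  | .op o a b, p =>
    ((compile C b p).1 ++ ((compile C a (p + (compile C b p).1.length)).1 ++
      [o.gate (compile C a (p + (compile C b p).1.length)).2 (compile C b p).2]),
      p + (compile C b p).1.length + (compile C a (p + (compile C b p).1.length)).1.length)
  | .call k j _ args, p =>
    (compileCall (C.gates k) (List.ofFn fun i => compile C (args i)) p,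
      p + (compileAll (List.ofFn fun i => compile C (args i)) p).1.length + (C.outs k).getD j 0)

/-! ### Emitting the code of an expression -/

/-- The stacks `S`, with new contents of `out`, `pos` and `wires`. -/
def mid (S : Reg → List Bool) (o : List Bool) (p : ℕ) (v : List Bool) : Reg → List Bool :=
  Function.update (Function.update (Function.update S .out o) .pos (List.replicate p true)) .wires v

section mid

variable {S : Reg → List Bool} {o v : List Bool} {p : ℕ}

@[simp] theorem mid_out : mid S o p v .out = o := by simp [mid]

@[simp] theorem mid_pos : mid S o p v .pos = List.replicate p true := by simp [mid]

@[simp] theorem mid_wires : mid S o p v .wires = v := by simp [mid]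

theorem mid_of_ne {r : Reg} (h1 : r ≠ .out) (h2 : r ≠ .pos) (h3 : r ≠ .wires) :
    mid S o p v r = S r := by simp [mid, h1, h2, h3]

@[simp] theorem update_mid_out (x : List Bool) :
    Function.update (mid S o p v) .out x = mid S x p v := by
  funext r
  simp only [mid, Function.update_apply]
  split_ifs <;> simp_all

@[simp] theorem update_mid_pos (n : ℕ) :
    Function.update (mid S o p v) .pos (List.replicate n true) = mid S o n v := by
  funext r
  simp only [mid, Function.update_apply]
  split_ifs <;> simp_all

@[simp] theorem update_mid_wires (x : List Bool) :
    Function.update (mid S o p v) .wires x = mid S o p x := by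
  simp [mid]

theorem update_mid_of_ne {r : Reg} (h1 : r ≠ .out) (h2 : r ≠ .pos) (h3 : r ≠ .wires)
    (x : List Bool) : Function.update (mid S o p v) r x = mid (Function.update S r x) o p v := by
  funext r'
  simp only [mid, Function.update_apply]
  split_ifs <;> simp_all

end mid

section Emit

variable {ι : Type} [DecidableEq ι] {M : ι → TM2ComputableAux Bool Bool}
  {S : Reg → List Bool} {o v : List Bool} {p : ℕ}

/-- Append fixed bits to `out`. -/
def emitBits (l : List Bool) : Prog Reg ι := pushAll .out l.reverse

theorem runs_emitBits (l : List Bool) :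
    Runs M (emitBits l) (mid S o p v) (l.length + 1) (mid S (l.reverse ++ o) p v) :=
  (runs_pushAll l.reverse _).congr (by simp) (by simp)

theorem runs_push_out (b : Bool) :
    Runs M (.push .out b) (mid S o p v) 1 (mid S (b :: o) p v) :=
  (Runs.push b).congr le_rfl (by simp)

theorem runs_push_wires (b : Bool) :
    Runs M (.push .wires b) (mid S o p v) 1 (mid S o p (b :: v)) :=
  (Runs.push b).congr le_rfl (by simp)

theorem runs_bump : Runs M (.push .pos true) (mid S o p v) 1 (mid S o (p + 1) v) :=
  (Runs.push true).congr le_rfl (by rw [mid_pos, ← List.replicate_succ, update_mid_pos])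

/-- Push the number of the next wire. -/
def pushPos : Prog Reg ι := .seq (.push .wires false) (appendTo .tmp .pos .wires)

theorem runs_pushPos (ht : S .tmp = []) :
    Runs M pushPos (mid S o p v) (5 * p + 3) (mid S o p (encWire p ++ v)) := by
  refine ((runs_push_wires false).seq (runs_appendTo (by simp) (by simp) (by simp) _ ?_)).congr ?_ ?_
  · rw [mid_of_ne (by simp) (by simp) (by simp), ht]
  · simp; omega
  · simp [encWire]

/-- Pop a wire number and write it. -/
def popWire : Prog Reg ι := .seq (.loopT .wires (.push .out true)) (.push .out false)

theorem runs_popWire (w : ℕ) : Runs M popWire (mid S o p (encWire w ++ v)) (2 * w + 2)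
    (mid S ((encWire w).reverse ++ o) p v) := by
  have key : ∀ w o, Runs M (.loopT .wires (.push .out true)) (mid S o p (encWire w ++ v))
      (2 * w + 1) (mid S (List.replicate w true ++ o) p v) := by
    intro w
    induction w with
    | zero =>
      intro o
      exact (Runs.loopT_false (l := v) (by simp [encWire])).congr (by simp) (by simp)
    | succ w ih =>
      intro o
      refine (Runs.loopT_true (l := encWire w ++ v) (by simp [encWire, List.replicate_succ])
        (S' := mid S (true :: o) p (encWire w ++ v)) (T := 1) ?_ (ih _)).congr (by omega) ?_
      · rw [update_mid_wires]; exact runs_push_out true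
      · rw [List.replicate_succ']; simp
  exact ((key w o).seq (runs_push_out false)).congr le_rfl (by simp [encWire])

/-- Pop a wire number and write a gate that copies this wire. -/
def copyWire : Prog Reg ι :=
  -- The bits are a list marker and the tag of `max`. The wire number is needed twice; its second
  -- copy waits in `tmp`, and the reversal is harmless in unary.
  .seq (emitBits [true, true, false, false])
    (.seq (.loopT .wires (.seq (.push .out true) (.push .tmp true)))
      (.seq (.push .out false) (.seq (moveBits .tmp .out) (.seq (.push .out false)
        (.push .pos true)))))

theorem runs_copyWire (ht : S .tmp = []) (w : ℕ) :
    Runs M copyWire (mid S o p (encWire w ++ v)) (5 * w + 10)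
      (mid S ((gatesCode [Gate.max w w]).reverse ++ o) (p + 1) v) := by
  have key : ∀ w o t, Runs M (.loopT .wires (.seq (.push .out true) (.push .tmp true)))
      (mid (Function.update S .tmp t) o p (encWire w ++ v))
      (3 * w + 1) (mid (Function.update S .tmp (List.replicate w true ++ t))
        (List.replicate w true ++ o) p v) := by
    intro w
    induction w with
    | zero =>
      intro o t
      exact (Runs.loopT_false (l := v) (by simp [encWire])).congr (by simp) (by simp)
    | succ w ih =>
      intro o t
      refine (Runs.loopT_true (l := encWire w ++ v) (by simp [encWire, List.replicate_succ])
        (S' := mid (Function.update S .tmp (true :: t)) (true :: o) p (encWire w ++ v)) (T := 2)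
          ?_ (ih _ _)).congr (by omega) ?_
      · rw [update_mid_wires]
        refine ((runs_push_out true).seq (Runs.push true)).congr le_rfl ?_
        rw [mid_of_ne (by simp) (by simp) (by simp),
          update_mid_of_ne (by simp) (by simp) (by simp)]
        simp
      · rw [List.replicate_succ']; simp
  have hS : Function.update S .tmp [] = S := by rw [← ht, Function.update_eq_self]
  have h1 := key w ([true, true, false, false].reverse ++ o) []
  rw [hS] at h1
  have h2 : Runs M (moveBits .tmp .out) (mid (Function.update S .tmp (List.replicate w true))
      (false :: (List.replicate w true ++ ([true, true, false, false].reverse ++ o))) p v)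
      (2 * w + 1) (mid S (List.replicate w true ++ false ::
        (List.replicate w true ++ ([true, true, false, false].reverse ++ o))) p v) := by
    refine (runs_moveBits (by simp) _).congr ?_ ?_
    · rw [mid_of_ne (by simp) (by simp) (by simp)]; simp
    · rw [update_mid_of_ne (by simp) (by simp) (by simp),
        mid_of_ne (by simp) (by simp) (by simp)]
      simp [hS]
  rw [List.append_nil] at h1
  refine ((runs_emitBits [true, true, false, false]).seq (h1.seq ((runs_push_out false).seq
    (h2.seq ((runs_push_out false).seq runs_bump))))).congr ?_ ?_
  · simp; omega
  · simp [gatesCode, encGate, encWire]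

/-- Copy `n` wires. -/
def copyWires : ℕ → Prog Reg ι
  | 0 => .skip
  | n + 1 => .seq copyWire (copyWires n)

theorem runs_copyWires (ht : S .tmp = []) (ws : List ℕ) :
    Runs M (copyWires ws.length) (mid S o p (ws.flatMap encWire ++ v))
      ((ws.map fun w => 5 * w + 10).sum + 1)
      (mid S ((gatesCode (ws.map fun w => Gate.max w w)).reverse ++ o) (p + ws.length) v) := by
  induction ws generalizing o p with
  | nil => exact Runs.skip.congr (by simp) (by simp [gatesCode])
  | cons w ws ih =>
    rw [List.flatMap_cons, List.append_assoc]
    refine ((runs_copyWire ht w).seq ih).congr (by simp; omega) ?_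
    simp [gatesCode]
    congr 1; omega

/-- Write the gate for a constant and push its wire. -/
def emitConst (k : Fin 6) : Prog Reg ι :=
  -- A list marker, followed by the tag of a constant.
  .seq (emitBits [true, false, false, false]) (.seq (appendTo .tmp (.Q k) .out)
    (.seq pushPos (.push .pos true)))

theorem runs_emitConst (ht : S .tmp = []) {k : Fin 6} {q : ℚ} (hq : S (.Q k) = encRat q) :
    Runs M (emitConst k) (mid S o p v) (5 * (encRat q).length + 5 * p + 11)
      (mid S ((gatesCode [.const q]).reverse ++ o) (p + 1) (encWire p ++ v)) := by
  have h2 : Runs M (appendTo .tmp (.Q k) .out) (mid S ([true, false, false, false].reverse ++ o) p v)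
      (5 * (encRat q).length + 2)
      (mid S ((encRat q).reverse ++ ([true, false, false, false].reverse ++ o)) p v) := by
    refine (runs_appendTo (by simp) (by simp) (by simp) _ ?_).congr ?_ ?_
    · rw [mid_of_ne (by simp) (by simp) (by simp), ht]
    · rw [mid_of_ne (by simp) (by simp) (by simp), hq]
    · rw [mid_of_ne (by simp) (by simp) (by simp), hq]; simp
  refine ((runs_emitBits _).seq (h2.seq ((runs_pushPos ht).seq runs_bump))).congr ?_ ?_
  · simp; omega
  · simp [gatesCode, encGate]

/-- Pop two wires, write a gate that reads them, and push its wire. -/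
def emitOp (o : Op) : Prog Reg ι :=
  .seq (emitBits (true :: o.bits)) (.seq popWire (.seq popWire (.seq pushPos (.push .pos true))))

theorem runs_emitOp (ht : S .tmp = []) (op : Op) (i j : ℕ) :
    Runs M (emitOp op) (mid S o p (encWire i ++ (encWire j ++ v))) (2 * i + 2 * j + 5 * p + 13)
      (mid S ((gatesCode [op.gate i j]).reverse ++ o) (p + 1) (encWire p ++ v)) := by
  refine ((runs_emitBits _).seq ((runs_popWire i).seq ((runs_popWire j).seq
    ((runs_pushPos ht).seq runs_bump)))).congr ?_ ?_
  · have : op.bits.length = 3 := by cases op <;> rfl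
    simp [this]; omega
  · simp [gatesCode, encGate_gate]

/-- Write the gates of circuit `k`, after copying its `n` arguments; the number of the first copied
wire is left in `base`. -/
def embed (k : Fin 3) (n : ℕ) : Prog Reg ι :=
  .seq (appendTo .tmp .pos .base) (.seq (copyWires n) (.seq (scanGates (.G k))
    (moveBits .bak (.G k))))

theorem isSrc_G (k : Fin 3) : IsSrc (.G k) := by simp [IsSrc]

theorem isSrc_O (k : Fin 3) : IsSrc (.O k) := by simp [IsSrc]

theorem isSrc_inp : IsSrc .inp := by simp [IsSrc]

/-- Scanning leaves the code of the gates reversed in `bak`, and moving it back restores `G k`; so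
an expression may call the same circuit several times. -/
theorem runs_embed (ht : S .tmp = []) (hb : S .base = []) (hk : S .bak = []) {k : Fin 3}
    {gs : List Gate} (hG : S (.G k) = encList encGate gs) (ws : List ℕ) :
    Runs M (embed k ws.length) (mid S o p (ws.flatMap encWire ++ v))
      (5 * p + 4 + (ws.map fun w => 5 * w + 10).sum + 9 * (p + 1) * (encList encGate gs).length +
        2 * (encList encGate gs).length)
      (mid (Function.update S .base (List.replicate p true))
        ((gatesCode (ws.map (fun w => Gate.max w w) ++ gs.map (Gate.shift p))).reverse ++ o)
        (p + ws.length + gs.length) v) := by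
  set S1 := Function.update S .base (List.replicate p true) with hS1
  have ht1 : S1 .tmp = [] := by simp [hS1, ht]
  have h1 : Runs M (appendTo .tmp .pos .base) (mid S o p (ws.flatMap encWire ++ v)) (5 * p + 2)
      (mid S1 o p (ws.flatMap encWire ++ v)) := by
    refine (runs_appendTo (by simp) (by simp) (by simp) _ ?_).congr (by simp) ?_
    · rw [mid_of_ne (by simp) (by simp) (by simp), ht]
    · rw [mid_of_ne (r := .base) (by simp) (by simp) (by simp), hb,
        update_mid_of_ne (by simp) (by simp) (by simp)]
      simp [hS1]
  have h2 := runs_copyWires (M := M) (o := o) (p := p) (v := v) ht1 ws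
  have h3 := scans_gates (M := M) (b := p) (isSrc_G k) gs
    (mid S1 ((gatesCode (ws.map fun w => Gate.max w w)).reverse ++ o) (p + ws.length) v) []
    (by rw [mid_of_ne (by simp) (by simp) (by simp)]; simp [hS1])
    (by rw [mid_of_ne (by simp) (by simp) (by simp), ht1])
    (by rw [mid_of_ne (by simp) (by simp) (by simp)]; simp [hS1, hG])
  refine (h1.seq (h2.seq (h3.seq (runs_moveBits (by simp) _)))).congr ?_ ?_
  · simp [scanned, mid, hS1, hk]; omega
  · funext r
    simp only [scanned, mid, hS1, Function.update_apply, gatesCode]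
    split_ifs <;> simp_all
    omega

end Emit

/-! ### Emitting calls of circuits and whole expressions -/

section Emit

variable {ι : Type} [DecidableEq ι] {M : ι → TM2ComputableAux Bool Bool}
  {S : Reg → List Bool} {o v : List Bool} {p : ℕ}

/-- The stacks `S` while the outputs of circuit `k` are being read. -/
def reading (S : Reg → List Bool) (k : Fin 3) (rest bk : List Bool) : Reg → List Bool :=
  Function.update (Function.update S (.O k) rest) .bak bk

theorem update_reading_O (k : Fin 3) (rest bk x : List Bool) :
    Function.update (mid (reading S k rest bk) o p v) (.O k) x = mid (reading S k x bk) o p v := by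
  rw [update_mid_of_ne (by simp) (by simp) (by simp)]
  congr 1
  funext r
  simp only [reading, Function.update_apply]
  split_ifs <;> simp_all

theorem mid_reading_O (k : Fin 3) (rest bk : List Bool) :
    mid (reading S k rest bk) o p v (.O k) = rest := by
  rw [mid_of_ne (by simp) (by simp) (by simp)]
  simp [reading]

theorem runs_push_bak (k : Fin 3) (b : Bool) (rest bk : List Bool) :
    Runs M (.push .bak b) (mid (reading S k rest bk) o p v) 1
      (mid (reading S k rest (b :: bk)) o p v) := by
  refine (Runs.push b).congr le_rfl ?_
  rw [update_mid_of_ne (by simp) (by simp) (by simp), mid_of_ne (by simp) (by simp) (by simp)]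
  simp [reading]

/-- Skip an output of circuit `k`. -/
def skipOutput (k : Fin 3) : Prog Reg ι :=
  .case (.O k) (.seq (.push .bak true) (.seq (.loopT (.O k) (.push .bak true))
    (.push .bak false))) .skip

theorem runs_skipOutput (k : Fin 3) (w : ℕ) (rest bk : List Bool) :
    Runs M (skipOutput k) (mid (reading S k (true :: (encWire w ++ rest)) bk) o p v) (2 * w + 4)
      (mid (reading S k rest ((true :: encWire w).reverse ++ bk)) o p v) := by
  have key : ∀ w bk, Runs M (.loopT (.O k) (.push .bak true))
      (mid (reading S k (encWire w ++ rest) bk) o p v)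
      (2 * w + 1) (mid (reading S k rest (List.replicate w true ++ bk)) o p v) := by
    intro w
    induction w with
    | zero =>
      intro bk
      exact (Runs.loopT_false (l := rest) (by rw [mid_reading_O]; simp [encWire])).congr
        (by simp) (by simp [update_reading_O])
    | succ w ih =>
      intro bk
      refine (Runs.loopT_true (l := encWire w ++ rest)
        (by rw [mid_reading_O]; simp [encWire, List.replicate_succ])
        (S' := mid (reading S k (encWire w ++ rest) (true :: bk)) o p v) (T := 1)
          ?_ (ih _)).congr (by omega) ?_
      · rw [update_reading_O]
        exact runs_push_bak k true _ bk
      · rw [List.replicate_succ']; simp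
  refine (Runs.case_true (l := encWire w ++ rest) (mid_reading_O ..) (by
    rw [update_reading_O]
    exact (runs_push_bak k true _ bk).seq ((key w _).seq (runs_push_bak k false _ _)))).congr
      (by omega) ?_
  simp [encWire]

/-- Push an output of circuit `k` to the number on top of `wires`. -/
def takeOutput (k : Fin 3) : Prog Reg ι :=
  .case (.O k) (.seq (.push .bak true) (.seq (.loopT (.O k) (.seq (.push .wires true)
    (.push .bak true))) (.push .bak false))) .skip

theorem runs_takeOutput (k : Fin 3) (w : ℕ) (rest bk : List Bool) :
    Runs M (takeOutput k) (mid (reading S k (true :: (encWire w ++ rest)) bk) o p v) (3 * w + 4)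
      (mid (reading S k rest ((true :: encWire w).reverse ++ bk)) o p
        (List.replicate w true ++ v)) := by
  have key : ∀ w bk v, Runs M (.loopT (.O k) (.seq (.push .wires true) (.push .bak true)))
      (mid (reading S k (encWire w ++ rest) bk) o p v)
      (3 * w + 1) (mid (reading S k rest (List.replicate w true ++ bk)) o p
        (List.replicate w true ++ v)) := by
    intro w
    induction w with
    | zero =>
      intro bk v
      exact (Runs.loopT_false (l := rest) (by rw [mid_reading_O]; simp [encWire])).congr
        (by simp) (by simp [update_reading_O])
    | succ w ih =>
      intro bk v
      refine (Runs.loopT_true (l := encWire w ++ rest)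
        (by rw [mid_reading_O]; simp [encWire, List.replicate_succ])
        (S' := mid (reading S k (encWire w ++ rest) (true :: bk)) o p (true :: v)) (T := 2)
          ?_ (ih _ _)).congr (by omega) ?_
      · rw [update_reading_O]
        exact (runs_push_wires true).seq (runs_push_bak k true _ bk)
      · rw [List.replicate_succ']; simp
  refine (Runs.case_true (l := encWire w ++ rest) (mid_reading_O ..) (by
    rw [update_reading_O]
    exact (runs_push_bak k true _ bk).seq ((key w _ _).seq (runs_push_bak k false _ _)))).congr
      (by omega) ?_
  simp [encWire]

/-- Push the `j`-th output of circuit `k` to the number on top of `wires`. -/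
def pickOutput (k : Fin 3) : ℕ → Prog Reg ι
  | 0 => takeOutput k
  | j + 1 => .seq (skipOutput k) (pickOutput k j)

/-- Reading stops in the middle of the list of outputs. Afterwards it matters only that the part
read, kept reversed in `bak`, and the unread part still make up the whole code, so that moving `bak`
back restores `O k`. -/
theorem runs_pickOutput (k : Fin 3) (j : ℕ) (l : List ℕ) (hj : j < l.length) (bk : List Bool) :
    ∃ rest bk', bk'.reverse ++ rest = encList encWire l ∧
    Runs M (pickOutput k j) (mid (reading S k (encList encWire l) bk) o p v)
      (3 * (encList encWire l).length)
      (mid (reading S k rest (bk' ++ bk)) o p (List.replicate (l.getD j 0) true ++ v)) := by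
  induction l generalizing j bk with
  | nil => simp at hj
  | cons w l ih =>
    have e : encList encWire (w :: l) = true :: (encWire w ++ encList encWire l) := by
      simp [encList]
    have hl : (encList encWire (w :: l)).length = w + 2 + (encList encWire l).length := by
      rw [e]; simp [length_encWire]; omega
    rw [hl, e]
    cases j with
    | zero =>
      refine ⟨encList encWire l, (true :: encWire w).reverse, by simp, ?_⟩
      exact (runs_takeOutput k w _ bk).mono (by omega)
    | succ j =>
      obtain ⟨rest, bk', h1, h2⟩ := ih j (by simpa using hj) ((true :: encWire w).reverse ++ bk)
      refine ⟨rest, bk' ++ (true :: encWire w).reverse, by simp [← h1], ?_⟩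
      refine ((runs_skipOutput k w _ bk).seq h2).congr (by omega) ?_
      simp

/-- Write the gates of circuit `k` applied to the `n` wires on top of `wires`, and push the wire of
its `j`-th output. -/
def emitCall (k : Fin 3) (j n : ℕ) : Prog Reg ι :=
  .seq (embed k n) (.seq (.push .wires false) (.seq (appendTo .tmp .base .wires)
    (.seq (pickOutput k j) (.seq (moveBits .bak (.O k)) (clear .base)))))

/-- The wire of the result is a sum formed in unary on `wires`: a terminator, the ones of `base`,
then the ones of the selected output. -/
theorem runs_emitCall (ht : S .tmp = []) (hb : S .base = []) (hk : S .bak = []) {k : Fin 3}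
    {gs : List Gate} (hG : S (.G k) = encList encGate gs) {l : List ℕ}
    (hO : S (.O k) = encList encWire l) {j : ℕ} (hj : j < l.length) (ws : List ℕ) :
    Runs M (emitCall k j ws.length) (mid S o p (ws.flatMap encWire ++ v))
      (5 * p + 4 + (ws.map fun w => 5 * w + 10).sum + 9 * (p + 1) * (encList encGate gs).length +
        2 * (encList encGate gs).length + 7 * p + 5 * (encList encWire l).length + 5)
      (mid S ((gatesCode (ws.map (fun w => Gate.max w w) ++ gs.map (Gate.shift p))).reverse ++ o)
        (p + ws.length + gs.length) (encWire (p + l.getD j 0) ++ v)) := by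
  have h1 := runs_embed (M := M) (o := o) (p := p) (v := v) ht hb hk hG ws
  set S1 := Function.update S .base (List.replicate p true) with hS1
  generalize ((gatesCode (ws.map (fun w => Gate.max w w) ++ gs.map (Gate.shift p))).reverse ++ o)
    = o' at h1 ⊢
  generalize p + ws.length + gs.length = p' at h1 ⊢
  have h3 : Runs M (appendTo .tmp .base .wires) (mid S1 o' p' (false :: v)) (5 * p + 2)
      (mid S1 o' p' (List.replicate p true ++ false :: v)) := by
    have hb1 : mid S1 o' p' (false :: v) .base = List.replicate p true := by
      rw [mid_of_ne (by simp) (by simp) (by simp)]; simp [hS1]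
    refine (runs_appendTo (by simp) (by simp) (by simp) _ ?_).congr ?_ ?_
    · rw [mid_of_ne (by simp) (by simp) (by simp)]; simp [hS1, ht]
    · rw [hb1]; simp
    · rw [hb1]; simp
  obtain ⟨rest, bk, e, h4⟩ := runs_pickOutput (M := M) (S := S1) (o := o') (p := p')
    (v := List.replicate p true ++ false :: v) k j l hj []
  have hr : reading S1 k (encList encWire l) [] = S1 := by
    rw [reading, ← hO, ← hk]
    have e1 : S (.O k) = S1 (.O k) := by simp [hS1]
    have e2 : S .bak = S1 .bak := by simp [hS1]
    rw [e1, Function.update_eq_self, e2, Function.update_eq_self]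
  rw [hr, List.append_nil] at h4
  have hbk : mid (reading S1 k rest bk) o' p'
      (List.replicate (l.getD j 0) true ++ (List.replicate p true ++ false :: v)) .bak = bk := by
    rw [mid_of_ne (by simp) (by simp) (by simp)]; simp [reading]
  have hlen : bk.length + rest.length = (encList encWire l).length := by rw [← e]; simp
  have h5 : Runs M (moveBits .bak (.O k)) (mid (reading S1 k rest bk) o' p'
      (List.replicate (l.getD j 0) true ++ (List.replicate p true ++ false :: v)))
      (2 * (encList encWire l).length + 1) (mid S1 o' p'
      (List.replicate (l.getD j 0) true ++ (List.replicate p true ++ false :: v))) := by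
    refine (runs_moveBits (by simp) _).congr (by rw [hbk]; omega) ?_
    rw [hbk, mid_reading_O, e]
    rw [update_mid_of_ne (by simp) (by simp) (by simp),
      update_mid_of_ne (by simp) (by simp) (by simp)]
    congr 1
    rw [← hr]
    funext r
    simp only [reading, Function.update_apply]
    split_ifs <;> simp_all
  have h6 : Runs M (clear .base) (mid S1 o' p'
      (List.replicate (l.getD j 0) true ++ (List.replicate p true ++ false :: v)))
      (2 * p + 1) (mid S o' p'
      (List.replicate (l.getD j 0) true ++ (List.replicate p true ++ false :: v))) := by
    refine (runs_clear _).congr ?_ ?_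
    · rw [mid_of_ne (by simp) (by simp) (by simp)]; simp [hS1]
    · rw [update_mid_of_ne (by simp) (by simp) (by simp)]
      simp [hS1, ← hb]
  refine (h1.seq ((runs_push_wires false).seq (h3.seq (h4.seq (h5.seq h6))))).congr ?_ ?_
  · omega
  · rw [encWire, Nat.add_comm p, List.replicate_add, List.append_assoc, List.append_assoc,
      List.singleton_append]

/-- The programs of a list, the last one first. -/
def emitAll : List (Prog Reg ι) → Prog Reg ι
  | [] => .skip
  | c :: cs => .seq (emitAll cs) c

/-- Write the gates of an expression and push the wire of its value. -/
def emit : Expr → Prog Reg ι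
  | .inp i => pushAll .wires (encWire i)
  | .const k => emitConst k
  | .op o a b => .seq (emit b) (.seq (emit a) (emitOp o))
  | .call k j n args => .seq (emitAll (List.ofFn fun i => emit (args i))) (emitCall k j n)

/-- The stacks hold the circuits and constants of a context. -/
structure Holds (C : Ctx) (S : Reg → List Bool) : Prop where
  tmp : S .tmp = []
  base : S .base = []
  bak : S .bak = []
  G : ∀ k, S (.G k) = encList encGate (C.gates k)
  O : ∀ k, S (.O k) = encList encWire (C.outs k)
  Q : ∀ k, S (.Q k) = encRat (C.q k)

/-- The codes of circuits and constants have polynomial size. -/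
structure CtxBdd {α : Type} (ℓ : α → ℕ) (C : α → Ctx) : Prop where
  G : ∀ k, PolyBdd ℓ fun a => (encList encGate ((C a).gates k)).length
  O : ∀ k, PolyBdd ℓ fun a => (encList encWire ((C a).outs k)).length
  Q : ∀ k, PolyBdd ℓ fun a => (encRat ((C a).q k)).length

theorem length_le_encList {β : Type} (e : β → List Bool) (l : List β) :
    l.length ≤ (encList e l).length := by
  rw [length_encList]
  have : (l.map fun _ => 1).sum ≤ (l.map fun a => (e a).length + 1).sum :=
    List.sum_le_sum fun a _ => by omega
  simp at this ⊢
  omega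

theorem getD_le_encList (l : List ℕ) (j : ℕ) : l.getD j 0 ≤ (encList encWire l).length := by
  induction l generalizing j with
  | nil => simp
  | cons w l ih =>
    have : (encList encWire (w :: l)).length = w + 2 + (encList encWire l).length := by
      simp [encList, length_encWire]; omega
    rw [this]
    cases j with
    | zero => simp; omega
    | succ j => have := ih j; simp at this ⊢; omega

/-- Expressions that refer to `n` inputs and to circuits with given numbers of inputs and
outputs. -/
def Expr.WF (n : ℕ) (ar on : Fin 3 → ℕ) : Expr → Prop
  | .inp i => i < n
  | .const _ => True
  | .op _ a b => a.WF n ar on ∧ b.WF n ar on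
  | .call k j m args => m = ar k ∧ j < on k ∧ ∀ i, (args i).WF n ar on

theorem length_compileAll (cs : List (ℕ → List Gate × ℕ)) (p : ℕ) :
    (compileAll cs p).2.length = cs.length := by
  induction cs with
  | nil => rfl
  | cons c cs ih => simp [compileAll, ih]

section Families

variable {α : Type} {ℓ : α → ℕ}

/-- The program `P` writes the gates `(c a p).1` and pushes the wire `(c a p).2`, in polynomial
time. -/
def Emits (M : ι → TM2ComputableAux Bool Bool) (ℓ : α → ℕ) (S : α → Reg → List Bool)
    (P : Prog Reg ι) (c : α → ℕ → List Gate × ℕ) : Prop :=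
  ∀ (o : α → List Bool) (p : α → ℕ) (v : α → List Bool), PolyBdd ℓ p →
    PolyBdd ℓ (fun a => (c a (p a)).1.length) ∧ PolyBdd ℓ (fun a => (c a (p a)).2) ∧
    PolyRuns M ℓ P (fun a => mid (S a) (o a) (p a) (v a))
      (fun a => mid (S a) ((gatesCode (c a (p a)).1).reverse ++ o a)
        (p a + (c a (p a)).1.length) (encWire (c a (p a)).2 ++ v a))

/-- Running the programs from the last to the first leaves the wires on the stack in the order of
the list, the order in which `copyWires` pops them. -/
theorem emits_all {S : α → Reg → List Bool} {β : Type} (P : β → Prog Reg ι)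
    (c : β → α → ℕ → List Gate × ℕ) (l : List β) (h : ∀ i ∈ l, Emits M ℓ S (P i) (c i))
    (o : α → List Bool) (p : α → ℕ) (v : α → List Bool) (hp : PolyBdd ℓ p) :
    PolyBdd ℓ (fun a => (compileAll (l.map fun i => c i a) (p a)).1.length) ∧
    PolyBdd ℓ (fun a => ((compileAll (l.map fun i => c i a) (p a)).2.map
      fun w => 5 * w + 10).sum) ∧
    PolyRuns M ℓ (emitAll (l.map P)) (fun a => mid (S a) (o a) (p a) (v a))
      (fun a => mid (S a) ((gatesCode (compileAll (l.map fun i => c i a) (p a)).1).reverse ++ o a)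
        (p a + (compileAll (l.map fun i => c i a) (p a)).1.length)
        ((compileAll (l.map fun i => c i a) (p a)).2.flatMap encWire ++ v a)) := by
  induction l with
  | nil =>
    refine ⟨?_, ?_, fun _ => 1, PolyBdd.const 1, fun a => ?_⟩
    · simpa [compileAll] using PolyBdd.const 0
    · simpa [compileAll] using PolyBdd.const 0
    · exact Runs.skip.congr le_rfl (by simp [compileAll, gatesCode])
  | cons i l ih =>
    obtain ⟨h1, h2, h3⟩ := ih fun i hi => h i (by simp [hi])
    obtain ⟨g1, g2, g3⟩ := h i (by simp) (fun a =>
        (gatesCode (compileAll (l.map fun i => c i a) (p a)).1).reverse ++ o a)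
      (fun a => p a + (compileAll (l.map fun i => c i a) (p a)).1.length)
      (fun a => (compileAll (l.map fun i => c i a) (p a)).2.flatMap encWire ++ v a) (hp.add h1)
    refine ⟨?_, ?_, (h3.seq g3).congr fun a => ?_⟩
    · exact (h1.add g1).mono fun a => by simp [compileAll]
    · exact ((((PolyBdd.const 5).mul g2).add (PolyBdd.const 10)).add h2).mono
        fun a => by simp [compileAll]
    · simp [compileAll, gatesCode, Nat.add_assoc]

/-- The expression is fixed while the context varies with the instance. So the induction has a
constant number of steps, each with a polynomial cost, even though every call duplicates the code of
a circuit. -/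
theorem emits_compile {C : α → Ctx} {S : α → Reg → List Bool} (hS : ∀ a, Holds (C a) (S a))
    (hC : CtxBdd ℓ C) {n : ℕ} {ar on : Fin 3 → ℕ} (hon : ∀ a k, on k ≤ ((C a).outs k).length)
    (e : Expr) (he : e.WF n ar on) :
    Emits M ℓ S (emit e) (fun a => compile (C a) e) := by
  induction e with
  | inp i =>
    intro o p v hp
    refine ⟨by simpa [compile] using PolyBdd.const 0, by simpa [compile] using PolyBdd.const i,
      _, PolyBdd.const ((encWire i).length + 1), fun a => ?_⟩
    exact (runs_pushAll _ _).congr le_rfl (by simp [compile, gatesCode])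
  | const k =>
    intro o p v hp
    refine ⟨by simpa [compile] using PolyBdd.const 1, by simpa [compile] using hp,
      _, (((PolyBdd.const 5).mul (hC.Q k)).add ((PolyBdd.const 5).mul hp)).add
        (PolyBdd.const 11), fun a => ?_⟩
    exact (runs_emitConst (hS a).tmp ((hS a).Q k)).congr le_rfl (by simp [compile])
  | op o a b iha ihb =>
    intro out p v hp
    obtain ⟨b1, b2, b3⟩ := ihb he.2 out p v hp
    obtain ⟨a1, a2, a3⟩ := iha he.1 (fun x => (gatesCode (compile (C x) b (p x)).1).reverse ++ out x)
      (fun x => p x + (compile (C x) b (p x)).1.length)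
      (fun x => encWire (compile (C x) b (p x)).2 ++ v x) (hp.add b1)
    refine ⟨?_, ?_, ?_⟩
    · exact ((b1.add a1).add (PolyBdd.const 1)).mono fun x => by simp [compile]; omega
    · exact ((hp.add b1).add a1).mono fun x => by simp [compile]
    · refine b3.seq (a3.seq ⟨_, ((((PolyBdd.const 2).mul a2).add ((PolyBdd.const 2).mul b2)).add
        ((PolyBdd.const 5).mul ((hp.add b1).add a1))).add (PolyBdd.const 13), fun x => ?_⟩)
      refine (runs_emitOp (hS x).tmp o _ _).congr le_rfl ?_
      simp [compile, gatesCode, Nat.add_assoc]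
  | call k j m args ih =>
    intro o p v hp
    obtain ⟨rfl, hj, hargs⟩ := he
    obtain ⟨h1, h2, h3⟩ := emits_all (fun i => emit (args i)) (fun i a => compile (C a) (args i))
      (List.finRange (ar k)) (fun i _ => ih i (hargs i)) o p v hp
    simp only [← List.ofFn_eq_map] at h1 h2 h3
    have hlen : ∀ a, ((C a).gates k).length ≤ (encList encGate ((C a).gates k)).length :=
      fun a => length_le_encList _ _
    refine ⟨?_, ?_, ?_⟩
    · refine ((h1.add (PolyBdd.const (ar k))).add (hC.G k)).mono fun a => ?_
      have := hlen a
      simp [compile, compileCall, length_compileAll]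
      omega
    · refine ((hp.add h1).add (hC.O k)).mono fun a => ?_
      have := getD_le_encList ((C a).outs k) j
      simp only [compile]
      omega
    · have hb := hp.add h1
      refine h3.seq ⟨_, ((((((((PolyBdd.const 5).mul hb).add (PolyBdd.const 4)).add h2).add
        (((PolyBdd.const 9).mul (hb.add (PolyBdd.const 1))).mul (hC.G k))).add
        ((PolyBdd.const 2).mul (hC.G k))).add ((PolyBdd.const 7).mul hb)).add
        ((PolyBdd.const 5).mul (hC.O k))).add (PolyBdd.const 5), fun a => ?_⟩
      have := runs_emitCall (M := M)
        (o := (gatesCode (compileAll (List.ofFn fun i => compile (C a) (args i)) (p a)).1).reverse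
          ++ o a)
        (p := p a + (compileAll (List.ofFn fun i => compile (C a) (args i)) (p a)).1.length)
        (v := v a)
        (hS a).tmp (hS a).base (hS a).bak ((hS a).G k) ((hS a).O k)
        (hj.trans_le (hon a k)) (compileAll (List.ofFn fun i => compile (C a) (args i)) (p a)).2
      rw [length_compileAll, List.length_ofFn] at this
      refine this.congr le_rfl ?_
      simp only [compile, compileCall, gatesCode, List.flatMap_append, List.reverse_append,
        List.append_assoc, List.length_append, List.length_map, length_compileAll,
        List.length_ofFn, Nat.add_assoc]

/-- Write the gates of circuit `k` applied to given arguments, and its outputs. -/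
def emitTail (k : Fin 3) (n : ℕ) (args : Fin n → Expr) : Prog Reg ι :=
  -- The bit `false` closes the list of gates, which `emitAll` and `embed` leave open.
  .seq (emitAll (List.ofFn fun i => emit (args i))) (.seq (embed k n) (.seq (.push .out false)
    (.seq (scanOutputs (.O k)) (.seq (moveBits .bak (.O k)) (clear .base)))))

/-- The code that `emitTail` writes. -/
def tailCode (C : Ctx) (k : Fin 3) {n : ℕ} (args : Fin n → Expr) (p : ℕ) : List Bool :=
  encList encGate (compileCall (C.gates k) (List.ofFn fun i => compile C (args i)) p) ++
    encList encWire ((C.outs k).map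
      (p + (compileAll (List.ofFn fun i => compile C (args i)) p).1.length + ·))

theorem polyRuns_emitTail {C : α → Ctx} {S : α → Reg → List Bool} (hS : ∀ a, Holds (C a) (S a))
    (hC : CtxBdd ℓ C) {n : ℕ} {ar on : Fin 3 → ℕ} (hon : ∀ a k, on k ≤ ((C a).outs k).length)
    (k : Fin 3) (m : ℕ) (args : Fin m → Expr) (hargs : ∀ i, (args i).WF n ar on)
    (o : α → List Bool) (p : ℕ) :
    ∃ p' : α → ℕ, PolyBdd ℓ p' ∧
    PolyRuns M ℓ (emitTail k m args) (fun a => mid (S a) (o a) p [])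
      (fun a => mid (S a) ((tailCode (C a) k args p).reverse ++ o a) (p' a) []) := by
  obtain ⟨h1, h2, h3⟩ := emits_all (M := M) (ℓ := ℓ) (S := S) (fun i => emit (args i))
    (fun i a => compile (C a) (args i)) (List.finRange m)
    (fun i _ => emits_compile hS hC hon (args i) (hargs i)) o (fun _ => p) (fun _ => [])
    (PolyBdd.const p)
  simp only [← List.ofFn_eq_map] at h1 h2 h3
  have hb := (PolyBdd.const p).add h1
  have hlen : ∀ a, ((C a).gates k).length ≤ (encList encGate ((C a).gates k)).length :=
    fun a => length_le_encList _ _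
  refine ⟨fun a => p + (compileAll (List.ofFn fun i => compile (C a) (args i)) p).1.length + m +
    ((C a).gates k).length, (hb.add (PolyBdd.const m)).add ((hC.G k).mono hlen),
    h3.seq ⟨_, (((((((((PolyBdd.const 5).mul hb).add (PolyBdd.const 4)).add h2).add
        (((PolyBdd.const 9).mul (hb.add (PolyBdd.const 1))).mul (hC.G k))).add
        ((PolyBdd.const 2).mul (hC.G k))).add
        (((PolyBdd.const 9).mul (hb.add (PolyBdd.const 1))).mul (hC.O k))).add
        ((PolyBdd.const 2).mul (hC.O k))).add ((PolyBdd.const 2).mul hb)).add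
        (PolyBdd.const 3), fun a => ?_⟩⟩
  set L := compileAll (List.ofFn fun i => compile (C a) (args i)) p with hL
  have hLm : L.2.length = m := by rw [hL, length_compileAll, List.length_ofFn]
  have h4 := runs_embed (M := M) (o := (gatesCode L.1).reverse ++ o a) (p := p + L.1.length)
    (v := []) (hS a).tmp (hS a).base (hS a).bak ((hS a).G k) L.2
  rw [hLm] at h4
  set S1 := Function.update (S a) .base (List.replicate (p + L.1.length) true) with hS1
  set o' := false :: ((gatesCode (L.2.map (fun w => Gate.max w w) ++
    ((C a).gates k).map (Gate.shift (p + L.1.length)))).reverse ++ ((gatesCode L.1).reverse ++ o a))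
    with ho'
  set p' := p + L.1.length + m + ((C a).gates k).length
  have hbs : ∀ x, Function.update (mid S1 x p' []) .base [] = mid (S a) x p' [] := by
    intro x
    rw [update_mid_of_ne (by simp) (by simp) (by simp)]
    simp [hS1, ← (hS a).base]
  have h5 := scans_outputs (M := M) (b := p + L.1.length) (isSrc_O k) ((C a).outs k)
    (mid S1 o' p' []) []
    (by rw [mid_of_ne (by simp) (by simp) (by simp)]; simp [hS1])
    (by rw [mid_of_ne (by simp) (by simp) (by simp)]; simp [hS1, (hS a).tmp])
    (by rw [mid_of_ne (by simp) (by simp) (by simp)]; simp [hS1, (hS a).O])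
  have h6 := runs_moveBits (M := M) (src := Reg.bak) (d := Reg.O k) (by simp)
    (scanned (mid S1 o' p' []) (.O k) [] (encList encWire ((C a).outs k))
      (encList encWire (((C a).outs k).map (p + L.1.length + ·))) 0)
  -- After scanning, the whole code of the outputs is in `bak` and `O k` is empty; moving it back
  -- restores the context.
  have e6 : Function.update (Function.update (scanned (mid S1 o' p' []) (.O k) []
      (encList encWire ((C a).outs k))
      (encList encWire (((C a).outs k).map (p + L.1.length + ·))) 0) .bak []) (.O k)
      ((scanned (mid S1 o' p' []) (.O k) [] (encList encWire ((C a).outs k))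
      (encList encWire (((C a).outs k).map (p + L.1.length + ·))) 0 .bak).reverse ++
      (scanned (mid S1 o' p' []) (.O k) [] (encList encWire ((C a).outs k))
      (encList encWire (((C a).outs k).map (p + L.1.length + ·))) 0 (.O k))) =
      mid S1 ((encList encWire (((C a).outs k).map (p + L.1.length + ·))).reverse ++ o') p' [] := by
    have q1 := (hS a).O k
    have q2 := (hS a).bak
    funext r
    simp only [scanned, mid, hS1, Function.update_apply]
    split_ifs <;> simp_all
  rw [e6] at h6
  refine (h4.seq ((runs_push_out false).seq (h5.seq (h6.seq (runs_clear _))))).congr ?_ ?_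
  · have q2 := (hS a).bak
    have e7 : (scanned (mid S1 o' p' []) (.O k) [] (encList encWire ((C a).outs k))
      (encList encWire (((C a).outs k).map (p + L.1.length + ·))) 0 .bak).length =
        (encList encWire ((C a).outs k)).length := by
      simp [scanned, mid, hS1, q2]
    have e8 : (mid S1 ((encList encWire (((C a).outs k).map (p + L.1.length + ·))).reverse ++ o')
        p' [] .base).length = p + L.1.length := by
      rw [mid_of_ne (by simp) (by simp) (by simp)]; simp [hS1]
    rw [e7, e8]
    omega
  · rw [hbs]
    simp [tailCode, compileCall, ← hL, ho', gatesCode, encList]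
    rfl

end Families

end Emit

/-! ### The circuit of an expression -/

theorem runGates_append (a b : List Gate) (v : List ℝ) :
    runGates (a ++ b) v = runGates b (runGates a v) := by
  induction a generalizing v with
  | nil => rfl
  | cons g a ih => exact ih _

theorem exists_runGates (gs : List Gate) (v : List ℝ) :
    ∃ t, runGates gs v = v ++ t ∧ t.length = gs.length := by
  induction gs generalizing v with
  | nil => exact ⟨[], by simp [runGates], rfl⟩
  | cons g gs ih =>
    obtain ⟨t, h, h'⟩ := ih (v ++ [g.eval (fun i => v.getD i 0)])
    exact ⟨g.eval (fun i => v.getD i 0) :: t,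
      by rw [runGates, h, List.append_assoc, List.singleton_append], by simp [h']⟩

theorem length_runGates (gs : List Gate) (v : List ℝ) :
    (runGates gs v).length = v.length + gs.length := by
  obtain ⟨t, h, h'⟩ := exists_runGates gs v
  simp [h, h']

theorem getD_runGates (gs : List Gate) (v : List ℝ) {i : ℕ} (hi : i < v.length) :
    (runGates gs v).getD i 0 = v.getD i 0 := by
  obtain ⟨t, h, -⟩ := exists_runGates gs v
  rw [h, List.getD_append _ _ _ _ hi]

theorem getD_append_add (u v : List ℝ) (i : ℕ) : (u ++ v).getD (u.length + i) 0 = v.getD i 0 := by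
  rw [List.getD_append_right _ _ _ _ (by omega)]
  congr 1; omega

theorem eval_shift (g : Gate) (u v : List ℝ) :
    (g.shift u.length).eval (fun i => (u ++ v).getD i 0) = g.eval (fun i => v.getD i 0) := by
  cases g <;> simp only [Gate.shift, Gate.eval, getD_append_add]

/-- No shifted reference reaches into `u`, and references past the end read the default `0` on both
sides, so the gates need not be sorted. -/
theorem runGates_shift (gs : List Gate) (u v : List ℝ) :
    runGates (gs.map (Gate.shift u.length)) (u ++ v) = u ++ runGates gs v := by
  induction gs generalizing v with
  | nil => rfl
  | cons g gs ih =>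
    simp only [List.map_cons, runGates, eval_shift]
    rw [List.append_assoc, ih]

theorem gatesWF_append (k : ℕ) (a b : List Gate) :
    GatesWF k (a ++ b) ↔ GatesWF k a ∧ GatesWF (k + a.length) b := by
  induction a generalizing k with
  | nil => simp [GatesWF]
  | cons g a ih =>
    simp only [List.cons_append, GatesWF, ih, List.length_cons, and_assoc]
    rw [show k + 1 + a.length = k + (a.length + 1) by omega]

theorem gatesWF_shift (b k : ℕ) (gs : List Gate) (h : GatesWF k gs) :
    GatesWF (b + k) (gs.map (Gate.shift b)) := by
  induction gs generalizing k with
  | nil => trivial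
  | cons g gs ih =>
    refine ⟨?_, ih (k + 1) h.2⟩
    have := h.1
    cases g <;> simp only [Gate.shift, Gate.RefsLT] at this ⊢ <;> omega

/-- The value of an expression. -/
noncomputable def Expr.eval (C : Ctx) (x : ℕ → ℝ) : Expr → ℝ
  | .inp i => x i
  | .const k => C.q k
  | .op o a b => o.eval (a.eval C x) (b.eval C x)
  | .call k j _ args =>
    (runGates (C.gates k) (List.ofFn fun i => (args i).eval C x)).getD ((C.outs k).getD j 0) 0

/-- The circuits of a context are sorted, and have the given numbers of inputs and at least the
given numbers of outputs. -/
structure Ctx.Valid (C : Ctx) (ar on : Fin 3 → ℕ) : Prop where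
  wf : ∀ k, GatesWF (ar k) (C.gates k)
  outs_lt : ∀ k, ∀ w ∈ C.outs k, w < ar k + (C.gates k).length
  on_le : ∀ k, on k ≤ (C.outs k).length

/-- The compiler `c` produces sorted gates that compute `y` from inputs `x`. -/
def Sound (n : ℕ) (x : ℕ → ℝ) (c : ℕ → List Gate × ℕ) (y : ℝ) : Prop :=
  ∀ v : List ℝ, n ≤ v.length → (∀ i < n, v.getD i 0 = x i) →
    GatesWF v.length (c v.length).1 ∧ (c v.length).2 < v.length + (c v.length).1.length ∧
    (runGates (c v.length).1 v).getD (c v.length).2 0 = y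

theorem sound_all {n : ℕ} {x : ℕ → ℝ} {β : Type} (c : β → ℕ → List Gate × ℕ) (y : β → ℝ)
    (l : List β) (h : ∀ i ∈ l, Sound n x (c i) (y i)) (v : List ℝ) (hv : n ≤ v.length)
    (hx : ∀ i < n, v.getD i 0 = x i) :
    GatesWF v.length (compileAll (l.map c) v.length).1 ∧
    (∀ w ∈ (compileAll (l.map c) v.length).2,
      w < v.length + (compileAll (l.map c) v.length).1.length) ∧
    (compileAll (l.map c) v.length).2.map
      (fun w => (runGates (compileAll (l.map c) v.length).1 v).getD w 0) = l.map y := by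
  induction l with
  | nil => exact ⟨trivial, by simp [compileAll], rfl⟩
  | cons i l ih =>
    obtain ⟨h1, h2, h3⟩ := ih fun i hi => h i (by simp [hi])
    simp only [List.map_cons, compileAll]
    set L := compileAll (l.map c) v.length
    have hlen := length_runGates L.1 v
    obtain ⟨g1, g2, g3⟩ := h i (by simp) (runGates L.1 v) (by omega)
      (fun i hi => by rw [getD_runGates _ _ (by omega), hx i hi])
    rw [hlen] at g1 g2 g3
    refine ⟨(gatesWF_append _ _ _).2 ⟨h1, g1⟩, ?_, ?_⟩
    · intro w hw
      rw [List.mem_cons] at hw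
      rw [List.length_append]
      rcases hw with rfl | hw
      · omega
      · have := h2 w hw; omega
    · rw [runGates_append, g3, ← h3]
      congr 1
      refine List.map_congr_left fun w hw => ?_
      have := h2 w hw
      rw [getD_runGates _ _ (by omega)]

theorem runGates_copy (ws : List ℕ) (v : List ℝ) (hw : ∀ w ∈ ws, w < v.length) :
    runGates (ws.map fun w => Gate.max w w) v = v ++ ws.map fun w => v.getD w 0 := by
  induction ws generalizing v with
  | nil => simp [runGates]
  | cons w ws ih =>
    simp only [List.map_cons, runGates, Gate.eval, max_self]
    rw [ih _ fun w' hw' => by have := hw w' (by simp [hw']); simp; omega]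
    rw [List.append_assoc]
    congr 1
    rw [List.singleton_append]
    congr 1
    refine List.map_congr_left fun w' hw' => ?_
    rw [List.getD_append _ _ _ _ (hw w' (by simp [hw']))]

theorem gatesWF_copy (ws : List ℕ) (k : ℕ) (hw : ∀ w ∈ ws, w < k) :
    GatesWF k (ws.map fun w => Gate.max w w) := by
  induction ws generalizing k with
  | nil => trivial
  | cons w ws ih =>
    exact ⟨⟨hw w (by simp), hw w (by simp)⟩,
      ih (k + 1) fun w' hw' => (hw w' (by simp [hw'])).trans (by omega)⟩

/-- The gates of a circuit applied to arguments. -/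
theorem compileCall_spec {n : ℕ} {x : ℕ → ℝ} {m : ℕ} (gs : List Gate) (hgs : GatesWF m gs)
    (c : Fin m → ℕ → List Gate × ℕ) (y : Fin m → ℝ) (h : ∀ i, Sound n x (c i) (y i)) (v : List ℝ)
    (hv : n ≤ v.length) (hx : ∀ i < n, v.getD i 0 = x i) :
    GatesWF v.length (compileCall gs (List.ofFn c) v.length) ∧
    (compileCall gs (List.ofFn c) v.length).length =
      (compileAll (List.ofFn c) v.length).1.length + m + gs.length ∧
    ∀ w, (runGates (compileCall gs (List.ofFn c) v.length) v).getD
      (v.length + (compileAll (List.ofFn c) v.length).1.length + w) 0 =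
      (runGates gs (List.ofFn y)).getD w 0 := by
  obtain ⟨h1, h2, h3⟩ := sound_all c y (List.finRange m) (fun i _ => h i) v hv hx
  simp only [← List.ofFn_eq_map] at h1 h2 h3
  have hm : (compileAll (List.ofFn c) v.length).2.length = m := by
    rw [length_compileAll, List.length_ofFn]
  set L := compileAll (List.ofFn c) v.length with hL
  have hlen := length_runGates L.1 v
  unfold compileCall
  rw [← hL]
  refine ⟨?_, ?_, fun w => ?_⟩
  · rw [gatesWF_append, gatesWF_append]
    refine ⟨h1, gatesWF_copy _ _ h2, ?_⟩
    rw [List.length_map, hm]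
    exact gatesWF_shift _ _ _ hgs
  · simp [hm]; omega
  · rw [runGates_append, runGates_append, runGates_copy _ _ fun w hw => by
      have := h2 w hw; omega]
    rw [h3, ← hlen, runGates_shift, getD_append_add]

/-- `Sound` prescribes only the first `n` wires and leaves the later ones arbitrary. This lets the
induction pass over wires produced by sibling expressions. -/
theorem sound_compile {C : Ctx} {ar on : Fin 3 → ℕ} (hC : C.Valid ar on) {n : ℕ} (x : ℕ → ℝ)
    (e : Expr) (he : e.WF n ar on) : Sound n x (compile C e) (e.eval C x) := by
  induction e with
  | inp i =>
    intro v hv hx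
    have hi : i < n := he
    exact ⟨trivial, by simp [compile]; omega, by simpa [compile, runGates, Expr.eval] using hx i hi⟩
  | const k =>
    intro v hv hx
    refine ⟨⟨trivial, trivial⟩, by simp [compile], ?_⟩
    simp [compile, runGates, Gate.eval, Expr.eval]
  | op o a b iha ihb =>
    intro v hv hx
    obtain ⟨b1, b2, b3⟩ := ihb he.2 v hv hx
    set B := compile C b v.length with hB
    have hlB := length_runGates B.1 v
    obtain ⟨a1, a2, a3⟩ := iha he.1 (runGates B.1 v) (by omega)
      (fun i hi => by rw [getD_runGates _ _ (by omega), hx i hi])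
    rw [hlB] at a1 a2 a3
    set A := compile C a (v.length + B.1.length) with hA
    have hlA := length_runGates A.1 (runGates B.1 v)
    simp only [compile, ← hB, ← hA]
    refine ⟨?_, by simp; omega, ?_⟩
    · rw [gatesWF_append, gatesWF_append]
      exact ⟨b1, a1, refsLT_gate _ _ _ _ (by omega) (by omega), trivial⟩
    · rw [runGates_append, runGates_append]
      have := getD_append_add (runGates A.1 (runGates B.1 v)) [(o.gate A.2 B.2).eval
        fun i => (runGates A.1 (runGates B.1 v)).getD i 0] 0
      rw [hlA, hlB, Nat.add_zero] at this
      rw [runGates, runGates, this]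
      simp only [List.getD_cons_zero, eval_gate, a3, Expr.eval]
      rw [getD_runGates _ _ (by omega), b3]
  | call k j m args ih =>
    intro v hv hx
    obtain ⟨rfl, hj, hargs⟩ := he
    obtain ⟨h1, h2, h3⟩ := compileCall_spec (C.gates k) (hC.wf k) (fun i => compile C (args i))
      (fun i => (args i).eval C x) (fun i => ih i (hargs i)) v hv hx
    simp only [compile]
    have hj' := hj.trans_le (hC.on_le k)
    have hmem : (C.outs k).getD j 0 ∈ C.outs k := by
      rw [List.getD_eq_getElem _ _ hj']; exact List.getElem_mem _
    have := hC.outs_lt k _ hmem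
    refine ⟨h1, by rw [h2]; omega, ?_⟩
    rw [h3]
    rfl

/-- The inputs of a circuit, as a sequence. -/
noncomputable def ofVec {n : ℕ} (x : Fin n → ℝ) : ℕ → ℝ := fun i => (List.ofFn x).getD i 0

theorem ofVec_val {n : ℕ} (x : Fin n → ℝ) (i : Fin n) : ofVec x i = x i := by
  simp [ofVec]

theorem sound_args {C : Ctx} {ar on : Fin 3 → ℕ} (hC : C.Valid ar on) {n k m : ℕ} {t : Fin 3}
    (T : ArithCircuit k m) (ht : C.gates t = T.gates) (args : Fin k → Expr)
    (hargs : ∀ i, (args i).WF n ar on) (x : Fin n → ℝ) :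
    GatesWF n (compileCall (C.gates t) (List.ofFn fun i => compile C (args i)) n) ∧
    (compileCall (C.gates t) (List.ofFn fun i => compile C (args i)) n).length =
      (compileAll (List.ofFn fun i => compile C (args i)) n).1.length + k + (C.gates t).length ∧
    ∀ w, (runGates (compileCall (C.gates t) (List.ofFn fun i => compile C (args i)) n)
      (List.ofFn x)).getD
      (n + (compileAll (List.ofFn fun i => compile C (args i)) n).1.length + w) 0 =
      (runGates (C.gates t) (List.ofFn fun i => (args i).eval C (ofVec x))).getD w 0 := by
  have := compileCall_spec (C.gates t) (by rw [ht]; exact T.gates_wf)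
      (fun i => compile C (args i)) (fun i => (args i).eval C (ofVec x))
      (fun i => sound_compile hC (ofVec x) (args i) (hargs i)) (List.ofFn x) (by simp)
      (fun _ _ => rfl)
  rwa [List.length_ofFn] at this

/-- The circuit that applies a circuit `T` to the values of expressions. -/
noncomputable def build (C : Ctx) (ar on : Fin 3 → ℕ) (hC : C.Valid ar on) (n : ℕ) {k m : ℕ}
    (t : Fin 3)
    (T : ArithCircuit k m) (ht : C.gates t = T.gates) (args : Fin k → Expr)
    (hargs : ∀ i, (args i).WF n ar on) : ArithCircuit n m where
  gates := compileCall (C.gates t) (List.ofFn fun i => compile C (args i)) n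
  outputs j := n + (compileAll (List.ofFn fun i => compile C (args i)) n).1.length + T.outputs j
  -- Being sorted does not depend on the inputs, so any input vector will do.
  gates_wf := (sound_args hC T ht args hargs fun _ => 0).1
  outputs_lt j := by
    rw [(sound_args hC T ht args hargs fun _ => 0).2.1, ht]
    have := T.outputs_lt j
    omega

theorem eval_build (C : Ctx) (ar on : Fin 3 → ℕ) (hC : C.Valid ar on) (n : ℕ) {k m : ℕ}
    (t : Fin 3) (T : ArithCircuit k m) (ht : C.gates t = T.gates) (args : Fin k → Expr)
    (hargs : ∀ i, (args i).WF n ar on) (x : Fin n → ℝ) :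
    (build C ar on hC n t T ht args hargs).eval x = T.eval fun i => (args i).eval C (ofVec x) := by
  funext j
  rw [ArithCircuit.eval, ArithCircuit.eval, ← ht]
  exact (sound_args hC T ht args hargs x).2.2 (T.outputs j)

theorem encode_build (C : Ctx) (ar on : Fin 3 → ℕ) (hC : C.Valid ar on) (n : ℕ) {k m : ℕ}
    (t : Fin 3) (T : ArithCircuit k m) (ht : C.gates t = T.gates)
    (ht' : C.outs t = List.ofFn T.outputs) (args : Fin k → Expr)
    (hargs : ∀ i, (args i).WF n ar on) :
    (build C ar on hC n t T ht args hargs).encode = tailCode C t args n := by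
  simp only [ArithCircuit.encode, build, tailCode, ht', List.map_ofFn]
  rfl

/-- The circuit that copies its inputs. -/
def idCircuit (n : ℕ) : ArithCircuit n n where
  gates := []
  outputs j := j
  gates_wf := trivial
  outputs_lt j := by simp

theorem eval_idCircuit {n : ℕ} (x : Fin n → ℝ) : (idCircuit n).eval x = x := by
  funext j
  exact ofVec_val x j

/-- The context of three circuits and constants. -/
def ctx₃ {n₀ m₀ n₁ m₁ n₂ m₂ : ℕ} (A : ArithCircuit n₀ m₀) (B : ArithCircuit n₁ m₁)
    (T : ArithCircuit n₂ m₂) (q : Fin 6 → ℚ) : Ctx where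
  gates := ![A.gates, B.gates, T.gates]
  outs := ![List.ofFn A.outputs, List.ofFn B.outputs, List.ofFn T.outputs]
  q := q

section ctx₃

variable {n₀ m₀ n₁ m₁ n₂ m₂ : ℕ} (A : ArithCircuit n₀ m₀) (B : ArithCircuit n₁ m₁)
    (T : ArithCircuit n₂ m₂) (q : Fin 6 → ℚ)

/-- The third circuit is declared to have `0` outputs, so well-formed expressions cannot call it: it
is reserved for being applied last, by `build`. -/
theorem valid_ctx₃ : (ctx₃ A B T q).Valid ![n₀, n₁, n₂] ![m₀, m₁, 0] where
  wf k := by fin_cases k; exacts [A.gates_wf, B.gates_wf, T.gates_wf]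
  outs_lt k := by
    fin_cases k
    · simpa [ctx₃] using A.outputs_lt
    · simpa [ctx₃] using B.outputs_lt
    · simpa [ctx₃] using T.outputs_lt
  on_le k := by fin_cases k <;> simp [ctx₃]

theorem eval_call_zero (j : Fin m₀) (args : Fin n₀ → Expr) (x : ℕ → ℝ) :
    (Expr.call 0 j n₀ args).eval (ctx₃ A B T q) x =
      A.eval (fun i => (args i).eval (ctx₃ A B T q) x) j := by
  simp [Expr.eval, ArithCircuit.eval, ctx₃]

theorem eval_call_one (j : Fin m₁) (args : Fin n₁ → Expr) (x : ℕ → ℝ) :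
    (Expr.call 1 j n₁ args).eval (ctx₃ A B T q) x =
      B.eval (fun i => (args i).eval (ctx₃ A B T q) x) j := by
  simp [Expr.eval, ArithCircuit.eval, ctx₃]

end ctx₃

/-! ### Expressions for the conditions on solutions -/

section Conditions

variable (C : Ctx) (s : ℕ → ℝ)

/-- The values of a family of expressions. -/
noncomputable def vals {n : ℕ} (e : Fin n → Expr) : Fin n → ℝ := fun i => (e i).eval C s

/-- The value of `t` tells whether `P` holds. -/
def Ind (t : Expr) (P : Prop) : Prop := (P → t.eval C s = 1) ∧ (¬ P → t.eval C s = 0)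

/-- The negation of a condition. -/
def eNot (t : Expr) : Expr := .op .sub (.const 1) t

/-- The condition `a ≠ b`. -/
def eNe (a b : Expr) : Expr := .op .max (.op .gt a b) (.op .gt b a)

/-- The condition that two points are different. -/
def eNeV (x y : Fin 3 → Expr) : Expr :=
  .op .max (eNe (x 0) (y 0)) (.op .max (eNe (x 1) (y 1)) (eNe (x 2) (y 2)))

/-- The absolute value. -/
def eAbs (a : Expr) : Expr := .op .max a (.op .sub (.const 0) a)

/-- The `ℓ₁` distance. -/
def eDist (x y : Fin 3 → Expr) : Expr :=
  .op .add (.op .add (eAbs (.op .sub (x 0) (y 0))) (eAbs (.op .sub (x 1) (y 1))))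
    (eAbs (.op .sub (x 2) (y 2)))

/-- The value of `a` if the condition `t` holds, and that of `b` otherwise. -/
def eSel (t a b : Expr) : Expr := .op .add (.op .mul t a) (.op .mul (eNot t) b)

/-- The first vector of a list whose condition holds. -/
def pick {n : ℕ} : List (Expr × (Fin n → Expr)) → Fin n → Expr
  | [], _ => .const 0
  | c :: l, i => eSel c.1 (c.2 i) (pick l i)

variable {C s} {t t' a b : Expr} {P P' : Prop}

theorem Ind.congr (h : Ind C s t P) (hP : P ↔ P') : Ind C s t P' := by
  rwa [← propext hP]

theorem Ind.gt : Ind C s (.op .gt a b) (a.eval C s > b.eval C s) := by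
  constructor <;> intro h <;> simp [Expr.eval, Op.eval] <;> simpa using h

theorem Ind.or (h : Ind C s t P) (h' : Ind C s t' P') : Ind C s (.op .max t t') (P ∨ P') := by
  by_cases hP : P <;> by_cases hP' : P' <;>
    simp_all [Ind, Expr.eval, Op.eval]

theorem Ind.and (h : Ind C s t P) (h' : Ind C s t' P') : Ind C s (.op .min t t') (P ∧ P') := by
  by_cases hP : P <;> by_cases hP' : P' <;>
    simp_all [Ind, Expr.eval, Op.eval]

theorem Ind.not (h1 : C.q 1 = 1) (h : Ind C s t P) : Ind C s (eNot t) (¬ P) := by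
  by_cases hP : P <;> simp_all [Ind, eNot, Expr.eval, Op.eval]

theorem Ind.ne : Ind C s (eNe a b) (a.eval C s ≠ b.eval C s) :=
  (Ind.gt.or Ind.gt).congr (by rw [ne_iff_lt_or_gt, or_comm])

theorem Ind.neV {x y : Fin 3 → Expr} : Ind C s (eNeV x y) (vals C s x ≠ vals C s y) := by
  refine (Ind.ne.or (Ind.ne.or Ind.ne)).congr ?_
  rw [Function.ne_iff]
  simp [Fin.exists_fin_succ, vals]

theorem eval_eAbs (h0 : C.q 0 = 0) (a : Expr) : (eAbs a).eval C s = |a.eval C s| := by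
  simp [eAbs, Expr.eval, Op.eval, h0, abs]

theorem eval_eDist (h0 : C.q 0 = 0) (x y : Fin 3 → Expr) :
    (eDist x y).eval C s = dist1 (vals C s x) (vals C s y) := by
  have : ∀ a b, (Expr.op .add a b).eval C s = a.eval C s + b.eval C s := fun _ _ => rfl
  have h' : ∀ a b, (Expr.op .sub a b).eval C s = a.eval C s - b.eval C s := fun _ _ => rfl
  simp only [eDist, this, eval_eAbs h0, h', dist1, Fin.sum_univ_three, vals]

/-- Conditions evaluate to exactly `0` or `1`, so `t * a + (1 - t) * b` returns one of its two
values unchanged. A circuit can thus test finitely many candidates and output a good one. -/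
theorem vals_pick {n : ℕ} (h1 : C.q 1 = 1) (P : (Fin n → ℝ) → Prop)
    (l : List (Expr × (Fin n → Expr))) (hl : ∀ c ∈ l, Ind C s c.1 (P (vals C s c.2)))
    (h : ∃ c ∈ l, P (vals C s c.2)) :
    ∃ c ∈ l, vals C s (pick l) = vals C s c.2 ∧ P (vals C s c.2) := by
  induction l with
  | nil => simp at h
  | cons c l ih =>
    by_cases hc : P (vals C s c.2)
    · refine ⟨c, by simp, ?_, hc⟩
      have := (hl c (by simp)).1 hc
      funext i
      simp [vals, pick, eSel, eNot, Expr.eval, Op.eval, this, h1]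
    · have := (hl c (by simp)).2 hc
      obtain ⟨d, hd, e1, e2⟩ := ih (fun c hc => hl c (by simp [hc])) (by
        obtain ⟨d, hd, e⟩ := h
        rw [List.mem_cons] at hd
        rcases hd with rfl | hd
        · exact absurd e hc
        · exact ⟨d, hd, e⟩)
      refine ⟨d, by simp [hd], ?_, e2⟩
      rw [← e1]
      funext i
      simp [vals, pick, eSel, eNot, Expr.eval, Op.eval, this, h1]

/-- A list of points, as one vector. -/
def ePoints {k : ℕ} (x : Fin k → Fin 3 → Expr) : Fin (k * 3) → Expr :=
  fun i => x (finProdFinEquiv.symm i).1 (finProdFinEquiv.symm i).2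

theorem point_vals {k : ℕ} (x : Fin k → Fin 3 → Expr) (j : Fin k) :
    point (vals C s (ePoints x)) j = vals C s (x j) := by
  funext i
  simp [point, vals, ePoints]

/-- The `j`-th input point. -/
def eInput (k : ℕ) (j : Fin k) : Fin 3 → Expr := fun i => .inp (finProdFinEquiv (j, i)).val

theorem vals_eInput {k : ℕ} (x : Fin (k * 3) → ℝ) (j : Fin k) :
    vals C (ofVec x) (eInput k j) = point x j := by
  funext i
  exact ofVec_val x _

section WF

variable {n : ℕ} {ar on : Fin 3 → ℕ}

theorem wf_eNot (h : t.WF n ar on) : (eNot t).WF n ar on := ⟨trivial, h⟩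

theorem wf_eAbs (h : a.WF n ar on) : (eAbs a).WF n ar on := ⟨h, trivial, h⟩

theorem wf_eNe (h : a.WF n ar on) (h' : b.WF n ar on) : (eNe a b).WF n ar on :=
  ⟨⟨h, h'⟩, ⟨h', h⟩⟩

theorem wf_eNeV {x y : Fin 3 → Expr} (h : ∀ i, (x i).WF n ar on) (h' : ∀ i, (y i).WF n ar on) :
    (eNeV x y).WF n ar on :=
  ⟨wf_eNe (h 0) (h' 0), wf_eNe (h 1) (h' 1), wf_eNe (h 2) (h' 2)⟩

theorem wf_eDist {x y : Fin 3 → Expr} (h : ∀ i, (x i).WF n ar on) (h' : ∀ i, (y i).WF n ar on) :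
    (eDist x y).WF n ar on :=
  ⟨⟨wf_eAbs ⟨h 0, h' 0⟩, wf_eAbs ⟨h 1, h' 1⟩⟩, wf_eAbs ⟨h 2, h' 2⟩⟩

theorem wf_pick {m : ℕ} (l : List (Expr × (Fin m → Expr)))
    (hl : ∀ c ∈ l, c.1.WF n ar on ∧ ∀ i, (c.2 i).WF n ar on) (i : Fin m) :
    (pick l i).WF n ar on := by
  induction l with
  | nil => trivial
  | cons c l ih =>
    have h := hl c (by simp)
    exact ⟨⟨h.1, h.2 i⟩, wf_eNot h.1, ih fun c hc => hl c (by simp [hc])⟩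

theorem wf_ePoints {k : ℕ} {x : Fin k → Fin 3 → Expr} (h : ∀ j i, (x j i).WF n ar on) (i) :
    (ePoints x i).WF n ar on := h _ _

theorem wf_eInput (k : ℕ) (j : Fin k) (i : Fin 3) : (eInput k j i).WF (k * 3) ar on :=
  (finProdFinEquiv (j, i)).isLt

end WF

end Conditions

/-! ### Sizes of rational numbers -/

theorem length_encRat (q : ℚ) :
    (encRat q).length = 2 * q.num.natAbs.size + 2 * q.den.size + 3 := by
  simp only [encRat, List.length_cons, List.length_append, length_encBits, Nat.size_eq_bits_len]
  omega

/-- Together with the next two lemmas this turns lengths of numerals into powers of two, so that the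
length of the code of an instance serves as a universal exponent. -/
theorem le_two_pow_size {q : ℚ} (hq : 0 < q) : q ≤ 2 ^ q.num.natAbs.size := by
  have h1 : (q.num.natAbs : ℚ) < 2 ^ q.num.natAbs.size := by
    exact_mod_cast Nat.lt_size_self q.num.natAbs
  have h2 : (q.num : ℚ) = q.num.natAbs := by
    have : (q.num.natAbs : ℤ) = q.num := Int.natAbs_of_nonneg (Rat.num_pos.2 hq).le
    rw [← Int.cast_natCast, this]
  have h3 : (1 : ℚ) ≤ q.den := by exact_mod_cast q.den_pos
  calc q = q.num / q.den := (Rat.num_div_den q).symm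
    _ ≤ q.num := div_le_self (by exact_mod_cast (Rat.num_pos.2 hq).le) h3
    _ ≤ _ := by rw [h2]; exact h1.le

theorem two_pow_size_inv_le {q : ℚ} (hq : 0 < q) : 1 / 2 ^ q.den.size ≤ q := by
  have h1 : (q.den : ℚ) < 2 ^ q.den.size := by exact_mod_cast Nat.lt_size_self q.den
  have h0 : (0 : ℚ) < q.den := by exact_mod_cast q.den_pos
  have h3 : (1 : ℚ) ≤ q.num := by exact_mod_cast Rat.num_pos.2 hq
  calc 1 / 2 ^ q.den.size ≤ 1 / (q.den : ℚ) := one_div_le_one_div_of_le h0 h1.le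
    _ ≤ q.num / q.den := by gcongr
    _ = q := Rat.num_div_den q

/-- The contraction gap `1 - c` is a positive rational with the denominator of `c`, hence not
smaller than a power of two readable from its code. -/
theorem two_pow_size_inv_le_one_sub {q : ℚ} (hq : q < 1) : 1 / 2 ^ q.den.size ≤ 1 - q := by
  have h := two_pow_size_inv_le (sub_pos.2 hq)
  have : (1 - q).den = q.den := by
    simp
  rwa [this] at h

/-! ### Every instance of Banach has a solution -/

/-- If there were no solution, contraction would hold along the orbit of the origin, and distances
of successive iterates would tend to a limit below `ε`. -/
theorem banach_total : Banach.Total := by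
  intro (I : BanachInstance)
  by_contra hcon
  have hno : ∀ x₁ ∈ cube, ∀ x₂ ∈ cube, ∀ y₁ ∈ cube, ∀ y₂ ∈ cube, ¬ I.Solves x₁ x₂ y₁ y₂ := by
    intro x₁ h1 x₂ h2 y₁ h3 y₂ h4 h
    obtain ⟨w, hp⟩ : ∃ w : Fin (4 * 3) → ℝ, ∀ j, point w j = ![x₁, x₂, y₁, y₂] j :=
      ⟨fun i => ![x₁, x₂, y₁, y₂] (finProdFinEquiv.symm i).1 (finProdFinEquiv.symm i).2,
        fun j => by funext i; simp [point]⟩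
    have hm : ∀ j, point w j ∈ cube := by
      intro j; rw [hp]; fin_cases j <;> assumption
    have hs : BanachInstance.Solves I (point w 0) (point w 1) (point w 2) (point w 3) := by
      rw [hp, hp, hp, hp]; exact h
    exact hcon ⟨w, hm, hs⟩
  have h0 : (fun _ => 0 : Fin 3 → ℝ) ∈ cube := fun i => by simp
  set x : ℕ → Fin 3 → ℝ := fun n => I.f.eval^[n] (fun _ => 0) with hx
  have hxs : ∀ n, x (n + 1) = I.f.eval (x n) := fun n => Function.iterate_succ_apply' _ _ _
  have hxc : ∀ n, x n ∈ cube := by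
    intro n
    induction n with
    | zero => exact h0
    | succ n ih => rw [hxs]; exact I.f_mapsTo _ ih
  have hc0 : (0 : ℝ) < I.c := by exact_mod_cast I.c_pos
  have hc1 : (I.c : ℝ) < 1 := by exact_mod_cast I.c_lt_one
  have hε : (0 : ℝ) < I.ε := by exact_mod_cast I.ε_pos
  have hd : ∀ n, I.dd (x n) (x (n + 1)) ≤ I.c ^ n * I.dd (x 0) (x 1) := by
    intro n
    induction n with
    | zero => simp
    | succ n ih =>
      have h := hno _ (hxc n) _ (hxc (n + 1)) _ h0 _ h0
      simp only [BanachInstance.Solves, not_or, not_lt] at h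
      have h2 := h.2.1
      rw [← hxs, ← hxs] at h2
      calc I.dd (x (n + 1)) (x (n + 1 + 1)) ≤ I.c * I.dd (x n) (x (n + 1)) := h2
        _ ≤ I.c * (I.c ^ n * I.dd (x 0) (x 1)) := by gcongr
        _ = _ := by ring
  have hlim : Filter.Tendsto (fun n : ℕ => (I.c : ℝ) ^ n * I.dd (x 0) (x 1)) Filter.atTop
      (nhds (0 * I.dd (x 0) (x 1))) :=
    (tendsto_pow_atTop_nhds_zero_of_lt_one hc0.le hc1).mul_const _
  rw [zero_mul] at hlim
  obtain ⟨n, hn⟩ := (hlim.eventually (gt_mem_nhds hε)).exists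
  refine hno _ (hxc n) _ h0 _ h0 _ h0 (Or.inl ?_)
  rw [← hxs]
  exact (hd n).trans hn.le

/-! ### From Banach to ContinuousLocalOpt -/

theorem dist1_nonneg (x y : Fin 3 → ℝ) : 0 ≤ dist1 x y :=
  Finset.sum_nonneg fun _ _ => abs_nonneg _

theorem dist1_le_three {x y : Fin 3 → ℝ} (hx : x ∈ cube) (hy : y ∈ cube) : dist1 x y ≤ 3 := by
  have h : ∀ i ∈ Finset.univ, |x i - y i| ≤ (1 : ℝ) := by
    intro i _
    have h1 := hx i
    have h2 := hy i
    rw [Set.mem_Icc] at h1 h2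
    rw [abs_le]; constructor <;> linarith
  simpa [dist1] using Finset.sum_le_card_nsmul Finset.univ _ _ h

/-- The origin. -/
def pt0 : Fin 3 → ℝ := fun _ => 0

/-- The first unit vector. -/
def pt1 : Fin 3 → ℝ := ![1, 0, 0]

theorem pt0_mem : pt0 ∈ cube := fun i => by simp [pt0]

theorem pt1_mem : pt1 ∈ cube := fun i => by fin_cases i <;> simp [pt1]

theorem pt0_ne_pt1 : pt0 ≠ pt1 := fun h => by simpa [pt0, pt1] using congrFun h 0

/-- Restriction to the unit interval. -/
noncomputable def clamp (t : ℝ) : ℝ := max 0 (min 1 t)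

theorem clamp_mem (t : ℝ) : clamp t ∈ Set.Icc (0 : ℝ) 1 :=
  ⟨le_max_left _ _, max_le zero_le_one (min_le_left _ _)⟩

theorem clamp_of_mem {t : ℝ} (h0 : 0 ≤ t) (h1 : t ≤ 1) : clamp t = t := by
  simp [clamp, h0, h1]

theorem abs_clamp_sub_clamp_le (s t : ℝ) : |clamp s - clamp t| ≤ |s - t| := by
  have h1 := abs_max_sub_max_le_max 0 (min 1 s) 0 (min 1 t)
  have h2 := abs_min_sub_min_le_max 1 s 1 t
  simp only [sub_self, abs_zero] at h1 h2
  rw [max_eq_right (abs_nonneg (min 1 s - min 1 t))] at h1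
  rw [max_eq_right (abs_nonneg (s - t))] at h2
  exact h1.trans h2

/-- The potential of a point in an instance of Banach. -/
noncomputable def BanachInstance.pot (I : BanachInstance) (K : ℕ) (x : Fin 3 → ℝ) : ℝ :=
  clamp (1 / 2 ^ K * (I.dd x (I.f.eval x) - I.dd pt0 pt1) + 1 / 2)

/-! ### The potential of an instance of Banach -/

section BanachMath

variable {I : BanachInstance} {x x' y z w : Fin 3 → ℝ}

/-- At a fixed point, either `d(x, x) = 0 < ε` or a metric axiom fails. So a non-solution satisfies
`x ≠ f x`, and this makes the Lipschitz clause for `d`, restricted to pairs of different points,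
available. -/
theorem BanachInstance.facts_of_not_solves (h : ¬ I.Solves x (I.f.eval x) y z) :
    I.ε < I.dd x (I.f.eval x) ∧
    I.dd (I.f.eval x) (I.f.eval (I.f.eval x)) ≤ I.c * I.dd x (I.f.eval x) ∧
    x ≠ I.f.eval x ∧
    (y ≠ z → |I.dd x (I.f.eval x) - I.dd y z| ≤ I.lam * (dist1 x y + dist1 (I.f.eval x) z)) := by
  simp only [BanachInstance.Solves, BanachInstance.MetricViolation, not_or, not_and, not_le,
    not_lt, not_not] at h
  obtain ⟨h1, h2, h3, h4, h5⟩ := h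
  have hε : (0 : ℝ) < I.ε := by exact_mod_cast I.ε_pos
  have hne : x ≠ I.f.eval x := fun e => by
    have := h5.2.1.2 e
    linarith
  exact ⟨h1, h2, hne, fun hyz => h4 hne hyz⟩

/-- Comparison with one fixed pair bounds the oscillation of `d(x, f x)`. The cube has `ℓ₁` diameter
`3`, and both arguments move, whence `6`. -/
theorem BanachInstance.abs_dd_sub_le (h : ¬ I.Solves x (I.f.eval x) pt0 pt1) (hx : x ∈ cube) :
    |I.dd x (I.f.eval x) - I.dd pt0 pt1| ≤ 6 * I.lam := by
  have hl : (0 : ℝ) < I.lam := by exact_mod_cast I.lam_pos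
  have h1 := (I.facts_of_not_solves h).2.2.2 pt0_ne_pt1
  have h2 := dist1_le_three hx pt0_mem
  have h3 := dist1_le_three (I.f_mapsTo x hx) pt1_mem
  nlinarith

/-- Each quadruple supplies a fact when it is not a solution: the first compares `d(x, f x)` with
`d(x', f x')`; the second and third bound `d` at `x` and `f x`, the second also giving contraction
there; the fourth gives the Lipschitz bound for `f`; the fifth gives `x' ≠ f x'`. -/
theorem BanachInstance.exists_solves (K : ℕ) (hx : x ∈ cube)
    (hK1 : 12 * (I.lam : ℝ) ≤ 2 ^ K) (hK2 : (1 : ℝ) + I.lam ≤ 2 ^ K)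
    (hK3 : 1 / 2 ^ K ≤ (1 - I.c) * (I.ε : ℝ))
    (h : I.pot K (I.f.eval x) ≥ I.pot K x - 1 / 4 ^ K ∨
      dist1 (I.f.eval x) (I.f.eval x') > 2 ^ K * dist1 x x' ∨
      |I.pot K x - I.pot K x'| > 2 ^ K * dist1 x x') :
    I.Solves x (I.f.eval x) x' (I.f.eval x') ∨ I.Solves x (I.f.eval x) pt0 pt1 ∨
    I.Solves (I.f.eval x) (I.f.eval (I.f.eval x)) pt0 pt1 ∨ I.Solves x x' x x' ∨
    I.Solves x' (I.f.eval x') pt0 pt1 := by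
  by_contra hcon
  simp only [not_or] at hcon
  obtain ⟨hA, hB, hC, hD, hE⟩ := hcon
  have hl : (0 : ℝ) < I.lam := by exact_mod_cast I.lam_pos
  have hε : (0 : ℝ) < I.ε := by exact_mod_cast I.ε_pos
  have hc1 : (I.c : ℝ) < 1 := by exact_mod_cast I.c_lt_one
  have hpos : (0 : ℝ) < 2 ^ K := by positivity
  have hdist := dist1_nonneg x x'
  have hf : dist1 (I.f.eval x) (I.f.eval x') ≤ I.lam * dist1 x x' := by
    simp only [BanachInstance.Solves, not_or, not_lt] at hD
    exact hD.2.2.1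
  rcases h with h | h | h
  · obtain ⟨b1, b2, -, -⟩ := I.facts_of_not_solves hB
    have bB := abs_le.1 (I.abs_dd_sub_le hB hx)
    have bC := abs_le.1 (I.abs_dd_sub_le hC (I.f_mapsTo x hx))
    -- By `hK1`, `6 * lam` is at most half of `2 ^ K`, so the clamping has no effect at `x` and at
    -- `f x`.
    have hu : ∀ t : ℝ, -(6 * I.lam) ≤ t ∧ t ≤ 6 * I.lam →
        0 ≤ 1 / 2 ^ K * t + 1 / 2 ∧ 1 / 2 ^ K * t + 1 / 2 ≤ 1 := by
      intro t ⟨h1, h2⟩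
      have h3 : 1 / 2 ^ K * t = t / 2 ^ K := by ring
      have h4 : t / 2 ^ K ≤ 1 / 2 := by rw [div_le_iff₀ hpos]; linarith
      have h5 : -(1 / 2) ≤ t / 2 ^ K := by rw [le_div_iff₀ hpos]; linarith
      rw [h3]; constructor <;> linarith
    obtain ⟨u1, u2⟩ := hu _ bB
    obtain ⟨u3, u4⟩ := hu _ bC
    rw [BanachInstance.pot, BanachInstance.pot, clamp_of_mem u1 u2, clamp_of_mem u3 u4] at h
    have e4 : (1 : ℝ) / 4 ^ K = 1 / 2 ^ K * (1 / 2 ^ K) := by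
      rw [show (4 : ℝ) = 2 * 2 by norm_num, mul_pow]; field_simp
    rw [e4] at h
    have hq : (0 : ℝ) < 1 / 2 ^ K := by positivity
    -- Dividing out the scaling factor turns `4 ^ (-K)` into `2 ^ (-K)`. With contraction this gives
    -- `(1 - c) d(x, f x) ≤ 2 ^ (-K) ≤ (1 - c) ε`, against `ε < d(x, f x)`.
    have h6 : I.dd x (I.f.eval x) - I.dd (I.f.eval x) (I.f.eval (I.f.eval x)) ≤ 1 / 2 ^ K := by
      by_contra h7
      push Not at h7
      nlinarith [mul_lt_mul_of_pos_left h7 hq]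
    nlinarith
  · have : (I.lam : ℝ) * dist1 x x' ≤ 2 ^ K * dist1 x x' := by
      apply mul_le_mul_of_nonneg_right _ hdist; linarith
    linarith
  · obtain ⟨-, -, hne, -⟩ := I.facts_of_not_solves hE
    have hA' := (I.facts_of_not_solves hA).2.2.2 hne
    have h1 := abs_clamp_sub_clamp_le
      (1 / 2 ^ K * (I.dd x (I.f.eval x) - I.dd pt0 pt1) + 1 / 2)
      (1 / 2 ^ K * (I.dd x' (I.f.eval x') - I.dd pt0 pt1) + 1 / 2)
    have e : 1 / 2 ^ K * (I.dd x (I.f.eval x) - I.dd pt0 pt1) + 1 / 2 -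
      (1 / 2 ^ K * (I.dd x' (I.f.eval x') - I.dd pt0 pt1) + 1 / 2) =
      1 / 2 ^ K * (I.dd x (I.f.eval x) - I.dd x' (I.f.eval x')) := by ring
    rw [e, abs_mul, abs_of_pos (by positivity : (0 : ℝ) < 1 / 2 ^ K)] at h1
    change |clamp _ - clamp _| > _ at h
    have h2 : 1 / 2 ^ K * |I.dd x (I.f.eval x) - I.dd x' (I.f.eval x')| ≤
        2 ^ K * dist1 x x' := by
      rw [one_div, inv_mul_le_iff₀ hpos]
      -- The first argument of `d` moves by `dist1 x x'` and the second by at most `lam * dist1 x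
      -- x'`.
      have h3 : |I.dd x (I.f.eval x) - I.dd x' (I.f.eval x')| ≤
          I.lam * ((1 + I.lam) * dist1 x x') := by
        refine hA'.trans ?_
        apply mul_le_mul_of_nonneg_left _ hl.le
        linarith
      refine h3.trans ?_
      have h4 : (1 + I.lam) * dist1 x x' ≤ 2 ^ K * dist1 x x' :=
        mul_le_mul_of_nonneg_right hK2 hdist
      exact mul_le_mul (by linarith) h4 (by positivity) hpos.le
    linarith

end BanachMath

/-- The constants `0`, `1` and four others. -/
def consts (a b c d : ℚ) : Fin 6 → ℚ := ![0, 1, a, b, c, d]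

/-- The arities of the circuits in use. -/
abbrev arB (k : ℕ) : Fin 3 → ℕ := ![3, 6, k]

/-- The numbers of outputs of the circuits in use. -/
abbrev onB : Fin 3 → ℕ := ![3, 1, 0]

/-- The circuit `f` applied to a point. -/
def eF (x : Fin 3 → Expr) : Fin 3 → Expr := fun j => .call 0 j 3 x

/-- The circuit `d` applied to two points. -/
def eD (x y : Fin 3 → Expr) : Expr := .call 1 0 6 (Fin.append x y : Fin (3 + 3) → Expr)

/-- The origin. -/
def ePt0 : Fin 3 → Expr := fun _ => .const 0

/-- The first unit vector. -/
def ePt1 : Fin 3 → Expr := ![.const 1, .const 0, .const 0]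

/-- The potential of a point; constant `2` is the scaling factor, constant `3` is `1 / 2`. -/
def ePot (x : Fin 3 → Expr) : Expr :=
  .op .max (.const 0) (.op .min (.const 1)
    (.op .add (.op .mul (.const 2) (.op .sub (eD x (eF x)) (eD ePt0 ePt1))) (.const 3)))

/-- The condition that four points solve an instance of Banach; constants `2`, `3`, `4` are
`ε`, `lam`, `c`. -/
def eSolvesB (x₁ x₂ y₁ y₂ : Fin 3 → Expr) : Expr :=
  .op .max (eNot (.op .gt (eD x₁ (eF x₁)) (.const 2)))
  (.op .max (.op .gt (eD (eF x₁) (eF x₂)) (.op .mul (.const 4) (eD x₁ x₂)))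
  (.op .max (.op .gt (eDist (eF x₁) (eF x₂)) (.op .mul (.const 3) (eDist x₁ x₂)))
  (.op .max (.op .min (eNeV x₁ x₂) (.op .min (eNeV y₁ y₂)
    (.op .gt (eAbs (.op .sub (eD x₁ x₂) (eD y₁ y₂)))
      (.op .mul (.const 3) (.op .add (eDist x₁ y₁) (eDist x₂ y₂))))))
  (.op .max (.op .gt (.const 0) (eD x₁ x₂))
  (.op .max (.op .max (.op .min (eNot (eNe (eD x₁ x₂) (.const 0))) (eNeV x₁ x₂))
      (.op .min (eNe (eD x₁ x₂) (.const 0)) (eNot (eNeV x₁ x₂))))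
  (.op .max (eNe (eD x₁ x₂) (eD x₂ x₁))
    (.op .gt (eD x₁ x₂) (.op .add (eD x₁ y₁) (eD y₁ x₂)))))))))

section WF

variable {n k : ℕ} {x y z w : Fin 3 → Expr}

theorem wf_eF (hx : ∀ i, (x i).WF n (arB k) onB) (j : Fin 3) : (eF x j).WF n (arB k) onB :=
  ⟨rfl, j.isLt, hx⟩

theorem wf_eD (hx : ∀ i, (x i).WF n (arB k) onB) (hy : ∀ i, (y i).WF n (arB k) onB) :
    (eD x y).WF n (arB k) onB := by
  refine ⟨rfl, Nat.one_pos, fun i => ?_⟩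
  refine Fin.addCases (m := 3) (n := 3) (motive := fun i =>
    ((Fin.append x y : Fin (3 + 3) → Expr) i).WF n (arB k) onB) (fun i => ?_) (fun i => ?_) i
  · rw [Fin.append_left]; exact hx i
  · rw [Fin.append_right]; exact hy i

theorem wf_ePt0 (i) : (ePt0 i).WF n (arB k) onB := trivial

theorem wf_ePt1 (i) : (ePt1 i).WF n (arB k) onB := by fin_cases i <;> trivial

theorem wf_ePot (hx : ∀ i, (x i).WF n (arB k) onB) : (ePot x).WF n (arB k) onB :=
  ⟨trivial, trivial, ⟨trivial, wf_eD hx (wf_eF hx), wf_eD wf_ePt0 wf_ePt1⟩, trivial⟩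

theorem wf_eSolvesB (hx : ∀ i, (x i).WF n (arB k) onB) (hy : ∀ i, (y i).WF n (arB k) onB)
    (hz : ∀ i, (z i).WF n (arB k) onB) (hw : ∀ i, (w i).WF n (arB k) onB) :
    (eSolvesB x y z w).WF n (arB k) onB :=
  ⟨wf_eNot ⟨wf_eD hx (wf_eF hx), trivial⟩, ⟨wf_eD (wf_eF hx) (wf_eF hy), trivial, wf_eD hx hy⟩,
    ⟨wf_eDist (wf_eF hx) (wf_eF hy), trivial, wf_eDist hx hy⟩,
    ⟨wf_eNeV hx hy, wf_eNeV hz hw, wf_eAbs ⟨wf_eD hx hy, wf_eD hz hw⟩, trivial, wf_eDist hx hz,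
      wf_eDist hy hw⟩, ⟨trivial, wf_eD hx hy⟩,
    ⟨⟨wf_eNot (wf_eNe (wf_eD hx hy) trivial), wf_eNeV hx hy⟩,
      wf_eNe (wf_eD hx hy) trivial, wf_eNot (wf_eNeV hx hy)⟩,
    wf_eNe (wf_eD hx hy) (wf_eD hy hx), wf_eD hx hy, wf_eD hx hz, wf_eD hz hy⟩

end WF

theorem vals_append {C : Ctx} {s : ℕ → ℝ} (x y : Fin 3 → Expr) :
    vals C s (Fin.append x y : Fin (3 + 3) → Expr) = Fin.append (vals C s x) (vals C s y) := by
  funext i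
  refine Fin.addCases (m := 3) (n := 3) (motive := fun i =>
    vals C s (Fin.append x y : Fin (3 + 3) → Expr) i = Fin.append (vals C s x) (vals C s y) i)
    (fun i => ?_) (fun i => ?_) i
  · rw [vals, Fin.append_left, Fin.append_left]; rfl
  · rw [vals, Fin.append_right, Fin.append_right]; rfl

/-! ### Values of the expressions for an instance of Banach -/

section BanachExpr

variable (I : BanachInstance) {k m : ℕ} (T : ArithCircuit k m) (a b c d : ℚ) {s : ℕ → ℝ}

local notation "CB" => ctx₃ I.f I.d T (consts a b c d)

theorem vals_eF (x : Fin 3 → Expr) : vals CB s (eF x) = I.f.eval (vals CB s x) := by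
  funext j
  exact eval_call_zero _ _ _ _ j x s

theorem eval_eD (x y : Fin 3 → Expr) :
    (eD x y).eval CB s = I.dd (vals CB s x) (vals CB s y) := by
  rw [BanachInstance.dd, ← vals_append]
  exact eval_call_one I.f I.d T (consts a b c d) 0 (Fin.append x y : Fin (3 + 3) → Expr) s

theorem vals_ePt0 : vals CB s ePt0 = pt0 := by
  funext i
  simp [vals, ePt0, pt0, Expr.eval, ctx₃, consts]

theorem vals_ePt1 : vals CB s ePt1 = pt1 := by
  funext i
  fin_cases i <;> simp [vals, ePt1, pt1, Expr.eval, ctx₃, consts]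

theorem eval_ePot (K : ℕ) (x : Fin 3 → Expr) (ha : a = 1 / 2 ^ K) (hb : b = 1 / 2) :
    (ePot x).eval CB s = I.pot K (vals CB s x) := by
  have e : (ePot x).eval CB s = max ((0 : ℚ) : ℝ) (min ((1 : ℚ) : ℝ)
    ((a : ℝ) * ((eD x (eF x)).eval CB s - (eD ePt0 ePt1).eval CB s) + (b : ℝ))) := rfl
  rw [e, eval_eD, eval_eD, vals_eF, vals_ePt0, vals_ePt1, ha, hb]
  simp [BanachInstance.pot, clamp]

theorem ind_eSolvesB (x₁ x₂ y₁ y₂ : Fin 3 → Expr) (ha : a = I.ε) (hb : b = I.lam) (hc : c = I.c) :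
    Ind CB s (eSolvesB x₁ x₂ y₁ y₂)
      (I.Solves (vals CB s x₁) (vals CB s x₂) (vals CB s y₁) (vals CB s y₂)) := by
  have h0 : (CB).q 0 = 0 := rfl
  have h1 : (CB).q 1 = 1 := rfl
  have c0 : (Expr.const 0).eval CB s = 0 := by simp [Expr.eval, h0]
  have c2 : (Expr.const 2).eval CB s = I.ε := by rw [← ha]; rfl
  have c3 : (Expr.const 3).eval CB s = I.lam := by rw [← hb]; rfl
  have c4 : (Expr.const 4).eval CB s = I.c := by rw [← hc]; rfl
  have cm : ∀ a b, (Expr.op .mul a b).eval CB s = a.eval CB s * b.eval CB s := fun _ _ => rfl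
  have ca : ∀ a b, (Expr.op .add a b).eval CB s = a.eval CB s + b.eval CB s := fun _ _ => rfl
  have cs : ∀ a b, (Expr.op .sub a b).eval CB s = a.eval CB s - b.eval CB s := fun _ _ => rfl
  have key := (Ind.gt (C := CB) (s := s) (a := eD x₁ (eF x₁)) (b := .const 2)).not h1 |>.or
    ((Ind.gt (a := eD (eF x₁) (eF x₂)) (b := .op .mul (.const 4) (eD x₁ x₂))).or
    ((Ind.gt (a := eDist (eF x₁) (eF x₂)) (b := .op .mul (.const 3) (eDist x₁ x₂))).or
    (((Ind.neV (x := x₁) (y := x₂)).and ((Ind.neV (x := y₁) (y := y₂)).and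
      (Ind.gt (a := eAbs (.op .sub (eD x₁ x₂) (eD y₁ y₂)))
        (b := .op .mul (.const 3) (.op .add (eDist x₁ y₁) (eDist x₂ y₂)))))).or
    ((Ind.gt (a := .const 0) (b := eD x₁ x₂)).or
    ((((Ind.ne (a := eD x₁ x₂) (b := .const 0)).not h1 |>.and (Ind.neV (x := x₁) (y := x₂))).or
      ((Ind.ne (a := eD x₁ x₂) (b := .const 0)).and ((Ind.neV (x := x₁) (y := x₂)).not h1))).or
    ((Ind.ne (a := eD x₁ x₂) (b := eD x₂ x₁)).or
    (Ind.gt (a := eD x₁ x₂) (b := .op .add (eD x₁ y₁) (eD y₁ x₂)))))))))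
  refine Ind.congr key ?_
  simp only [eval_eD, eval_eDist h0, eval_eAbs h0, vals_eF, cm, ca, cs, c0, c2, c3, c4, not_lt,
    BanachInstance.Solves, BanachInstance.MetricViolation, gt_iff_lt]
  tauto

end BanachExpr

/-- The circuit that applies `T` to the values of expressions that may call `A` and `B`. -/
noncomputable def apply₃ {n₀ m₀ n₁ m₁ k m : ℕ} (A : ArithCircuit n₀ m₀) (B : ArithCircuit n₁ m₁)
    (T : ArithCircuit k m) (q : Fin 6 → ℚ) (n : ℕ) (args : Fin k → Expr)
    (hargs : ∀ i, (args i).WF n ![n₀, n₁, k] ![m₀, m₁, 0]) : ArithCircuit n m :=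
  build (ctx₃ A B T q) ![n₀, n₁, k] ![m₀, m₁, 0] (valid_ctx₃ A B T q) n 2 T rfl args hargs

section apply₃

variable {n₀ m₀ n₁ m₁ k m : ℕ} (A : ArithCircuit n₀ m₀) (B : ArithCircuit n₁ m₁)
    (T : ArithCircuit k m) (q : Fin 6 → ℚ) (n : ℕ) (args : Fin k → Expr)
    (hargs : ∀ i, (args i).WF n ![n₀, n₁, k] ![m₀, m₁, 0])

theorem eval_apply₃ (x : Fin n → ℝ) :
    (apply₃ A B T q n args hargs).eval x = T.eval (vals (ctx₃ A B T q) (ofVec x) args) :=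
  eval_build _ _ _ _ _ _ _ _ _ _ _

theorem encode_apply₃ :
    (apply₃ A B T q n args hargs).encode = tailCode (ctx₃ A B T q) 2 args n :=
  encode_build _ _ _ _ _ _ _ _ rfl _ _

end apply₃

theorem wf_inp {n : ℕ} {ar on : Fin 3 → ℕ} (i : Fin n) : (Expr.inp i).WF n ar on := i.isLt

theorem vals_inp {C : Ctx} {n : ℕ} (x : Fin n → ℝ) :
    vals C (ofVec x) (fun i : Fin n => .inp i) = x := by
  funext i; exact ofVec_val x i

/-- The circuit of the potential of an instance of Banach. -/
noncomputable def BanachInstance.potCircuit (I : BanachInstance) (K : ℕ) : ArithCircuit 3 1 :=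
  apply₃ I.f I.d (idCircuit 1) (consts (1 / 2 ^ K) (1 / 2) 0 0) 3
    (fun _ => ePot fun i => .inp i) fun _ => wf_ePot wf_inp

theorem BanachInstance.eval_potCircuit (I : BanachInstance) (K : ℕ) (x : Fin 3 → ℝ) :
    (I.potCircuit K).eval x 0 = I.pot K x := by
  rw [potCircuit, eval_apply₃, eval_idCircuit]
  change (ePot _).eval _ _ = _
  rw [eval_ePot I _ _ _ _ _ K _ rfl rfl, vals_inp]

/-- The instance of ContinuousLocalOpt made from an instance of Banach. -/
noncomputable def BanachInstance.toCLO (I : BanachInstance) : CLOInstance where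
  f := I.f
  -- The length of the code is a large enough exponent for all estimates, and powers of two with
  -- this exponent are written by repeating bits once per bit of the input.
  p := I.potCircuit I.encode.length
  ε := 1 / 4 ^ I.encode.length
  lam := 2 ^ I.encode.length
  f_mapsTo := I.f_mapsTo
  p_mem x _ := by rw [I.eval_potCircuit]; exact clamp_mem _
  ε_pos := by positivity
  lam_pos := by positivity

/-- All estimates on `K` rest on this. Each of the three codes of rationals has `3` bits besides
those for the digits, which gives `9`. -/
theorem BanachInstance.le_length_encode (I : BanachInstance) :
    I.lam.num.natAbs.size + I.ε.den.size + I.c.den.size + 9 ≤ I.encode.length := by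
  simp only [BanachInstance.encode, List.length_append, length_encRat]
  omega

theorem BanachInstance.twelve_mul_lam_le (I : BanachInstance) :
    12 * (I.lam : ℝ) ≤ 2 ^ I.encode.length := by
  have h1 := le_two_pow_size I.lam_pos
  have h2 : (I.lam : ℝ) ≤ 2 ^ I.lam.num.natAbs.size := by exact_mod_cast h1
  -- The `4` comes from `12 ≤ 2 ^ 4`.
  have h3 : (2 : ℝ) ^ (I.lam.num.natAbs.size + 4) ≤ 2 ^ I.encode.length :=
    pow_le_pow_right₀ one_le_two (by have := I.le_length_encode; omega)
  rw [pow_add] at h3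
  have h4 : (0 : ℝ) < 2 ^ I.lam.num.natAbs.size := by positivity
  linarith

theorem BanachInstance.one_add_lam_le (I : BanachInstance) :
    (1 : ℝ) + I.lam ≤ 2 ^ I.encode.length := by
  have h1 := le_two_pow_size I.lam_pos
  have h2 : (I.lam : ℝ) ≤ 2 ^ I.lam.num.natAbs.size := by exact_mod_cast h1
  have h3 : (2 : ℝ) ^ (I.lam.num.natAbs.size + 1) ≤ 2 ^ I.encode.length :=
    pow_le_pow_right₀ one_le_two (by have := I.le_length_encode; omega)
  rw [pow_add] at h3
  have h4 : (1 : ℝ) ≤ 2 ^ I.lam.num.natAbs.size := one_le_pow₀ one_le_two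
  linarith

theorem BanachInstance.inv_le_mul_ε (I : BanachInstance) :
    1 / 2 ^ I.encode.length ≤ (1 - I.c) * (I.ε : ℝ) := by
  have h1 : (1 : ℝ) / 2 ^ I.ε.den.size ≤ I.ε := by
    have := (Rat.cast_le (K := ℝ)).2 (two_pow_size_inv_le I.ε_pos)
    push_cast at this; exact this
  have h2 : (1 : ℝ) / 2 ^ I.c.den.size ≤ 1 - I.c := by
    have := (Rat.cast_le (K := ℝ)).2 (two_pow_size_inv_le_one_sub I.c_lt_one)
    push_cast at this; exact this
  have h3 : (1 : ℝ) / 2 ^ I.encode.length ≤ 1 / 2 ^ (I.c.den.size + I.ε.den.size) :=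
    one_div_le_one_div_of_le (by positivity)
      (pow_le_pow_right₀ one_le_two (by have := I.le_length_encode; omega))
  have h4 : (0 : ℝ) < 1 / 2 ^ I.c.den.size := by positivity
  calc (1 : ℝ) / 2 ^ I.encode.length ≤ 1 / 2 ^ I.c.den.size * (1 / 2 ^ I.ε.den.size) := by
        rw [pow_add] at h3
        refine h3.trans (le_of_eq ?_)
        field_simp
    _ ≤ _ := mul_le_mul h2 h1 (by positivity) (h4.le.trans h2)

/-- The candidates for a solution of Banach, given a solution of ContinuousLocalOpt. -/
def candidatesB : List (Fin 4 → Fin 3 → Expr) :=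
  let x := eInput 2 0
  let x' := eInput 2 1
  [![x, eF x, x', eF x'], ![x, eF x, ePt0, ePt1], ![eF x, eF (eF x), ePt0, ePt1],
    ![x, x', x, x'], ![x', eF x', ePt0, ePt1]]

/-- The first candidate that solves the instance of Banach. -/
def pickB : Fin (4 * 3) → Expr :=
  pick (candidatesB.map fun p => (eSolvesB (p 0) (p 1) (p 2) (p 3), ePoints p))

theorem wf_candidatesB {k : ℕ} : ∀ p ∈ candidatesB, ∀ j i, (p j i).WF (2 * 3) (arB k) onB := by
  have h := fun j => wf_eInput (ar := arB k) (on := onB) 2 j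
  intro p hp
  simp only [candidatesB, List.mem_cons, List.not_mem_nil, or_false] at hp
  rcases hp with rfl | rfl | rfl | rfl | rfl <;> intro j <;> fin_cases j
  exacts [h 0, wf_eF (h 0), h 1, wf_eF (h 1), h 0, wf_eF (h 0), wf_ePt0, wf_ePt1,
    wf_eF (h 0), wf_eF (wf_eF (h 0)), wf_ePt0, wf_ePt1, h 0, h 1, h 0, h 1,
    h 1, wf_eF (h 1), wf_ePt0, wf_ePt1]

theorem wf_pickB {k : ℕ} (i) : (pickB i).WF (2 * 3) (arB k) onB := by
  refine wf_pick _ (fun c hc => ?_) i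
  obtain ⟨p, hp, rfl⟩ := List.mem_map.1 hc
  have h := wf_candidatesB (k := k) p hp
  exact ⟨wf_eSolvesB (h 0) (h 1) (h 2) (h 3), wf_ePoints h⟩

/-- The circuit that turns solutions of `I.toCLO` into solutions of `I`. -/
noncomputable def BanachInstance.fromCLO (I : BanachInstance) : ArithCircuit (2 * 3) (4 * 3) :=
  apply₃ I.f I.d (idCircuit (4 * 3)) (consts I.ε I.lam I.c 0) (2 * 3) pickB wf_pickB

theorem BanachInstance.isSolution_fromCLO (I : BanachInstance) (s : Fin (2 * 3) → ℝ)
    (hs : ContinuousLocalOpt.IsSolution I.toCLO s) : Banach.IsSolution I (I.fromCLO.eval s) := by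
  obtain ⟨hs1, hs2⟩ := hs
  change ∀ j, point (k := 2) s j ∈ cube at hs1
  change I.toCLO.Solves (point (k := 2) s 0) (point (k := 2) s 1) at hs2
  rw [fromCLO, eval_apply₃, eval_idCircuit]
  set C := ctx₃ I.f I.d (idCircuit (4 * 3)) (consts I.ε I.lam I.c 0) with hC
  have hF : ∀ x, vals C (ofVec s) (eF x) = I.f.eval (vals C (ofVec s) x) :=
    fun x => vals_eF I _ _ _ _ _ x
  have h0 : vals C (ofVec s) ePt0 = pt0 := vals_ePt0 I _ _ _ _ _
  have h1 : vals C (ofVec s) ePt1 = pt1 := vals_ePt1 I _ _ _ _ _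
  have hx : ∀ j, vals C (ofVec s) (eInput 2 j) = point s j := fun j => vals_eInput s j
  obtain ⟨c, hc, e1, e2⟩ := vals_pick (C := C) (s := ofVec s) (n := 4 * 3) rfl
    (fun v => I.Solves (point v 0) (point v 1) (point v 2) (point v 3))
    (candidatesB.map fun p => (eSolvesB (p 0) (p 1) (p 2) (p 3), ePoints p))
    (by
      intro c hc
      obtain ⟨p, hp, rfl⟩ := List.mem_map.1 hc
      simp only [point_vals]
      exact ind_eSolvesB I _ _ _ _ _ _ _ _ _ rfl rfl rfl)
    (by
      have := I.exists_solves I.encode.length (hs1 0) I.twelve_mul_lam_le I.one_add_lam_le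
        I.inv_le_mul_ε (x' := point s 1) (by
          have := hs2
          simp only [CLOInstance.Solves, toCLO, eval_potCircuit] at this
          push_cast at this
          exact this)
      simp only [candidatesB, List.map_cons, List.map_nil, List.mem_cons, List.not_mem_nil,
        or_false, exists_eq_or_imp, exists_eq_left, point_vals]
      simpa [hF, h0, h1, hx] using this)
  obtain ⟨p, hp, rfl⟩ := List.mem_map.1 hc
  have hmem : ∀ j, vals C (ofVec s) (p j) ∈ cube := by
    simp only [candidatesB, List.mem_cons, List.not_mem_nil, or_false] at hp
    have hf := I.f_mapsTo
    rcases hp with rfl | rfl | rfl | rfl | rfl <;> intro j <;> fin_cases j <;>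
      simp [hF, h0, h1, hx, hs1, hf, pt0_mem, pt1_mem]
  rw [pickB]
  refine ⟨fun j => ?_, ?_⟩
  · rw [e1, point_vals]; exact hmem j
  · change I.Solves (point (k := 4) (vals C (ofVec s) (pick _)) 0) (point (k := 4) _ 1)
      (point (k := 4) _ 2) (point (k := 4) _ 3)
    rw [e1]; exact e2

/-! ### From ContinuousLocalOpt to Banach -/

/-- The circuit `p` applied to a point. -/
def eP (x : Fin 3 → Expr) : Expr := .call 1 0 3 x

/-- The distance of two points: `0` if they are equal, and otherwise `1` plus the larger one of
their potentials. -/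
def eMetric (x y : Fin 3 → Expr) : Expr :=
  .op .mul (eNeV x y) (.op .add (.const 1) (.op .max (eP x) (eP y)))

/-- The condition that two points solve an instance of ContinuousLocalOpt; constants `2`, `3` are
`ε`, `lam`. -/
def eSolvesC (x x' : Fin 3 → Expr) : Expr :=
  .op .max (eNot (.op .gt (.op .sub (eP x) (.const 2)) (eP (eF x))))
  (.op .max (.op .gt (eDist (eF x) (eF x')) (.op .mul (.const 3) (eDist x x')))
    (.op .gt (eAbs (.op .sub (eP x) (eP x'))) (.op .mul (.const 3) (eDist x x'))))

/-- The arities of the circuits in use. -/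
abbrev arC (k : ℕ) : Fin 3 → ℕ := ![3, 3, k]

section WF

variable {n k : ℕ} {x y : Fin 3 → Expr}

theorem wf_eF' (hx : ∀ i, (x i).WF n (arC k) onB) (j : Fin 3) : (eF x j).WF n (arC k) onB :=
  ⟨rfl, j.isLt, hx⟩

theorem wf_eP (hx : ∀ i, (x i).WF n (arC k) onB) : (eP x).WF n (arC k) onB :=
  ⟨rfl, Nat.one_pos, hx⟩

theorem wf_eMetric (hx : ∀ i, (x i).WF n (arC k) onB) (hy : ∀ i, (y i).WF n (arC k) onB) :
    (eMetric x y).WF n (arC k) onB :=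
  ⟨wf_eNeV hx hy, trivial, wf_eP hx, wf_eP hy⟩

theorem wf_eSolvesC (hx : ∀ i, (x i).WF n (arC k) onB) (hy : ∀ i, (y i).WF n (arC k) onB) :
    (eSolvesC x y).WF n (arC k) onB :=
  ⟨wf_eNot ⟨⟨wf_eP hx, trivial⟩, wf_eP (wf_eF' hx)⟩,
    ⟨wf_eDist (wf_eF' hx) (wf_eF' hy), trivial, wf_eDist hx hy⟩,
    wf_eAbs ⟨wf_eP hx, wf_eP hy⟩, trivial, wf_eDist hx hy⟩

end WF

open Classical in
/-- The metric on the cube given by the potential. -/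
noncomputable def CLOInstance.metric (J : CLOInstance) (x y : Fin 3 → ℝ) : ℝ :=
  if x = y then 0 else 1 + max (J.p.eval x 0) (J.p.eval y 0)

/-! ### Values of the expressions for an instance of ContinuousLocalOpt -/

section CLOExpr

variable (J : CLOInstance) {k m : ℕ} (T : ArithCircuit k m) (a b c d : ℚ) {s : ℕ → ℝ}

local notation "CC" => ctx₃ J.f J.p T (consts a b c d)

theorem vals_eF' (x : Fin 3 → Expr) : vals CC s (eF x) = J.f.eval (vals CC s x) := by
  funext j
  exact eval_call_zero _ _ _ _ j x s

theorem eval_eP (x : Fin 3 → Expr) : (eP x).eval CC s = J.p.eval (vals CC s x) 0 :=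
  eval_call_one J.f J.p T (consts a b c d) 0 x s

theorem eval_eMetric (x y : Fin 3 → Expr) :
    (eMetric x y).eval CC s = J.metric (vals CC s x) (vals CC s y) := by
  have e : (eMetric x y).eval CC s = (eNeV x y).eval CC s *
    (((1 : ℚ) : ℝ) + max ((eP x).eval CC s) ((eP y).eval CC s)) := rfl
  rw [e, eval_eP, eval_eP, CLOInstance.metric]
  split_ifs with h
  · rw [Ind.neV.2 (not_not.2 h), zero_mul]
  · rw [Ind.neV.1 h]; simp

theorem ind_eSolvesC (x x' : Fin 3 → Expr) (ha : a = J.ε) (hb : b = J.lam) :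
    Ind CC s (eSolvesC x x') (J.Solves (vals CC s x) (vals CC s x')) := by
  have h0 : (CC).q 0 = 0 := rfl
  have h1 : (CC).q 1 = 1 := rfl
  have c2 : (Expr.const 2).eval CC s = J.ε := by rw [← ha]; rfl
  have c3 : (Expr.const 3).eval CC s = J.lam := by rw [← hb]; rfl
  have cm : ∀ a b, (Expr.op .mul a b).eval CC s = a.eval CC s * b.eval CC s := fun _ _ => rfl
  have cs : ∀ a b, (Expr.op .sub a b).eval CC s = a.eval CC s - b.eval CC s := fun _ _ => rfl
  have key := (Ind.gt (C := CC) (s := s) (a := .op .sub (eP x) (.const 2))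
      (b := eP (eF x))).not h1 |>.or
    ((Ind.gt (a := eDist (eF x) (eF x')) (b := .op .mul (.const 3) (eDist x x'))).or
    (Ind.gt (a := eAbs (.op .sub (eP x) (eP x'))) (b := .op .mul (.const 3) (eDist x x'))))
  refine Ind.congr key ?_
  simp only [eval_eP, eval_eDist h0, eval_eAbs h0, vals_eF', cm, cs, c2, c3, not_lt,
    CLOInstance.Solves, gt_iff_lt, ge_iff_le]

end CLOExpr

/-- The circuit of the metric of an instance of ContinuousLocalOpt. -/
noncomputable def CLOInstance.metricCircuit (J : CLOInstance) : ArithCircuit (3 + 3) 1 :=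
  apply₃ J.f J.p (idCircuit 1) (consts J.ε J.lam 0 0) (2 * 3)
    (fun _ => eMetric (eInput 2 0) (eInput 2 1)) fun _ => wf_eMetric (wf_eInput 2 0) (wf_eInput 2 1)

theorem CLOInstance.eval_metricCircuit (J : CLOInstance) (x y : Fin 3 → ℝ) :
    J.metricCircuit.eval (Fin.append x y) 0 = J.metric x y := by
  rw [metricCircuit, eval_apply₃, eval_idCircuit]
  change (eMetric _ _).eval _ _ = _
  -- Appending two points lays out the six numbers exactly as in a list of two points, which is what
  -- `eInput 2` reads.
  have h0 : ∀ C, vals C (ofVec (Fin.append x y : Fin (3 + 3) → ℝ)) (eInput 2 0) = x := by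
    intro C
    rw [vals_eInput (k := 2) (Fin.append x y : Fin (3 + 3) → ℝ)]
    funext i; fin_cases i <;> rfl
  have h1 : ∀ C, vals C (ofVec (Fin.append x y : Fin (3 + 3) → ℝ)) (eInput 2 1) = y := by
    intro C
    rw [vals_eInput (k := 2) (Fin.append x y : Fin (3 + 3) → ℝ)]
    funext i; fin_cases i <;> rfl
  rw [eval_eMetric]
  exact congrArg₂ _ (h0 _) (h1 _)

/-- This makes `1 / 2 ^ length` smaller than `1`, which gives `0 < c` and ensures that points at
distance at most `1 / 2 ^ length` in the metric are equal. -/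
theorem CLOInstance.length_encode_pos (J : CLOInstance) : 0 < J.encode.length := by
  simp only [CLOInstance.encode, List.length_append, length_encRat]
  omega

/-- The instance of Banach made from an instance of ContinuousLocalOpt. -/
noncomputable def CLOInstance.toBanach (J : CLOInstance) : BanachInstance where
  f := J.f
  d := J.metricCircuit
  ε := 1 / 2 ^ J.encode.length
  lam := J.lam
  c := 1 - 1 / 2 ^ J.encode.length
  f_mapsTo := J.f_mapsTo
  ε_pos := by positivity
  lam_pos := J.lam_pos
  c_pos := by
    have := one_lt_pow₀ (one_lt_two (α := ℚ)) J.length_encode_pos.ne'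
    rw [sub_pos, div_lt_one (by positivity)]; exact this
  c_lt_one := by
    have : (0 : ℚ) < 1 / 2 ^ J.encode.length := by positivity
    linarith

/-- The metric is at most `2`, so multiplying a distance by `c = 1 - 1 / 2 ^ length` lowers it by at
most `2 / 2 ^ length`, and this must not exceed `ε`. -/
theorem CLOInstance.two_div_le_ε (J : CLOInstance) : 2 / 2 ^ J.encode.length ≤ (J.ε : ℝ) := by
  have h1 := (Rat.cast_le (K := ℝ)).2 (two_pow_size_inv_le J.ε_pos)
  push_cast at h1
  have h3 : (1 : ℝ) / 2 ^ J.encode.length ≤ 1 / 2 ^ (J.ε.den.size + 1) :=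
    one_div_le_one_div_of_le (by positivity) (pow_le_pow_right₀ one_le_two (by
      simp only [CLOInstance.encode, List.length_append, length_encRat]; omega))
  rw [pow_add] at h3
  calc (2 : ℝ) / 2 ^ J.encode.length = 2 * (1 / 2 ^ J.encode.length) := by ring
    _ ≤ 2 * (1 / (2 ^ J.ε.den.size * 2 ^ 1)) := by gcongr
    _ = 1 / 2 ^ J.ε.den.size := by field_simp
    _ ≤ _ := h1

/-- A metric axiom is never violated; every other alternative leads back to `p` or `f`. The pair
`(x₂, y₂)` serves twice: for a possible local optimum `x₂`, and for the Lipschitz bound of `p` in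
the second argument of the metric. -/
theorem CLOInstance.exists_solves (J : CLOInstance) {x₁ x₂ y₁ y₂ : Fin 3 → ℝ} (hx₁ : x₁ ∈ cube)
    (hx₂ : x₂ ∈ cube) (hy₁ : y₁ ∈ cube) (h : J.toBanach.Solves x₁ x₂ y₁ y₂) :
    J.Solves x₁ x₂ ∨ J.Solves x₂ y₂ ∨ J.Solves x₁ y₁ := by
  have hdd : ∀ x y, J.toBanach.dd x y = J.metric x y := J.eval_metricCircuit
  have hp : ∀ x ∈ cube, 0 ≤ J.p.eval x 0 ∧ J.p.eval x 0 ≤ 1 := fun x hx => J.p_mem x hx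
  have hpos : (0 : ℝ) < 1 / 2 ^ J.encode.length := by positivity
  have hlt : (1 : ℝ) / 2 ^ J.encode.length < 1 := by
    rw [div_lt_one (by positivity)]
    exact one_lt_pow₀ one_lt_two J.length_encode_pos.ne'
  have hε := J.two_div_le_ε
  rw [show (2 : ℝ) / 2 ^ J.encode.length = 2 * (1 / 2 ^ J.encode.length) by ring] at hε
  have hεB : (J.toBanach.ε : ℝ) = 1 / 2 ^ J.encode.length := by simp [toBanach]
  have hcB : (J.toBanach.c : ℝ) = 1 - 1 / 2 ^ J.encode.length := by simp [toBanach]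
  have hfB : J.toBanach.f = J.f := rfl
  have hlB : J.toBanach.lam = J.lam := rfl
  simp only [BanachInstance.Solves, BanachInstance.MetricViolation, hdd, hεB, hcB, hfB, hlB] at h
  set δ : ℝ := 1 / 2 ^ J.encode.length
  have hp1 := hp x₁ hx₁
  have hp2 := hp x₂ hx₂
  have hp3 := hp y₁ hy₁
  have hnn : 0 ≤ J.metric x₁ x₂ := by
    rw [metric]; split_ifs
    · exact le_rfl
    · have := le_max_left (J.p.eval x₁ 0) (J.p.eval x₂ 0); linarith
  rcases h with h | h | h | ⟨h1, h2, h⟩ | h | h | h | h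
  · left; left
    -- Different points are at distance at least `1`, so a small distance means an exact fixed
    -- point, where the potential does not drop at all.
    by_cases e : x₁ = J.f.eval x₁
    · have : (0 : ℝ) < J.ε := by exact_mod_cast J.ε_pos
      rw [← e]; linarith
    · rw [metric, if_neg e] at h
      have := le_max_left (J.p.eval x₁ 0) (J.p.eval (J.f.eval x₁) 0)
      linarith
  · by_contra hcon
    simp only [not_or, Solves, not_le, ge_iff_le] at hcon
    obtain ⟨⟨c1, -⟩, ⟨c2, -⟩, -⟩ := hcon
    -- Equal images have distance `0`, which cannot exceed `c` times a nonnegative number.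
    have hne : J.f.eval x₁ ≠ J.f.eval x₂ := by
      intro e
      rw [show J.metric (J.f.eval x₁) (J.f.eval x₂) = 0 by rw [metric, if_pos e]] at h
      have := mul_nonneg (by linarith : 0 ≤ 1 - δ) hnn
      linarith
    have hne' : x₁ ≠ x₂ := fun e => hne (by rw [e])
    rw [metric, metric, if_neg hne, if_neg hne'] at h
    have m1 := le_max_left (J.p.eval x₁ 0) (J.p.eval x₂ 0)
    have m2 := le_max_right (J.p.eval x₁ 0) (J.p.eval x₂ 0)
    have m3 : max (J.p.eval x₁ 0) (J.p.eval x₂ 0) ≤ 1 := max_le hp1.2 hp2.2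
    -- Both potentials drop by more than `ε`, hence so does their maximum by at least `ε ≥ 2 δ`,
    -- while `δ` times a distance is at most `2 δ`.
    have m4 : max (J.p.eval (J.f.eval x₁) 0) (J.p.eval (J.f.eval x₂) 0) ≤
        max (J.p.eval x₁ 0) (J.p.eval x₂ 0) - J.ε := max_le (by linarith) (by linarith)
    nlinarith
  · left; right; left; exact h
  · by_contra hcon
    simp only [not_or, Solves, not_lt, gt_iff_lt] at hcon
    obtain ⟨-, ⟨-, -, c2⟩, -, -, c1⟩ := hcon
    rw [metric, metric, if_neg h1, if_neg h2] at h
    -- The maximum is 1-Lipschitz in the sup norm, so a large change of the distance needs a large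
    -- change of `p` from `x₁` to `y₁` or from `x₂` to `y₂`.
    have m := abs_max_sub_max_le_max (J.p.eval x₁ 0) (J.p.eval x₂ 0) (J.p.eval y₁ 0)
      (J.p.eval y₂ 0)
    have hl : (0 : ℝ) < J.lam := by exact_mod_cast J.lam_pos
    have d1 := mul_nonneg hl.le (dist1_nonneg x₁ y₁)
    have d2 := mul_nonneg hl.le (dist1_nonneg x₂ y₂)
    have m' := max_le (c := J.lam * (dist1 x₁ y₁ + dist1 x₂ y₂)) (c1.trans (by linarith))
      (c2.trans (by linarith))
    rw [add_sub_add_left_eq_sub] at h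
    linarith
  · linarith
  · exfalso; apply h
    rw [metric]
    split_ifs with e
    · simp [e]
    · have := le_max_left (J.p.eval x₁ 0) (J.p.eval x₂ 0)
      constructor
      · intro h; linarith
      · intro h; exact absurd h e
  · exfalso; apply h
    simp only [metric, eq_comm (a := x₁), max_comm (J.p.eval x₁ 0)]
  · exfalso; revert h
    rw [gt_iff_lt, imp_false, not_lt]
    simp only [metric]
    have m1 := le_max_left (J.p.eval x₁ 0) (J.p.eval y₁ 0)
    have m2 := le_max_right (J.p.eval x₁ 0) (J.p.eval y₁ 0)
    have m3 := le_max_left (J.p.eval y₁ 0) (J.p.eval x₂ 0)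
    have m4 := le_max_right (J.p.eval y₁ 0) (J.p.eval x₂ 0)
    -- The triangle inequality for three different points, after cancelling `1`: each of `p x₁`, `p
    -- x₂` occurs in a maximum on the right, and all terms are nonnegative.
    have m5 : max (J.p.eval x₁ 0) (J.p.eval x₂ 0) ≤
      1 + max (J.p.eval x₁ 0) (J.p.eval y₁ 0) + max (J.p.eval y₁ 0) (J.p.eval x₂ 0) :=
        max_le (by linarith) (by linarith)
    split_ifs <;> subst_vars <;> first | linarith | simp_all

/-- The candidates for a solution of ContinuousLocalOpt, given a solution of Banach. -/
def candidatesC : List (Fin 2 → Fin 3 → Expr) :=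
  [![eInput 4 0, eInput 4 1], ![eInput 4 1, eInput 4 3], ![eInput 4 0, eInput 4 2]]

/-- The first candidate that solves the instance of ContinuousLocalOpt. -/
def pickC : Fin (2 * 3) → Expr :=
  pick (candidatesC.map fun p => (eSolvesC (p 0) (p 1), ePoints p))

theorem wf_candidatesC {k : ℕ} : ∀ p ∈ candidatesC, ∀ j i, (p j i).WF (4 * 3) (arC k) onB := by
  have h := fun j => wf_eInput (ar := arC k) (on := onB) 4 j
  intro p hp
  simp only [candidatesC, List.mem_cons, List.not_mem_nil, or_false] at hp
  rcases hp with rfl | rfl | rfl <;> intro j <;> fin_cases j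
  exacts [h 0, h 1, h 1, h 3, h 0, h 2]

theorem wf_pickC {k : ℕ} (i) : (pickC i).WF (4 * 3) (arC k) onB := by
  refine wf_pick _ (fun c hc => ?_) i
  obtain ⟨p, hp, rfl⟩ := List.mem_map.1 hc
  have h := wf_candidatesC (k := k) p hp
  exact ⟨wf_eSolvesC (h 0) (h 1), wf_ePoints h⟩

/-- The circuit that turns solutions of `J.toBanach` into solutions of `J`, followed by `T`. -/
noncomputable def CLOInstance.fromBanach (J : CLOInstance) {m : ℕ} (T : ArithCircuit (2 * 3) m) :
    ArithCircuit (4 * 3) m :=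
  apply₃ J.f J.p T (consts J.ε J.lam 0 0) (4 * 3) pickC wf_pickC

/-- An arbitrary circuit `T` is allowed behind the selection, so that the back-translation of a
given reduction to ContinuousLocalOpt is composed within the same circuit. -/
theorem CLOInstance.exists_eval_fromBanach (J : CLOInstance) {m : ℕ}
    (T : ArithCircuit (2 * 3) m) (s : Fin (4 * 3) → ℝ)
    (hs : Banach.IsSolution J.toBanach s) :
    ∃ v, ContinuousLocalOpt.IsSolution J v ∧ (J.fromBanach T).eval s = T.eval v := by
  obtain ⟨hs1, hs2⟩ := hs
  change ∀ j, point (k := 4) s j ∈ cube at hs1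
  change J.toBanach.Solves (point (k := 4) s 0) (point (k := 4) s 1) (point (k := 4) s 2)
    (point (k := 4) s 3) at hs2
  rw [fromBanach, eval_apply₃]
  refine ⟨_, ?_, rfl⟩
  set C := ctx₃ J.f J.p T (consts J.ε J.lam 0 0) with hC
  have hx : ∀ j, vals C (ofVec s) (eInput 4 j) = point s j := fun j => vals_eInput s j
  obtain ⟨c, hc, e1, e2⟩ := vals_pick (C := C) (s := ofVec s) (n := 2 * 3) rfl
    (fun v => J.Solves (point v 0) (point v 1))
    (candidatesC.map fun p => (eSolvesC (p 0) (p 1), ePoints p))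
    (by
      intro c hc
      obtain ⟨p, hp, rfl⟩ := List.mem_map.1 hc
      simp only [point_vals]
      exact ind_eSolvesC J _ _ _ _ _ _ _ rfl rfl)
    (by
      have := J.exists_solves (hs1 0) (hs1 1) (hs1 2) hs2
      simp only [candidatesC, List.map_cons, List.map_nil, List.mem_cons, List.not_mem_nil,
        or_false, exists_eq_or_imp, exists_eq_left, point_vals]
      simpa [hx] using this)
  obtain ⟨p, hp, rfl⟩ := List.mem_map.1 hc
  have hmem : ∀ j, vals C (ofVec s) (p j) ∈ cube := by
    simp only [candidatesC, List.mem_cons, List.not_mem_nil, or_false] at hp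
    rcases hp with rfl | rfl | rfl <;> intro j <;> fin_cases j <;> simp [hx, hs1]
  rw [pickC]
  refine ⟨fun j => ?_, ?_⟩
  · rw [e1, point_vals]; exact hmem j
  · change J.Solves (point (k := 2) (vals C (ofVec s) (pick _)) 0) (point (k := 2) _ 1)
    rw [e1]; exact e2

/-! ### Assembling programs -/

section Trans

variable {R ι : Type} [DecidableEq R] [DecidableEq ι] {M : ι → TM2ComputableAux Bool Bool}
  {α : Type} {ℓ : α → ℕ} {p q : Prog R ι} {S S' S'' : α → R → List Bool}

/-- From stacks of polynomial size, the program `p` leads from `S a` to `S' a` in polynomial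
time. -/
def PolyTrans (M : ι → TM2ComputableAux Bool Bool) (ℓ : α → ℕ) (p : Prog R ι)
    (S S' : α → R → List Bool) : Prop :=
  Small ℓ S → PolyRuns M ℓ p S S'

/-- Smallness of the stacks passes through the first program by `PolyRuns.small`, so in a long
sequence it has to be checked only for the initial stacks. -/
theorem PolyTrans.seq (h : PolyTrans M ℓ p S S') (h' : PolyTrans M ℓ q S' S'') :
    PolyTrans M ℓ (.seq p q) S S'' :=
  fun hS => (h hS).seq (h' ((h hS).small hS))

theorem PolyTrans.congr (h : PolyTrans M ℓ p S S') (hS : ∀ a, S' a = S'' a) :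
    PolyTrans M ℓ p S S'' :=
  fun h' => (h h').congr hS

theorem polyTrans_moveBits {src d : R} (hd : d ≠ src) :
    PolyTrans M ℓ (moveBits src d) S (fun a =>
      Function.update (Function.update (S a) src []) d ((S a src).reverse ++ S a d)) :=
  fun hS => ⟨_, ((PolyBdd.const 2).mul (hS src)).add (PolyBdd.const 1),
    fun a => runs_moveBits hd (S a)⟩

theorem polyTrans_moveBits₂ {src d e : R} (hd : d ≠ src) (he : e ≠ src) (hde : d ≠ e) :
    PolyTrans M ℓ (moveBits₂ src d e) S (fun a =>
      Function.update (Function.update (Function.update (S a) src []) d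
        ((S a src).reverse ++ S a d)) e ((S a src).reverse ++ S a e)) :=
  fun hS => ⟨_, ((PolyBdd.const 3).mul (hS src)).add (PolyBdd.const 1),
    fun a => runs_moveBits₂ hd he hde (S a)⟩

theorem polyTrans_appendTo {t src d : R} (hd : d ≠ src) (ht : t ≠ src) (hdt : d ≠ t)
    (h : ∀ a, S a t = []) :
    PolyTrans M ℓ (appendTo t src d) S (fun a =>
      Function.update (S a) d ((S a src).reverse ++ S a d)) :=
  fun hS => ⟨_, ((PolyBdd.const 5).mul (hS src)).add (PolyBdd.const 2),
    fun a => runs_appendTo hd ht hdt (S a) (h a)⟩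

theorem polyTrans_clear {r : R} :
    PolyTrans M ℓ (clear r) S (fun a => Function.update (S a) r []) :=
  fun hS => ⟨_, ((PolyBdd.const 2).mul (hS r)).add (PolyBdd.const 1), fun a => runs_clear (S a)⟩

theorem polyTrans_pushAll {r : R} (l : List Bool) :
    PolyTrans M ℓ (pushAll r l) S (fun a => Function.update (S a) r (l ++ S a r)) :=
  fun _ => ⟨_, PolyBdd.const (l.length + 1), fun a => runs_pushAll l (S a)⟩

theorem polyTrans_call {β : Type} {ea : α → List Bool} {eb : β → List Bool} {f : α → β}
    (h : TM2ComputableInPolyTime ea eb f) {i : ι} (hi : M i = h.toTM2ComputableAux) (r : R)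
    (hS : ∀ a, S a r = (ea a).reverse) :
    PolyTrans M ℓ (.call i r) S (fun a => Function.update (S a) r (eb (f a)).reverse) :=
  fun hsm => PolyRuns.call h hi r hS ((hsm r).mono fun a => by simp [hS])

/-- Empty several stacks. -/
def clearAll : List R → Prog R ι
  | [] => .skip
  | r :: l => .seq (clear r) (clearAll l)

theorem polyTrans_clearAll (l : List R) :
    PolyTrans M ℓ (clearAll l) S (fun a r => if r ∈ l then [] else S a r) := by
  induction l generalizing S with
  | nil =>
    exact fun _ => ⟨_, PolyBdd.const 1, fun a => by
      simp only [List.not_mem_nil, if_false]; exact Runs.skip⟩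
  | cons r l ih =>
    refine (polyTrans_clear.seq ih).congr fun a => ?_
    funext x
    simp only [Function.update_apply, List.mem_cons]
    split_ifs <;> simp_all

theorem computable_of_polyTrans [Fintype R] [Fintype ι] {β : Type} {ea : α → List Bool}
    {eb : β → List Bool} {f : α → β} (rin rout : R)
    (h : PolyTrans M (fun a => (ea a).length) p
      (fun a => Function.update (fun _ => []) rin (ea a))
      (fun a => Function.update (fun _ => []) rout (eb (f a)))) :
    Nonempty (TM2ComputableInPolyTime ea eb f) := by
  refine computable_of_polyRuns rin rout (h fun r => PolyBdd.self.mono fun a => ?_)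
  change List.length (Function.update (fun _ => []) rin (ea a) r) ≤ _
  rw [Function.update_apply]
  split_ifs <;> simp

end Trans

/-! ### Building blocks: repetition, parsing, output -/

section Pieces

variable {ι : Type} [DecidableEq ι] {M : ι → TM2ComputableAux Bool Bool}
  {α : Type} {ℓ : α → ℕ} {S : α → Reg → List Bool} {o : α → List Bool}

/-- Push the bits `l` once for each bit in `size`. -/
def pushEach (d : Reg) (l : List Bool) : Prog Reg ι :=
  .seq (appendTo .tmp .size .wires) (.loopS .wires (pushAll d l) (pushAll d l))

theorem runs_pushLoop {d : Reg} (hd : d ≠ .wires) (l : List Bool) (S : Reg → List Bool) :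
    Runs M (.loopS .wires (pushAll d l) (pushAll d l)) S ((l.length + 2) * (S .wires).length + 1)
      (Function.update (Function.update S .wires []) d
        ((List.replicate (S .wires).length l).flatten ++ S d)) := by
  generalize h : S .wires = v
  induction v generalizing S with
  | nil =>
    refine (Runs.loopS_nil h).congr (by simp) ?_
    funext x
    simp only [Function.update_apply]
    split_ifs <;> simp_all
  | cons b v ih =>
    have h1 : Runs M (cond b (pushAll d l) (pushAll d l)) (Function.update S .wires v)
        (l.length + 1) (Function.update (Function.update S .wires v) d (l ++ S d)) := by
      cases b
      all_goals
        refine (runs_pushAll l _).congr le_rfl ?_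
        rw [Function.update_of_ne hd]
    refine (Runs.loopS_cons h h1 (ih _ ?_)).congr ?_ ?_
    · simp [hd.symm]
    · simp only [List.length_cons]; ring_nf; omega
    · funext x
      simp only [Function.update_apply, List.length_cons, List.replicate_succ']
      split_ifs <;> simp_all

theorem polyTrans_pushEach {d : Reg} (hd : d ≠ .wires) (l : List Bool)
    (ht : ∀ a, S a .tmp = []) (hw : ∀ a, S a .wires = []) :
    PolyTrans M ℓ (pushEach d l) S (fun a =>
      Function.update (S a) d ((List.replicate (S a .size).length l).flatten ++ S a d)) := by
  refine PolyTrans.congr (PolyTrans.seq (polyTrans_appendTo (by simp) (by simp) (by simp) ht)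
    fun hS => ⟨_, ((PolyBdd.const (l.length + 2)).mul (hS .wires)).add (PolyBdd.const 1),
      fun a => runs_pushLoop hd l _⟩) fun a => ?_
  funext x
  simp only [Function.update_apply]
  split_ifs <;> simp_all

/-- The bit string `x₁ y₁ⁿ x₂ y₂ⁿ …` for a list of pairs `(xᵢ, yᵢ)`. -/
def pattern : List (List Bool × List Bool) → ℕ → List Bool
  | [], _ => []
  | c :: l, n => c.1 ++ ((List.replicate n c.2).flatten ++ pattern l n)

/-- Write a pattern, where `n` is the number of bits in `size`. -/
def writePattern (d : Reg) : List (List Bool × List Bool) → Prog Reg ι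
  | [] => .skip
  | c :: l => .seq (writePattern d l) (.seq (pushEach d c.2) (pushAll d c.1))

theorem polyTrans_writePattern {d : Reg} (h1 : d ≠ .wires) (h2 : d ≠ .size) (h3 : d ≠ .tmp)
    (l : List (List Bool × List Bool)) (ht : ∀ a, S a .tmp = []) (hw : ∀ a, S a .wires = []) :
    PolyTrans M ℓ (writePattern d l) S (fun a =>
      Function.update (S a) d (pattern l (S a .size).length ++ S a d)) := by
  induction l with
  | nil =>
    exact fun _ => ⟨_, PolyBdd.const 1, fun a => by
      simp only [pattern, List.nil_append, Function.update_eq_self]; exact Runs.skip⟩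
  | cons c l ih =>
    refine PolyTrans.congr (ih.seq ((polyTrans_pushEach h1 c.2 ?_ ?_).seq
      (polyTrans_pushAll c.1))) fun a => ?_
    · intro a; rw [Function.update_of_ne h3.symm, ht]
    · intro a; rw [Function.update_of_ne h1.symm, hw]
    · simp [h2.symm, pattern]

/-- Move a code, recognized by the scanning program `p`, from `inp` to `d`. -/
def fetch (p : Prog Reg ι) (d : Reg) : Prog Reg ι :=
  .seq p (.seq (moveBits .bak d) (.seq (clear .out) (clear .pos)))

/-- The scanner is used only to find where the code ends: what it writes is thrown away, and the
original, kept in `bak`, is moved to `d`. -/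
theorem polyTrans_fetch {p : Prog Reg ι} {d : Reg} (hd : IsSrc d) (hd' : d ≠ .inp)
    {x y rest : α → List Bool} {n : α → ℕ}
    (h : ∀ a, Scans M 0 .inp p (x a) (y a) (n a) (9 * (x a).length))
    (hS : ∀ a, S a .inp = x a ++ rest a) (hout : ∀ a, S a .out = []) (hpos : ∀ a, S a .pos = [])
    (hbase : ∀ a, S a .base = []) (htmp : ∀ a, S a .tmp = []) (hbak : ∀ a, S a .bak = []) :
    PolyTrans M ℓ (fetch p d) S (fun a =>
      Function.update (Function.update (S a) .inp (rest a)) d (x a ++ S a d)) := by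
  obtain ⟨s1, s2, s3, s4, s5⟩ := hd
  have h1 : PolyTrans M ℓ p S fun a => scanned (S a) .inp (rest a) (x a) (y a) (n a) :=
    fun hsm => ⟨_, ((PolyBdd.const 9).mul (hsm .inp)).mono fun a => by
      rw [hS, List.length_append]; exact Nat.mul_le_mul_left 9 (Nat.le_add_right _ _),
      fun a => h a _ _ (hbase a) (htmp a) (hS a)⟩
  refine (h1.seq ((polyTrans_moveBits s5).seq (polyTrans_clear.seq polyTrans_clear))).congr
    fun a => ?_
  funext r
  simp only [scanned, Function.update_apply]
  split_ifs <;> simp_all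

theorem polyTrans_copyOut {r : Reg} (h1 : r ≠ .tmp) (h2 : r ≠ .out) (h3 : r ≠ .pos)
    (h4 : r ≠ .wires) (ht : ∀ a, S a .tmp = []) :
    PolyTrans M ℓ (appendTo .tmp r .out) (fun a => mid (S a) (o a) 0 [])
      (fun a => mid (S a) ((S a r).reverse ++ o a) 0 []) := by
  refine (polyTrans_appendTo h2.symm h1.symm (by simp) ?_).congr fun a => ?_
  · intro a; rw [mid_of_ne (by simp) (by simp) (by simp), ht]
  · rw [mid_of_ne h2 h3 h4]; simp

/-- Append a pattern to the output. -/
def emitPattern (l : List (List Bool × List Bool)) : Prog Reg ι :=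
  .seq (writePattern .res l) (moveBits .res .out)

theorem polyTrans_emitPattern (l : List (List Bool × List Bool)) (ht : ∀ a, S a .tmp = [])
    (hr : ∀ a, S a .res = []) :
    PolyTrans M ℓ (emitPattern l) (fun a => mid (S a) (o a) 0 [])
      (fun a => mid (S a) ((pattern l (S a .size).length).reverse ++ o a) 0 []) := by
  refine ((polyTrans_writePattern (by simp) (by simp) (by simp) l ?_ ?_).seq
    (polyTrans_moveBits (by simp))).congr fun a => ?_
  · intro a; rw [mid_of_ne (by simp) (by simp) (by simp), ht]
  · intro a; simp
  · have h1 : mid (S a) (o a) 0 [] .res = [] := by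
      rw [mid_of_ne (by simp) (by simp) (by simp), hr]
    have h2 : mid (S a) (o a) 0 [] .size = S a .size := mid_of_ne (by simp) (by simp) (by simp)
    funext r
    simp only [Function.update_apply, h1, h2]
    split_ifs <;> simp_all [mid, Function.update_apply]

/-- Write the code of a circuit with `n` inputs. -/
def emitCircuit (n m : ℕ) (args : Fin m → Expr) : Prog Reg ι :=
  .seq (pushAll .pos (List.replicate n true)) (.seq (emitTail 2 m args) (clear .pos))

/-- The counter `pos` starts at `n` because the inputs are the first `n` wires. Smallness of the
stacks that hold the context gives `CtxBdd`. -/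
theorem polyTrans_emitCircuit {C : α → Ctx} (hC : ∀ a, Holds (C a) (S a)) {ar on : Fin 3 → ℕ}
    (hon : ∀ a k, on k ≤ ((C a).outs k).length) (n m : ℕ) (args : Fin m → Expr)
    (hargs : ∀ i, (args i).WF n ar on) :
    PolyTrans M ℓ (emitCircuit n m args) (fun a => mid (S a) (o a) 0 [])
      (fun a => mid (S a) ((tailCode (C a) 2 args n).reverse ++ o a) 0 []) := by
  intro hS
  have hcb : CtxBdd ℓ C := by
    refine ⟨fun k => (hS (.G k)).mono fun a => ?_, fun k => (hS (.O k)).mono fun a => ?_,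
      fun k => (hS (.Q k)).mono fun a => ?_⟩
    all_goals
      change _ ≤ (mid _ _ _ _ _).length
      rw [mid_of_ne (by simp) (by simp) (by simp)]
    · rw [(hC a).G]
    · rw [(hC a).O]
    · rw [(hC a).Q]
  obtain ⟨p', -, h⟩ := polyRuns_emitTail (M := M) hC hcb hon 2 m args hargs o n
  refine PolyTrans.seq (S' := fun a => mid (S a) (o a) n [])
    ((polyTrans_pushAll _).congr fun a => ?_)
    (PolyTrans.seq (fun _ => h) (polyTrans_clear.congr fun a => ?_)) hS
  · simp
  · exact update_mid_pos 0

/-- Empty all stacks except `out`, and move its contents to `res`. -/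
noncomputable def finish : Prog Reg ι :=
  .seq (clearAll (Finset.univ.erase Reg.out).toList) (moveBits .out .res)

/-- The output was collected back to front, so one move puts it in order. -/
theorem polyTrans_finish : PolyTrans M ℓ finish S
    (fun a => Function.update (fun _ => []) .res (S a .out).reverse) := by
  refine ((polyTrans_clearAll _).seq (polyTrans_moveBits (by simp))).congr fun a => ?_
  funext r
  simp only [Function.update_apply, Finset.mem_toList, Finset.mem_erase, Finset.mem_univ, and_true]
  split_ifs <;> simp_all

end Pieces

/-- Stacks that hold an input, a bit string whose length is the size of the instance, codes of
circuits, and codes of rational numbers. -/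
def store (i z : List Bool) (G O : Fin 3 → List Bool) (Q : Fin 6 → List Bool) : Reg → List Bool
  | .inp => i
  | .size => z
  | .G k => G k
  | .O k => O k
  | .Q k => Q k
  | _ => []

section Store

variable {i z x : List Bool} {G O : Fin 3 → List Bool} {Q : Fin 6 → List Bool}

theorem update_store_inp : Function.update (store i z G O Q) .inp x = store x z G O Q := by
  funext r; cases r <;> simp [store]

theorem update_store_size : Function.update (store i z G O Q) .size x = store i x G O Q := by
  funext r; cases r <;> simp [store]

theorem update_store_G (k : Fin 3) :
    Function.update (store i z G O Q) (.G k) x = store i z (Function.update G k x) O Q := by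
  funext r; cases r <;> simp [store, Function.update_apply]

theorem update_store_O (k : Fin 3) :
    Function.update (store i z G O Q) (.O k) x = store i z G (Function.update O k x) Q := by
  funext r; cases r <;> simp [store, Function.update_apply]

theorem update_store_Q (k : Fin 6) :
    Function.update (store i z G O Q) (.Q k) x = store i z G O (Function.update Q k x) := by
  funext r; cases r <;> simp [store, Function.update_apply]

theorem mid_store : mid (store i z G O Q) [] 0 [] = store i z G O Q := by
  funext r; cases r <;> simp [store, mid]

theorem store_nil : store i [] (fun _ => []) (fun _ => []) (fun _ => []) =
    Function.update (fun _ => []) .inp i := by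
  funext r; cases r <;> simp [store]

end Store

/-! ### Loading circuits and constants into their places -/

section StoreTrans

variable {ι : Type} [DecidableEq ι] {M : ι → TM2ComputableAux Bool Bool}
  {α : Type} {ℓ : α → ℕ} {i z : α → List Bool} {G O : α → Fin 3 → List Bool}
  {Q : α → Fin 6 → List Bool}

/-- Move the code of a circuit from the input to its place. -/
def fetchCircuit (k : Fin 3) : Prog Reg ι :=
  .seq (fetch (scanGates .inp) (.G k)) (fetch (scanOutputs .inp) (.O k))

theorem polyTrans_fetchCircuit (k : Fin 3) {n m : α → ℕ} (A : ∀ a, ArithCircuit (n a) (m a))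
    (hi : ∀ a, ∃ rest, i a = (A a).encode ++ rest) (hG : ∀ a, G a k = []) (hO : ∀ a, O a k = []) :
    PolyTrans M ℓ (fetchCircuit k) (fun a => store (i a) (z a) (G a) (O a) (Q a))
      (fun a => store ((i a).drop (A a).encode.length) (z a)
        (Function.update (G a) k (encList encGate (A a).gates))
        (Function.update (O a) k (encList encWire (List.ofFn (A a).outputs))) (Q a)) := by
  choose rest hi using hi
  refine PolyTrans.congr (PolyTrans.seq
    (polyTrans_fetch (by simp [IsSrc]) (by simp) (x := fun a => encList encGate (A a).gates)
      (rest := fun a => encList encWire (List.ofFn (A a).outputs) ++ rest a)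
      (fun a => (scans_gates isSrc_inp _).mono (by simp)) ?_ ?_ ?_ ?_ ?_ ?_)
    (polyTrans_fetch (by simp [IsSrc]) (by simp)
      (x := fun a => encList encWire (List.ofFn (A a).outputs)) (rest := rest)
      (fun a => (scans_outputs isSrc_inp _).mono (by simp)) ?_ ?_ ?_ ?_ ?_ ?_)) fun a => ?_
  · intro a; simp [store, hi, ArithCircuit.encode]
  all_goals try (intro a; simp [store, hi])
  simp only [update_store_inp, update_store_G, update_store_O]
  simp [store, hG, hO, hi]

theorem polyTrans_fetchRat (k : Fin 6) (q : α → ℚ)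
    (hi : ∀ a, ∃ rest, i a = encRat (q a) ++ rest) (hQ : ∀ a, Q a k = []) :
    PolyTrans M ℓ (fetch (scanRat .inp) (.Q k)) (fun a => store (i a) (z a) (G a) (O a) (Q a))
      (fun a => store ((i a).drop (encRat (q a)).length) (z a) (G a) (O a)
        (Function.update (Q a) k (encRat (q a)))) := by
  choose rest hi using hi
  refine PolyTrans.congr (polyTrans_fetch (by simp [IsSrc]) (by simp) (x := fun a => encRat (q a))
      (rest := rest) (fun a => scans_rat isSrc_inp _) ?_ ?_ ?_ ?_ ?_ ?_) fun a => ?_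
  all_goals try (intro a; simp [store, hi])
  simp only [update_store_inp, update_store_Q]
  simp [store, hQ, hi]

/-- Record the size of the input. -/
def measure : Prog Reg ι := appendTo .tmp .inp .size

theorem polyTrans_measure (hz : ∀ a, z a = []) :
    PolyTrans M ℓ measure (fun a => store (i a) (z a) (G a) (O a) (Q a))
      (fun a => store (i a) (i a).reverse (G a) (O a) (Q a)) := by
  refine (polyTrans_appendTo (by simp) (by simp) (by simp) fun a => rfl).congr fun a => ?_
  rw [update_store_size]
  simp [store, hz]

theorem polyTrans_writeQ (k : Fin 6) (l : List (List Bool × List Bool)) (hQ : ∀ a, Q a k = []) :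
    PolyTrans M ℓ (writePattern (.Q k) l) (fun a => store (i a) (z a) (G a) (O a) (Q a))
      (fun a => store (i a) (z a) (G a) (O a)
        (Function.update (Q a) k (pattern l (z a).length))) := by
  refine (polyTrans_writePattern (by simp) (by simp) (by simp) l (fun _ => rfl)
    fun _ => rfl).congr fun a => ?_
  rw [update_store_Q]
  simp [store, hQ]

/-- Write the code of the circuit that copies `n` inputs in third place. -/
def writeId (n : ℕ) : Prog Reg ι :=
  .seq (pushAll (.G 2) (encList encGate [])) (pushAll (.O 2) (encList encWire
    (List.ofFn fun j : Fin n => j.val)))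

theorem polyTrans_writeId (n : ℕ) (hG : ∀ a, G a 2 = []) (hO : ∀ a, O a 2 = []) :
    PolyTrans M ℓ (writeId n) (fun a => store (i a) (z a) (G a) (O a) (Q a))
      (fun a => store (i a) (z a) (Function.update (G a) 2 (encList encGate (idCircuit n).gates))
        (Function.update (O a) 2 (encList encWire (List.ofFn (idCircuit n).outputs))) (Q a)) := by
  refine ((polyTrans_pushAll _).seq (polyTrans_pushAll _)).congr fun a => ?_
  simp only [update_store_G, update_store_O]
  simp [store, hG, hO, idCircuit]

end StoreTrans

/-! ### Patterns of some rational numbers -/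

theorem flatten_replicate_encBits (b : Bool) (n : ℕ) :
    (List.replicate n [true, b]).flatten = (List.replicate n b).flatMap fun c => [true, c] := by
  simp [List.flatMap_replicate]

/-- The least significant bit comes first, so a power of two is a run of zeros and a final one: a
single loop writes it. -/
theorem bits_two_pow (n : ℕ) : (2 ^ n).bits = List.replicate n false ++ [true] := by
  induction n with
  | zero => rfl
  | succ n ih =>
    rw [pow_succ, Nat.mul_comm, Nat.bit0_bits _ (by positivity), ih, List.replicate_succ]
    rfl

theorem bits_two_pow_sub_one (n : ℕ) : (2 ^ n - 1).bits = List.replicate n true := by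
  induction n with
  | zero => rfl
  | succ n ih =>
    have : 2 ^ (n + 1) - 1 = 2 * (2 ^ n - 1) + 1 := by
      have := Nat.one_le_two_pow (n := n)
      rw [pow_succ]; omega
    rw [this, Nat.bit1_bits, ih, List.replicate_succ]

theorem encRat_two_pow (n : ℕ) : encRat (2 ^ n) =
    pattern [([false], [true, false]), ([true, true, false, true, true, false], [])] n := by
  have h1 : ((2 : ℚ) ^ n).num = 2 ^ n := by
    rw [show (2 : ℚ) ^ n = ((2 ^ n : ℤ) : ℚ) by push_cast; rfl, Rat.num_intCast]
  have h2 : ((2 : ℚ) ^ n).den = 1 := by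
    rw [show (2 : ℚ) ^ n = ((2 ^ n : ℤ) : ℚ) by push_cast; rfl, Rat.den_intCast]
  have h3 : ((2 : ℤ) ^ n).natAbs = 2 ^ n := by simp [Int.natAbs_pow]
  have h4 : ¬ ((2 : ℤ) ^ n < 0) := not_lt.2 (by positivity)
  rw [encRat, h1, h2, h3, bits_two_pow]
  simp [h4, encBits, pattern, flatten_replicate_encBits]

theorem encRat_div_two_pow (a n : ℕ) (h : a.Coprime (2 ^ n)) : encRat ((a : ℚ) / 2 ^ n) =
    false :: (encBits a.bits ++ encBits (List.replicate n false ++ [true])) := by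
  have h0 : ((2 ^ n : ℕ) : ℤ) ≠ 0 := by positivity
  have e : (a : ℚ) / 2 ^ n = ((a : ℤ) : ℚ) / ((2 ^ n : ℤ) : ℚ) := by push_cast; rfl
  have h1 : ((a : ℚ) / 2 ^ n).num = a := by
    rw [e]; exact Rat.num_div_eq_of_coprime (by positivity) (by simpa [Int.natAbs_pow] using h)
  have h2 : (((a : ℚ) / 2 ^ n).den : ℤ) = 2 ^ n := by
    rw [e]; exact Rat.den_div_eq_of_coprime (by positivity) (by simpa [Int.natAbs_pow] using h)
  have h2' : ((a : ℚ) / 2 ^ n).den = 2 ^ n := by exact_mod_cast h2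
  rw [encRat, h1, h2', bits_two_pow]
  simp

theorem encRat_inv_two_pow (n : ℕ) : encRat (1 / 2 ^ n) =
    pattern [([false, true, true, false], [true, false]), ([true, true, false], [])] n := by
  have := encRat_div_two_pow 1 n (Nat.coprime_one_left _)
  rw [Nat.cast_one] at this
  rw [this]
  simp [encBits, pattern, flatten_replicate_encBits]

theorem encRat_inv_four_pow (n : ℕ) : encRat (1 / 4 ^ n) =
    pattern [([false, true, true, false], [true, false, true, false]),
      ([true, true, false], [])] n := by
  rw [show (4 : ℚ) ^ n = 2 ^ (2 * n) by rw [pow_mul]; norm_num, encRat_inv_two_pow]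
  have : ∀ n, (List.replicate (2 * n) [true, false]).flatten =
      (List.replicate n [true, false, true, false]).flatten := by
    intro n
    induction n with
    | zero => rfl
    | succ n ih => rw [Nat.mul_succ]; simp [List.replicate_succ, ih]
  simp [pattern, this]

/-- The numerator `2 ^ n - 1` consists of `n` ones, and it is coprime to `2 ^ n`, so the fraction is
already in lowest terms as `encRat` requires. -/
theorem encRat_one_sub_inv_two_pow (n : ℕ) : encRat (1 - 1 / 2 ^ n) =
    pattern [([false], [true, true]), ([false], [true, false]), ([true, true, false], [])] n := by
  have hc : (2 ^ n - 1).Coprime (2 ^ n) := by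
    have h := Nat.coprime_self_sub_left (m := 1) (n := 2 ^ n) Nat.one_le_two_pow
    exact h.2 (Nat.coprime_one_left _)
  have e : (1 : ℚ) - 1 / 2 ^ n = ((2 ^ n - 1 : ℕ) : ℚ) / 2 ^ n := by
    rw [Nat.cast_sub Nat.one_le_two_pow]
    push_cast
    field_simp
  rw [e, encRat_div_two_pow _ _ hc, bits_two_pow_sub_one]
  simp [encBits, pattern, flatten_replicate_encBits]

theorem pattern_const (x : List Bool) (n : ℕ) : pattern [(x, [])] n = x := by
  simp [pattern]

/-! ### The machines of the reductions -/

/-- The stacks when the codes of the members of the context `C` are in place. -/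
def ctxStore (i z : List Bool) (C : Ctx) : Reg → List Bool :=
  store i z (fun k => encList encGate (C.gates k)) (fun k => encList encWire (C.outs k))
    (fun k => encRat (C.q k))

theorem holds_ctxStore (i z : List Bool) (C : Ctx) : Holds C (ctxStore i z C) :=
  ⟨rfl, rfl, rfl, fun _ => rfl, fun _ => rfl, fun _ => rfl⟩

theorem mid_ctxStore (i z : List Bool) (C : Ctx) : mid (ctxStore i z C) [] 0 [] = ctxStore i z C :=
  mid_store

section Load

variable {ι : Type} [DecidableEq ι] {M : ι → TM2ComputableAux Bool Bool}
  {α : Type} {ℓ : α → ℕ} {i z : α → List Bool} {G O : α → Fin 3 → List Bool}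
  {Q : α → Fin 6 → List Bool}

theorem polyTrans_loadCircuits {n₀ m₀ n₁ m₁ n₂ : ℕ} {m₂ : α → ℕ} (A : α → ArithCircuit n₀ m₀)
    (B : α → ArithCircuit n₁ m₁) (T : ∀ a, ArithCircuit n₂ (m₂ a)) (q : α → Fin 6 → ℚ)
    (rest : α → List Bool) (hi : ∀ a, i a = (A a).encode ++ ((B a).encode ++ rest a))
    (hG0 : ∀ a, G a 0 = []) (hG1 : ∀ a, G a 1 = [])
    (hG2 : ∀ a, G a 2 = encList encGate (T a).gates)
    (hO0 : ∀ a, O a 0 = []) (hO1 : ∀ a, O a 1 = [])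
    (hO2 : ∀ a, O a 2 = encList encWire (List.ofFn (T a).outputs)) :
    PolyTrans M ℓ (.seq (fetchCircuit 0) (fetchCircuit 1))
      (fun a => store (i a) (z a) (G a) (O a) (Q a))
      (fun a => store (rest a) (z a)
        (fun k => encList encGate ((ctx₃ (A a) (B a) (T a) (q a)).gates k))
        (fun k => encList encWire ((ctx₃ (A a) (B a) (T a) (q a)).outs k)) (Q a)) := by
  refine (PolyTrans.seq (polyTrans_fetchCircuit 0 A (fun a => ⟨_, hi a⟩) hG0 hO0)
    (polyTrans_fetchCircuit 1 B (fun a => ⟨rest a, ?_⟩) ?_ ?_)).congr fun a => ?_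
  · simp [hi]
  · intro a; simp [hG1]
  · intro a; simp [hO1]
  · congr 1
    · simp [hi]
    · funext k; fin_cases k <;> simp [ctx₃, hG2]
    · funext k; fin_cases k <;> simp [ctx₃, hO2]

/-- Write patterns to the places of constants. -/
def writeQs (t : Fin 6 → List (List Bool × List Bool)) : List (Fin 6) → Prog Reg ι
  | [] => .skip
  | k :: l => .seq (writePattern (.Q k) (t k)) (writeQs t l)

theorem polyTrans_writeQs (t : Fin 6 → List (List Bool × List Bool)) (l : List (Fin 6))
    (hl : l.Nodup) (hQ : ∀ a, ∀ k ∈ l, Q a k = []) :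
    PolyTrans M ℓ (writeQs t l) (fun a => store (i a) (z a) (G a) (O a) (Q a))
      (fun a => store (i a) (z a) (G a) (O a)
        (fun k => if k ∈ l then pattern (t k) (z a).length else Q a k)) := by
  induction l generalizing Q with
  | nil =>
    exact fun _ => ⟨_, PolyBdd.const 1, fun a => by
      simp only [List.not_mem_nil, if_false]; exact Runs.skip⟩
  | cons k l ih =>
    obtain ⟨hk, hl⟩ := List.nodup_cons.1 hl
    refine ((polyTrans_writeQ k (t k) fun a => hQ a k (by simp)).seq
      (ih hl fun a j hj => ?_)).congr fun a => ?_
    · rw [Function.update_of_ne (by rintro rfl; exact hk hj)]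
      exact hQ a j (by simp [hj])
    · congr 1
      funext j
      simp only [Function.update_apply, List.mem_cons]
      split_ifs <;> simp_all

/-- The initial stacks. -/
theorem initial_eq (x : α → List Bool) : (fun a => Function.update (fun _ => []) Reg.inp (x a)) =
    fun a => store (x a) [] (fun _ => []) (fun _ => []) (fun _ => []) := by
  funext a; exact store_nil.symm

theorem polyTrans_emitAndFinish {C : α → Ctx} (n m : ℕ) (args : Fin m → Expr) {ar on : Fin 3 → ℕ}
    (hon : ∀ a k, on k ≤ ((C a).outs k).length) (hargs : ∀ i, (args i).WF n ar on) :
    PolyTrans M ℓ (.seq (emitCircuit n m args) finish) (fun a => ctxStore (i a) (z a) (C a))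
      (fun a => Function.update (fun _ => []) .res (tailCode (C a) 2 args n)) := by
  have h := polyTrans_emitCircuit (M := M) (ℓ := ℓ) (o := fun _ => [])
    (fun a => holds_ctxStore (i a) (z a) (C a)) hon n m args hargs
  simp only [mid_ctxStore] at h
  exact (h.seq polyTrans_finish).congr fun a => by simp

/-- Both reductions keep the function `f`, so an instance is written as a copy of circuit `0`, then
the constructed circuit, then numbers written by `p`. -/
theorem polyTrans_emitInstance {C : α → Ctx} (n m : ℕ) (args : Fin m → Expr) {ar on : Fin 3 → ℕ}
    (hon : ∀ a k, on k ≤ ((C a).outs k).length) (hargs : ∀ i, (args i).WF n ar on)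
    {p : Prog Reg ι} {y : α → List Bool}
    (hp : ∀ o : α → List Bool, PolyTrans M ℓ p
      (fun a => mid (ctxStore (i a) (z a) (C a)) (o a) 0 [])
      (fun a => mid (ctxStore (i a) (z a) (C a)) ((y a).reverse ++ o a) 0 [])) :
    PolyTrans M ℓ (.seq (appendTo .tmp (.G 0) .out) (.seq (appendTo .tmp (.O 0) .out)
      (.seq (emitCircuit n m args) (.seq p finish))))
      (fun a => ctxStore (i a) (z a) (C a))
      (fun a => Function.update (fun _ => []) .res
        ((encList encGate ((C a).gates 0) ++ encList encWire ((C a).outs 0)) ++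
          (tailCode (C a) 2 args n ++ y a))) := by
  have h := (polyTrans_copyOut (M := M) (ℓ := ℓ) (S := fun a => ctxStore (i a) (z a) (C a))
    (o := fun _ => []) (r := .G 0) (by simp) (by simp) (by simp) (by simp) fun _ => rfl).seq
    ((polyTrans_copyOut (r := .O 0) (by simp) (by simp) (by simp) (by simp) fun _ => rfl).seq
    ((polyTrans_emitCircuit (fun a => holds_ctxStore (i a) (z a) (C a)) hon n m args hargs).seq
    ((hp _).seq polyTrans_finish)))
  simp only [mid_ctxStore] at h
  exact h.congr fun a => by simp [ctxStore, store]

end Load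

theorem on_le_outs {n₀ n₁ n₂ m₂ : ℕ} (A : ArithCircuit n₀ 3) (B : ArithCircuit n₁ 1)
    (T : ArithCircuit n₂ m₂) (q : Fin 6 → ℚ) (k : Fin 3) :
    onB k ≤ ((ctx₃ A B T q).outs k).length :=
  (valid_ctx₃ A B T q).on_le k

/-- The pattern of `1 / 2 ^ n`. -/
def patInv₂ : List (List Bool × List Bool) :=
  [([false, true, true, false], [true, false]), ([true, true, false], [])]

/-- The pattern of a constant. -/
def patConst (q : ℚ) : List (List Bool × List Bool) := [(encRat q, [])]

/-! ### Machines for the reduction from Banach to ContinuousLocalOpt -/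

section FromBanach

/-- The program that computes `BanachInstance.toCLO`. -/
noncomputable def toCLOProg : Prog Reg Empty :=
  .seq measure (.seq (writeId 1) (.seq (.seq (fetchCircuit 0) (fetchCircuit 1))
    (.seq (writeQs ![patConst 0, patConst 1, patInv₂, patConst (1 / 2), patConst 0, patConst 0]
      [0, 1, 2, 3, 4, 5])
    (.seq (appendTo .tmp (.G 0) .out) (.seq (appendTo .tmp (.O 0) .out)
      (.seq (emitCircuit 3 1 fun _ => ePot fun i => .inp i.val)
      (.seq (.seq
        (emitPattern [([false, true, true, false], [true, false, true, false]),
          ([true, true, false], [])])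
        (emitPattern [([false], [true, false]), ([true, true, false, true, true, false], [])]))
        finish)))))))

theorem computable_toCLO :
    Nonempty (TM2ComputableInPolyTime BanachInstance.encode CLOInstance.encode
      BanachInstance.toCLO) := by
  refine computable_of_polyTrans (M := fun e : Empty => e.elim) (p := toCLOProg) .inp .res ?_
  rw [initial_eq]
  set C : BanachInstance → Ctx := fun I =>
    ctx₃ I.f I.d (idCircuit 1) (consts (1 / 2 ^ I.encode.length) (1 / 2) 0 0) with hC
  refine PolyTrans.congr ((polyTrans_measure fun _ => rfl).seq
    ((polyTrans_writeId 1 (fun _ => rfl) fun _ => rfl).seq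
    ((polyTrans_loadCircuits BanachInstance.f BanachInstance.d (fun _ => idCircuit 1)
      (fun I => consts (1 / 2 ^ I.encode.length) (1 / 2) 0 0)
      (fun I => encRat I.ε ++ (encRat I.lam ++ encRat I.c)) (fun _ => rfl)
      ?_ ?_ ?_ ?_ ?_ ?_).seq
    (((polyTrans_writeQs _ [0, 1, 2, 3, 4, 5] (by decide) fun _ _ _ => rfl).congr
      (S'' := fun I => ctxStore (encRat I.ε ++ (encRat I.lam ++ encRat I.c)) I.encode.reverse (C I)) fun I => ?_).seq
    (polyTrans_emitInstance 3 1 _ (fun I => on_le_outs _ _ _ _) (fun _ => wf_ePot (k := 1) wf_inp)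
      (y := fun I => encRat (1 / 4 ^ I.encode.length) ++ encRat (2 ^ I.encode.length))
      fun o => ((polyTrans_emitPattern _ (fun _ => rfl) fun _ => rfl).seq
        (polyTrans_emitPattern _ (fun _ => rfl) fun _ => rfl)).congr fun I => ?_))))) fun I => ?_
  all_goals try (intro I; simp)
  · rw [ctxStore]
    congr 1
    funext k
    have h := encRat_inv_two_pow I.encode.length
    rw [one_div] at h
    fin_cases k <;> simp [hC, ctx₃, consts, patConst, patInv₂, pattern_const, h]
  · rw [encRat_inv_four_pow, encRat_two_pow]
    simp [ctxStore, store]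
  · have h := encode_apply₃ I.f I.d (idCircuit 1) (consts (1 / 2 ^ I.encode.length) (1 / 2) 0 0) 3
      (fun _ => ePot fun i => .inp i) fun _ => wf_ePot wf_inp
    rw [← h]
    rfl

/-- The program that computes `BanachInstance.fromCLO`. -/
noncomputable def fromCLOProg : Prog Reg Empty :=
  .seq (writeId (4 * 3)) (.seq (.seq (fetchCircuit 0) (fetchCircuit 1))
    (.seq (fetch (scanRat .inp) (.Q 2)) (.seq (fetch (scanRat .inp) (.Q 3))
    (.seq (fetch (scanRat .inp) (.Q 4))
    (.seq (writeQs ![patConst 0, patConst 1, [], [], [], patConst 0] [0, 1, 5])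
    (.seq (emitCircuit (2 * 3) (4 * 3) pickB) finish))))))

theorem computable_fromCLO :
    Nonempty (TM2ComputableInPolyTime BanachInstance.encode id fun I => I.fromCLO.encode) := by
  refine computable_of_polyTrans (M := fun e : Empty => e.elim) (p := fromCLOProg) .inp .res ?_
  rw [initial_eq]
  set C : BanachInstance → Ctx := fun I =>
    ctx₃ I.f I.d (idCircuit (4 * 3)) (consts I.ε I.lam I.c 0) with hC
  refine PolyTrans.congr ((polyTrans_writeId (4 * 3) (fun _ => rfl) fun _ => rfl).seq
    ((polyTrans_loadCircuits BanachInstance.f BanachInstance.d (fun _ => idCircuit (4 * 3))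
      (fun I => consts I.ε I.lam I.c 0)
      (fun I => encRat I.ε ++ (encRat I.lam ++ encRat I.c)) (fun _ => rfl)
      ?_ ?_ ?_ ?_ ?_ ?_).seq
    ((polyTrans_fetchRat 2 BanachInstance.ε (fun I => ⟨encRat I.lam ++ encRat I.c, rfl⟩)
      fun _ => rfl).seq
    ((polyTrans_fetchRat 3 BanachInstance.lam (fun I => ⟨encRat I.c, by simp⟩) fun _ => by simp).seq
    ((polyTrans_fetchRat 4 BanachInstance.c (fun I => ⟨[], by simp⟩) fun _ => by simp).seq
    (((polyTrans_writeQs _ [0, 1, 5] (by decide) fun _ _ hk => ?_).congr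
      (S'' := fun I => ctxStore [] [] (C I)) fun I => ?_).seq
    (polyTrans_emitAndFinish (2 * 3) (4 * 3) pickB (fun I => on_le_outs _ _ _ _)
      (wf_pickB (k := 4 * 3)))))))))
    fun I => ?_
  all_goals try (intro I; simp)
  · simp only [List.mem_cons, List.not_mem_nil, or_false] at hk
    rcases hk with rfl | rfl | rfl <;> simp
  · rw [ctxStore]
    congr 1
    · simp
    · funext k
      fin_cases k <;> simp [hC, ctx₃, consts, patConst, pattern_const]
  · have h := encode_apply₃ I.f I.d (idCircuit (4 * 3)) (consts I.ε I.lam I.c 0) (2 * 3) pickB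
      wf_pickB
    rw [← h]
    rfl

end FromBanach

theorem banach_mem_CLS : Banach ∈ CLS :=
  ⟨BanachInstance.toCLO, BanachInstance.fromCLO, computable_toCLO, computable_fromCLO,
    BanachInstance.isSolution_fromCLO⟩

/-! ### Machines for the reduction from a problem in CLS to Banach -/

section ToBanach

variable {P : SearchProblem} {φ : P.Inst → CLOInstance}
  {ψ : (I : P.Inst) → ArithCircuit (2 * 3) (P.dim I)}

/-- Load the circuits and constants of an instance of ContinuousLocalOpt from the input. -/
def loadCLO : Prog Reg Bool :=
  .seq (.seq (fetchCircuit 0) (fetchCircuit 1))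
    (.seq (fetch (scanRat .inp) (.Q 2)) (.seq (fetch (scanRat .inp) (.Q 3))
    (writeQs ![patConst 0, patConst 1, [], [], patConst 0, patConst 0] [0, 1, 4, 5])))

theorem polyTrans_loadCLO {M : Bool → TM2ComputableAux Bool Bool} {α : Type} {ℓ : α → ℕ}
    (J : α → CLOInstance) {n₂ : ℕ} {m₂ : α → ℕ} (T : ∀ a, ArithCircuit n₂ (m₂ a))
    {z : α → List Bool} {G O : α → Fin 3 → List Bool}
    (hG0 : ∀ a, G a 0 = []) (hG1 : ∀ a, G a 1 = [])
    (hG2 : ∀ a, G a 2 = encList encGate (T a).gates)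
    (hO0 : ∀ a, O a 0 = []) (hO1 : ∀ a, O a 1 = [])
    (hO2 : ∀ a, O a 2 = encList encWire (List.ofFn (T a).outputs)) :
    PolyTrans M ℓ loadCLO (fun a => store (J a).encode (z a) (G a) (O a) fun _ => [])
      (fun a => ctxStore [] (z a)
        (ctx₃ (J a).f (J a).p (T a) (consts (J a).ε (J a).lam 0 0))) := by
  refine PolyTrans.congr ((polyTrans_loadCircuits (fun a => (J a).f) (fun a => (J a).p) T
      (fun a => consts (J a).ε (J a).lam 0 0)
      (fun a => encRat (J a).ε ++ encRat (J a).lam) (fun _ => rfl)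
      hG0 hG1 hG2 hO0 hO1 hO2).seq
    ((polyTrans_fetchRat 2 (fun a => (J a).ε) (fun a => ⟨encRat (J a).lam, rfl⟩)
      fun _ => rfl).seq
    ((polyTrans_fetchRat 3 (fun a => (J a).lam) (fun a => ⟨[], by simp⟩) fun _ => by simp).seq
    (polyTrans_writeQs _ [0, 1, 4, 5] (by decide) fun _ _ hk => ?_)))) fun a => ?_
  · simp only [List.mem_cons, List.not_mem_nil, or_false] at hk
    rcases hk with rfl | rfl | rfl | rfl <;> simp
  · rw [ctxStore]
    congr 1
    · simp
    · funext k
      fin_cases k <;> simp [ctx₃, consts, patConst, pattern_const]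

/-- The program that computes `CLOInstance.toBanach`, after calling a machine. -/
noncomputable def toBanachProg : Prog Reg Bool :=
  -- Moving reverses the input, as a call expects. The call leaves the code of `φ I` reversed in
  -- `size`, which then serves as source for `inp` and, by its length, as exponent for the patterns.
  .seq (moveBits .inp .size) (.seq (.call false .size) (.seq (appendTo .tmp .size .inp)
    (.seq (writeId 1) (.seq loadCLO
    (.seq (appendTo .tmp (.G 0) .out) (.seq (appendTo .tmp (.O 0) .out)
      (.seq (emitCircuit (2 * 3) 1 fun _ => eMetric (eInput 2 0) (eInput 2 1))
      (.seq (.seq (emitPattern patInv₂) (.seq (appendTo .tmp (.Q 3) .out)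
        (emitPattern [([false], [true, true]), ([false], [true, false]), ([true, true, false], [])])))
        finish))))))))

theorem computable_toBanach (h : TM2ComputableInPolyTime P.encode CLOInstance.encode φ) :
    Nonempty (TM2ComputableInPolyTime P.encode BanachInstance.encode fun I => (φ I).toBanach) := by
  refine computable_of_polyTrans (M := fun _ : Bool => h.toTM2ComputableAux) (p := toBanachProg)
    .inp .res ?_
  rw [initial_eq]
  refine PolyTrans.congr (((polyTrans_moveBits (by simp)).congr (S'' := fun I =>
      store [] (P.encode I).reverse (fun _ => []) (fun _ => []) (fun _ => [])) fun I => ?_).seq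
    (((polyTrans_call h rfl .size fun _ => rfl).congr (S'' := fun I =>
      store [] (φ I).encode.reverse (fun _ => []) (fun _ => []) (fun _ => [])) fun I => ?_).seq
    (((polyTrans_appendTo (by simp) (by simp) (by simp) fun _ => rfl).congr (S'' := fun I =>
      store (φ I).encode (φ I).encode.reverse (fun _ => []) (fun _ => []) (fun _ => []))
      fun I => ?_).seq
    ((polyTrans_writeId 1 (fun _ => rfl) fun _ => rfl).seq
    ((polyTrans_loadCLO φ (fun _ => idCircuit 1) ?_ ?_ ?_ ?_ ?_ ?_).seq
    (polyTrans_emitInstance (2 * 3) 1 _ (fun I => on_le_outs _ _ _ _)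
      (fun _ => wf_eMetric (k := 1) (wf_eInput 2 0) (wf_eInput 2 1))
      (y := fun I => encRat (1 / 2 ^ (φ I).encode.length) ++ (encRat (φ I).lam ++
        encRat (1 - 1 / 2 ^ (φ I).encode.length)))
      fun o => ((polyTrans_emitPattern _ (fun _ => rfl) fun _ => rfl).seq
        ((polyTrans_copyOut (by simp) (by simp) (by simp) (by simp) fun _ => rfl).seq
        (polyTrans_emitPattern _ (fun _ => rfl) fun _ => rfl))).congr fun I => ?_)))))) fun I => ?_
  all_goals try (intro I; simp)
  · simp [update_store_inp, update_store_size, store]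
  · rw [update_store_size]
  · simp [update_store_inp, store]
  · rw [encRat_inv_two_pow, encRat_one_sub_inv_two_pow]
    simp [ctxStore, store, patInv₂, ctx₃, consts]
  · have h := encode_apply₃ (φ I).f (φ I).p (idCircuit 1) (consts (φ I).ε (φ I).lam 0 0) (2 * 3)
      (fun _ => eMetric (eInput 2 0) (eInput 2 1))
      fun _ => wf_eMetric (wf_eInput 2 0) (wf_eInput 2 1)
    rw [← h]
    rfl

/-- The program that computes `CLOInstance.fromBanach`, after calling two machines. -/
noncomputable def fromBanachProg : Prog Reg Bool :=
  -- Each machine gets its own copy of the input. The circuit `ψ I` is parsed into third place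
  -- first, while the code of `φ I` waits in `size`.
  .seq (.seq (moveBits₂ .inp .size .res) (.seq (.call false .size) (.seq (.call true .res)
    (moveBits .res .inp)))) (.seq (fetchCircuit 2) (.seq (appendTo .tmp .size .inp)
    (.seq loadCLO (.seq (emitCircuit (4 * 3) (2 * 3) pickC) finish))))

theorem computable_fromBanach (h : TM2ComputableInPolyTime P.encode CLOInstance.encode φ)
    (h' : TM2ComputableInPolyTime P.encode id fun I => (ψ I).encode) :
    Nonempty (TM2ComputableInPolyTime P.encode id
      fun I => ((φ I).fromBanach (ψ I)).encode) := by
  refine computable_of_polyTrans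
    (M := fun b : Bool => cond b h'.toTM2ComputableAux h.toTM2ComputableAux) (p := fromBanachProg)
    .inp .res ?_
  rw [initial_eq]
  refine PolyTrans.congr ((((polyTrans_moveBits₂ (src := .inp) (d := .size) (e := .res) (by simp) (by simp) (by simp)).seq
    ((polyTrans_call (i := false) h rfl .size fun _ => ?_).seq ((polyTrans_call (i := true) h' rfl .res fun _ => ?_).seq
    (polyTrans_moveBits (src := .res) (d := .inp) (by simp))))).congr (S'' := fun I =>
      store (ψ I).encode (φ I).encode.reverse (fun _ => []) (fun _ => []) (fun _ => []))
      fun I => ?_).seq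
    ((polyTrans_fetchCircuit 2 ψ (fun I => ⟨[], by simp⟩) (fun _ => rfl) fun _ => rfl).seq
    (((polyTrans_appendTo (t := .tmp) (src := .size) (d := .inp) (by simp) (by simp) (by simp) fun _ => rfl).congr (S'' := fun I =>
      store (φ I).encode (φ I).encode.reverse
        (Function.update (fun _ => []) 2 (encList encGate (ψ I).gates))
        (Function.update (fun _ => []) 2 (encList encWire (List.ofFn (ψ I).outputs)))
        (fun _ => []))
      fun I => ?_).seq
    ((polyTrans_loadCLO φ ψ ?_ ?_ ?_ ?_ ?_ ?_).seq
    (polyTrans_emitAndFinish (4 * 3) (2 * 3) pickC (fun I => on_le_outs _ _ _ _)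
      (wf_pickC (k := 2 * 3)))))))
    fun I => ?_
  all_goals try (intro I; simp)
  · simp [store]
  · simp [store]
  · funext r
    cases r <;> simp [store]
  · simp [update_store_inp, store]
  · have h := encode_apply₃ (φ I).f (φ I).p (ψ I) (consts (φ I).ε (φ I).lam 0 0) (4 * 3) pickC
      wf_pickC
    rw [← h]
    rfl

end ToBanach

/-- The given reduction is absorbed instead of composed: its machines become subroutines of the new
ones, and `ψ I` becomes the last part of the new back-translation. -/
theorem banach_hard (P : SearchProblem) (hP : P ∈ CLS) : Reducible P Banach := by
  obtain ⟨φ, ψ, ⟨h⟩, ⟨h'⟩, hs⟩ := hP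
  refine ⟨fun I => CLOInstance.toBanach (φ I), fun I => CLOInstance.fromBanach (φ I) (ψ I),
    computable_toBanach h, computable_fromBanach h h', fun I s hsol => ?_⟩
  obtain ⟨v, hv, e⟩ := CLOInstance.exists_eval_fromBanach (φ I) (ψ I) s hsol
  exact (congrArg (P.IsSolution I) e).mpr (hs I v hv)

end BanachCLS

theorem mainTheorem3 :
    BanachCLS.Banach.Total ∧ BanachCLS.CLSComplete BanachCLS.Banach :=
  ⟨BanachCLS.banach_total, BanachCLS.banach_mem_CLS, BanachCLS.banach_hard⟩
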